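/- Let $m\ge 0$ be an integer and let $g>1$. Write $(r,\theta)$ for polar coordinates on $\mathbb{R}^2$, and let $H^1_m$ be the space of all $f\in H^1(\mathbb{R}^2;\mathbb{C})$ of the form $f(r,\theta)=e^{im\theta}u(r)$. For $f\in H^1_m$ put $$A_\theta[f](r)=-\frac12\int_0^r|f|^2\,s\,ds,\qquad A_0[f](r)=-\int_r^\infty\frac{m+A_\theta[f](s)}{s}\,|f|^2\,ds,$$ $$\operatorname{chg}(f)=\int_{\mathbb{R}^2}|f|^2\,dx,\qquad E(f)=\frac12\int_{\mathbb{R}^2}\Big(|\partial_r f|^2+\frac1{r^2}(m+A_\theta[f])^2|f|^2-\frac g2|f|^4\Big)dx .$$ Let $\phi\in H^1_m\setminus\{0\}$ satisfy $E(\phi)=0$, and suppose that $\operatorname{chg}(\phi)\le\operatorname{chg}(f)$ for every $f\in H^1_m\setminus\{0\}$ with $E(f)=0$. Then there exists $\lambda\in\mathbb{R}$ such that $\psi(t,x)=e^{i\lambda t}\phi(x)$, with the potentials $A_\theta=A_\theta[\psi(t)]=A_\theta[\phi]$, $A_0=A_0[\psi(t)]=A_0[\phi]$ and $A_r=0$,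 is a weak solution in $L^\infty_tH^1_m$ of the equivariant Chern-Simons-Schrödinger system $$\begin{cases}(i\partial_t+\Delta)\psi=\frac{2m}{r^2}A_\theta\psi+A_0\psi+\frac1{r^2}A_\theta^2\psi-g|\psi|^2\psi,\\ \partial_rA_0=\frac1r(m+A_\theta)|\psi|^2,\\ \partial_tA_\theta=r\,\mathrm{Im}(\bar\psi\,\partial_r\psi),\\ \partial_rA_\theta=-\frac12|\psi|^2r,\\ A_r=0,\end{cases}$$ with $A_\theta\to0$ as $r\to0$ and $A_0\to0$ as $r\to\infty$. Here "weak solution" means that both sides of every equation are distributions given by locally integrable functions (or distributional derivatives of such) and that the equations hold in the sense of distributions: the first and third on $\mathbb{R}\times\mathbb{R}^2$, the second and fourth on $\{(t,r): t\in\mathbb{R},\ r>0\}$. -/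

import Mathlib

open MeasureTheory Filter Topology
open scoped ContDiff

namespace EquivariantCSS

noncomputable section

/- The plane `ℝ²` is identified with `ℂ` through `x = x₁ + i x₂`; its norm is the Euclidean norm
and `volume` is Lebesgue measure.  The directions `∂₁`, `∂₂` are `1` and `Complex.I`. -/

/-- `∂_v f = F` in the sense of distributions on the open set `Ω`, where `f` and `F` are locally
integrable on `Ω`. -/
def HasWeakDerivOn {E V : Type*} [NormedAddCommGroup E] [NormedSpace ℝ E] [MeasureSpace E]
    [NormedAddCommGroup V] [NormedSpace ℝ V] (Ω : Set E) (v : E) (f F : E → V) : Prop :=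
  LocallyIntegrableOn f Ω ∧ LocallyIntegrableOn F Ω ∧
    ∀ η : E → ℝ, ContDiff ℝ ∞ η → HasCompactSupport η → tsupport η ⊆ Ω →
      ∫ x, fderiv ℝ η x v • f x = - ∫ x, η x • F x

open Classical in
/-- The weak partial derivative `∂_v f` on the whole plane (unique up to null sets; the value is
`0` if `f` has no weak derivative in the direction `v`). -/
def weakDeriv (v : ℂ) (f : ℂ → ℂ) : ℂ → ℂ :=
  if h : ∃ F : ℂ → ℂ, HasWeakDerivOn Set.univ v f F then h.choose else 0

theorem weakDeriv_spec {v : ℂ} {f : ℂ → ℂ} (h : ∃ F : ℂ → ℂ, HasWeakDerivOn Set.univ v f F) :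
    HasWeakDerivOn Set.univ v f (weakDeriv v f) := by
  unfold weakDeriv
  rw [dif_pos h]
  exact h.choose_spec

/-- `f ∈ H¹(ℝ²)`: the function and its weak first derivatives are square integrable. -/
def MemH1 (f : ℂ → ℂ) : Prop :=
  MemLp f 2 ∧
    (∃ F : ℂ → ℂ, HasWeakDerivOn Set.univ 1 f F ∧ MemLp F 2) ∧
    (∃ F : ℂ → ℂ, HasWeakDerivOn Set.univ Complex.I f F ∧ MemLp F 2)

/-- The square of the `H¹(ℝ²)` norm. -/
def h1NormSq (f : ℂ → ℂ) : ℝ :=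
  ∫ x, (‖f x‖ ^ 2 + ‖weakDeriv 1 f x‖ ^ 2 + ‖weakDeriv Complex.I f x‖ ^ 2)

/-- `f(r, θ) = e^{i m θ} u(r)` for some radial profile `u`. -/
def IsEquivariant (m : ℤ) (f : ℂ → ℂ) : Prop :=
  ∃ u : ℝ → ℂ, ∀ x : ℂ, f x = Complex.exp (Complex.I * m * x.arg) * u ‖x‖

/-- The equivariant Sobolev space `H¹_m`.  Its elements are given by the representatives that are
`m`-equivariant at every point; each class in `H¹_m` has one.  For these, `|f|` at radius `r` is
`‖f r‖`, the value on the positive half-axis. -/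
def MemH1m (m : ℤ) (f : ℂ → ℂ) : Prop :=
  IsEquivariant m f ∧ MemH1 f

/-- The charge `∫ |f|² dx`. -/
def charge (f : ℂ → ℂ) : ℝ := ∫ x, ‖f x‖ ^ 2

/-- The potential `A_θ(r) = -½ ∫₀^r |f|² s ds`. -/
def potTheta (f : ℂ → ℂ) (r : ℝ) : ℝ :=
  -(1 / 2) * ∫ s in (0 : ℝ)..r, ‖f (s : ℂ)‖ ^ 2 * s

/-- The potential `A₀(r) = -∫_r^∞ (m + A_θ(s)) / s |f|² ds`. -/
def potZero (m : ℤ) (f : ℂ → ℂ) (r : ℝ) : ℝ :=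
  - ∫ s in Set.Ioi r, (m + potTheta f s) / s * ‖f (s : ℂ)‖ ^ 2

/-- The radial derivative `∂_r = (x₁ ∂₁ + x₂ ∂₂) / |x|` at `x`, from the values `a`, `b` of `∂₁`
and `∂₂`. -/
def radialDeriv (x a b : ℂ) : ℂ :=
  ((x.re : ℂ) * a + (x.im : ℂ) * b) / (‖x‖ : ℂ)

/-- The energy `½ ∫ (|∂_r f|² + r⁻² |D_θ f|² - (g/2) |f|⁴) dx` of `f ∈ H¹_m`, where `A_r = 0`
and `D_θ f = (∂_θ + i A_θ) f = i (m + A_θ) f`. -/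
def energy (m : ℤ) (g : ℝ) (f : ℂ → ℂ) : ℝ :=
  (1 / 2) * ∫ x : ℂ,
    (‖radialDeriv x (weakDeriv 1 f x) (weakDeriv Complex.I f x)‖ ^ 2
      + 1 / ‖x‖ ^ 2 * ‖Complex.I * ((m + potTheta f ‖x‖ : ℝ) : ℂ) * f x‖ ^ 2
      - g / 2 * ‖f x‖ ^ 4)

/-- The nonlinearity `(2m/r²) A_θ φ + A₀ φ + (1/r²) A_θ² φ - g |φ|² φ` at radius `r`, from the
values `aT`, `a0`, `z` of `A_θ`, `A₀`, `φ`. -/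
def nonlinearity (m : ℤ) (g r aT a0 : ℝ) (z : ℂ) : ℂ :=
  ((2 * m / r ^ 2 * aT + a0 + 1 / r ^ 2 * aT ^ 2 - g * ‖z‖ ^ 2 : ℝ) : ℂ) * z

/-- `φ ∈ L^∞_t H¹_m`, defined for all times, with the radial potentials `A_θ(t, r)`, `A₀(t, r)`
and with `A_r = 0`, is a weak solution of the `m`-equivariant Chern-Simons-Schrödinger system

* `(i ∂_t + Δ) φ = (2m/r²) A_θ φ + A₀ φ + (1/r²) A_θ² φ - g |φ|² φ`,
* `∂_r A₀ = (1/r) (m + A_θ) |φ|²`,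
* `∂_t A_θ = r Im (conj φ ∂_r φ)`,
* `∂_r A_θ = - ½ |φ|² r`,

with `A_θ = 0` at `r = 0` and `A₀ → 0` as `r → ∞`.  The first and third equations hold in the
sense of distributions on `ℝ × ℝ²`, the other two on `ℝ × (0, ∞)`. -/
structure IsWeakSolution (m : ℤ) (g : ℝ) (φ : ℝ × ℂ → ℂ) (Aθ A₀ : ℝ × ℝ → ℝ) : Prop where
  locallyIntegrable : LocallyIntegrable φ
  memH1m : ∀ t : ℝ, MemH1m m (fun x => φ (t, x))
  bounded : ∃ C : ℝ, ∀ t : ℝ, h1NormSq (fun x => φ (t, x)) ≤ C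
  nonlinearity_locallyIntegrable : LocallyIntegrable (fun p : ℝ × ℂ =>
    nonlinearity m g ‖p.2‖ (Aθ (p.1, ‖p.2‖)) (A₀ (p.1, ‖p.2‖)) (φ p))
  evolution : ∀ η : ℝ × ℂ → ℝ, ContDiff ℝ ∞ η → HasCompactSupport η →
    ∫ p : ℝ × ℂ, (-Complex.I * ((fderiv ℝ η p (1, 0) : ℝ) : ℂ)
        + ((Laplacian.laplacian (fun x : ℂ => η (p.1, x)) p.2 : ℝ) : ℂ)) * φ p
      = ∫ p : ℝ × ℂ, (η p : ℂ) *
          nonlinearity m g ‖p.2‖ (Aθ (p.1, ‖p.2‖)) (A₀ (p.1, ‖p.2‖)) (φ p)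
  deriv_r_A₀ : HasWeakDerivOn {q : ℝ × ℝ | 0 < q.2} (0, 1) A₀
    (fun q => 1 / q.2 * (m + Aθ q) * ‖φ (q.1, (q.2 : ℂ))‖ ^ 2)
  deriv_t_Aθ : ∃ G₁ G₂ : ℝ × ℂ → ℂ,
    HasWeakDerivOn Set.univ (0, 1) φ G₁ ∧ HasWeakDerivOn Set.univ (0, Complex.I) φ G₂ ∧
    HasWeakDerivOn Set.univ ((1, 0) : ℝ × ℂ) (fun p => Aθ (p.1, ‖p.2‖))
      (fun p => ‖p.2‖ * (starRingEnd ℂ (φ p) * radialDeriv p.2 (G₁ p) (G₂ p)).im)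
  deriv_r_Aθ : HasWeakDerivOn {q : ℝ × ℝ | 0 < q.2} (0, 1) Aθ
    (fun q => -(1 / 2) * ‖φ (q.1, (q.2 : ℂ))‖ ^ 2 * q.2)
  Aθ_zero : ∀ t : ℝ, Tendsto (fun r : ℝ => Aθ (t, r)) (𝓝[>] 0) (𝓝 0)
  A₀_infinity : ∀ t : ℝ, Tendsto (fun r : ℝ => A₀ (t, r)) atTop (𝓝 0)

end

end EquivariantCSS

/-! Write `q = |f|²` for the radial density of `f` in the equivariant class. Expanding the square
`(m + A_θ)²`, the term `m²|f|²/r²` completes `|∂_r f|²` to the full gradient, and the energy becomes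
`E(f) = ½ D(f) + π (Q(q) + S(q))`, where `D` is the Dirichlet integral and `Q`, `S` are homogeneous
of degree 2 and 3 in `q` (`energy_eq`).

Minimality is used through scaling: `E(c f) = c² (½ D + π (c² Q + c⁴ S))`. If `E(f) < 0` with
`charge f ≤ charge φ`, then `D(f) > 0`, so the bracket changes sign on `[0, 1]`. It vanishes at some
`c` in `(0, 1)`, giving a nonzero zero-energy state of charge strictly below that of `φ`, a
contradiction (`energy_nonneg_of_charge_le`). Hence `φ` minimizes `E` at the value 0 among states of
its own charge. Normalizing `φ + s h` to that charge and differentiating at `s = 0` gives the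
Euler-Lagrange equation `-Δφ + Vφ = μφ` weakly, with a real multiplier `μ`, against equivariant `h`
(`exists_euler_lagrange`). The potential `A₀` enters `V` when the variation of `A_θ` is moved onto
the density by Fubini (`first_variation`).

All these integrals converge because the profile of an `H¹` equivariant function is almost
everywhere a primitive on `(0, ∞)`. A radial Sobolev inequality bounds `r |u|²`, a Hardy inequality
makes `|u|²` integrable in `dr`, and the identity `∂_θ f = i m f` controls `m |u|² / r`
(`MemH1m.isRadialDensity`). In particular `A_θ = O(r)`.

Two points remain. A general test function is reduced to an equivariant one by averaging over
rotations, which commutes with the Laplacian (`stationary_equation`); the phase `e^{-iμt}` then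
turns the stationary equation into the evolution equation. As `A_θ` does not depend on time, the
third equation says that the radial current `Im (conj φ ∂_r φ)` vanishes. This follows by testing
with the infinitesimal gauge variation `i X(r) φ`: only the current paired with `X'` survives
(`integral_radial_mul_current`, `current_ae_zero`). The other equations hold because the potentials
are primitives. -/

section

open Set
open scoped ComplexConjugate

namespace EquivariantCSS

/-! ### Primitives and weak derivatives on the half-line. -/

/-- `U` is a primitive of `w` on `(0, ∞)`. -/
structure IsPrimitive (U w : ℝ → ℝ) : Prop where
  locInt : LocallyIntegrableOn w (Ioi 0)
  sub_eq : ∀ ⦃a : ℝ⦄, 0 < a → ∀ ⦃b : ℝ⦄, a ≤ b → U b - U a = ∫ x in a..b, w x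

theorem locallyIntegrableOn_Ioi_intervalIntegrable {w : ℝ → ℝ}
    (hw : LocallyIntegrableOn w (Ioi 0)) {a b : ℝ} (ha : 0 < a) (hab : a ≤ b) :
    IntervalIntegrable w volume a b := by
  rw [intervalIntegrable_iff_integrableOn_Icc_of_le hab]
  exact hw.integrableOn_compact_subset (fun x hx => lt_of_lt_of_le ha hx.1) isCompact_Icc

theorem absolutelyContinuousOnInterval_const_add_integral {w : ℝ → ℝ} {a b : ℝ}
    (hw : IntervalIntegrable w volume a b) (c : ℝ) :
    AbsolutelyContinuousOnInterval (fun x => c + ∫ t in a..x, w t) a b :=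
  (contDiff_const (n := 1)).contDiffOn.absolutelyContinuousOnInterval.add
    (hw.absolutelyContinuousOnInterval_intervalIntegral left_mem_uIcc)

theorem ae_deriv_const_add_integral {w : ℝ → ℝ} {a b : ℝ}
    (hw : IntervalIntegrable w volume a b) (c : ℝ) :
    ∀ᵐ x, x ∈ uIcc a b → deriv (fun x => c + ∫ t in a..x, w t) x = w x := by
  filter_upwards [hw.ae_hasDerivAt_integral] with x hx hxm
  exact ((hx hxm a left_mem_uIcc).const_add c).deriv

theorem IsPrimitive.eq_add {U w : ℝ → ℝ} (h : IsPrimitive U w) {a x : ℝ} (ha : 0 < a)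
    (hx : a ≤ x) : U x = U a + ∫ t in a..x, w t := by
  rw [← h.sub_eq ha hx]; ring

theorem IsPrimitive.continuousOn {U w : ℝ → ℝ} (h : IsPrimitive U w) :
    ContinuousOn U (Ioi 0) := by
  intro x hx
  have hx0 : (0 : ℝ) < x := hx
  have hi := locallyIntegrableOn_Ioi_intervalIntegrable h.locInt (half_pos hx0)
    (by linarith : x / 2 ≤ x + 1)
  have hac := (absolutelyContinuousOnInterval_const_add_integral hi (U (x / 2))).continuousOn
  rw [uIcc_of_le (by linarith)] at hac
  have hc : ContinuousOn U (Icc (x / 2) (x + 1)) :=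
    hac.congr fun y hy => h.eq_add (half_pos hx0) hy.1
  exact (hc.continuousAt (Icc_mem_nhds (by linarith) (by linarith))).continuousWithinAt

/-- The product rule in integrated form. -/
theorem IsPrimitive.mul_sub_eq {U w V z : ℝ → ℝ} (hU : IsPrimitive U w) (hV : IsPrimitive V z)
    {a b : ℝ} (ha : 0 < a) (hab : a ≤ b) :
    U b * V b - U a * V a = ∫ x in a..b, (w x * V x + U x * z x) := by
  have hi := locallyIntegrableOn_Ioi_intervalIntegrable hU.locInt ha hab
  have hj := locallyIntegrableOn_Ioi_intervalIntegrable hV.locInt ha hab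
  have key := (absolutelyContinuousOnInterval_const_add_integral hi (U a)).integral_deriv_mul_eq_sub
    (absolutelyContinuousOnInterval_const_add_integral hj (V a))
  simp only [← hU.eq_add ha hab, ← hV.eq_add ha hab, ← hU.eq_add ha le_rfl,
    ← hV.eq_add ha le_rfl] at key
  rw [← key]
  apply intervalIntegral.integral_congr_ae
  filter_upwards [ae_deriv_const_add_integral hi (U a), ae_deriv_const_add_integral hj (V a)]
    with x h1 h2 hx
  have hx' := uIoc_subset_uIcc hx
  rw [h1 hx', h2 hx']
  rw [uIcc_of_le hab] at hx'
  rw [← hU.eq_add ha hx'.1, ← hV.eq_add ha hx'.1]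

theorem isPrimitive_of_contDiff {v : ℝ → ℝ} (hv : ContDiff ℝ 1 v) : IsPrimitive v (deriv v) where
  locInt := (hv.continuous_deriv le_rfl).locallyIntegrable.locallyIntegrableOn _
  sub_eq a _ b _ := by
    rw [intervalIntegral.integral_deriv_eq_sub (fun x _ => hv.differentiable one_ne_zero x)
      ((hv.continuous_deriv le_rfl).intervalIntegrable _ _)]

theorem exists_Icc_of_hasCompactSupport {V : Type*} [Zero V] [TopologicalSpace V]
    {v : ℝ → V} (hc : HasCompactSupport v)
    (hs : tsupport v ⊆ Ioi 0) : ∃ a b : ℝ, 0 < a ∧ a ≤ b ∧ tsupport v ⊆ Ioo a b := by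
  rcases (tsupport v).eq_empty_or_nonempty with h | h
  · exact ⟨1, 2, by norm_num, by norm_num, by simp [h]⟩
  · obtain ⟨x, hx, hxl⟩ := hc.isCompact.exists_isLeast h
    obtain ⟨y, hy, hyl⟩ := hc.isCompact.exists_isGreatest h
    have hx0 : 0 < x := hs hx
    refine ⟨x / 2, y + 1, by linarith, by linarith [hxl hy], fun z hz => ⟨?_, ?_⟩⟩
    · linarith [hxl hz]
    · linarith [hyl hz]

/-- A primitive has its integrand as a weak derivative. -/
theorem IsPrimitive.integral_deriv_mul {U w : ℝ → ℝ} (hU : IsPrimitive U w) {v : ℝ → ℝ}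
    (hv : ContDiff ℝ 1 v) (hc : HasCompactSupport v) (hs : tsupport v ⊆ Ioi 0) :
    ∫ x, deriv v x * U x = - ∫ x, v x * w x := by
  obtain ⟨a, b, ha, hab, hsub⟩ := exists_Icc_of_hasCompactSupport hc hs
  have key := (isPrimitive_of_contDiff hv).mul_sub_eq hU ha hab
  have hva : v a = 0 := image_eq_zero_of_notMem_tsupport fun h => lt_irrefl _ (hsub h).1
  have hvb : v b = 0 := image_eq_zero_of_notMem_tsupport fun h => lt_irrefl _ (hsub h).2
  have hUc : ContinuousOn U (uIcc a b) := hU.continuousOn.mono fun x hx => by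
    rw [uIcc_of_le hab] at hx; exact lt_of_lt_of_le ha hx.1
  rw [hva, hvb, intervalIntegral.integral_add] at key
  · have h1 : ∫ x in a..b, deriv v x * U x = ∫ x, deriv v x * U x := by
      apply intervalIntegral.integral_eq_integral_of_support_subset
      refine fun x hx => Ioo_subset_Ioc_self (hsub (support_deriv_subset ?_))
      exact fun h0 => hx (by simp [h0])
    have h2 : ∫ x in a..b, v x * w x = ∫ x, v x * w x := by
      apply intervalIntegral.integral_eq_integral_of_support_subset
      refine fun x hx => Ioo_subset_Ioc_self (hsub (subset_tsupport _ ?_))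
      exact fun h0 => hx (by simp [h0])
    linarith
  · exact ((hv.continuous_deriv le_rfl).continuousOn.mul hUc).intervalIntegrable
  · exact (locallyIntegrableOn_Ioi_intervalIntegrable hU.locInt ha hab).continuousOn_mul
      hv.continuous.continuousOn

/-- The base point is 1 because `w` need not be integrable near 0. -/
theorem isPrimitive_integral {w : ℝ → ℝ} (hw : LocallyIntegrableOn w (Ioi 0)) (c : ℝ) :
    IsPrimitive (fun x => c + ∫ t in (1 : ℝ)..x, w t) w where
  locInt := hw
  sub_eq a ha b hab := by
    have hint : ∀ {x : ℝ}, 0 < x → IntervalIntegrable w volume 1 x := fun {x} hx => by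
      rcases le_total 1 x with h | h
      · exact locallyIntegrableOn_Ioi_intervalIntegrable hw one_pos h
      · exact (locallyIntegrableOn_Ioi_intervalIntegrable hw hx h).symm
    rw [add_sub_add_left_eq_sub, intervalIntegral.integral_interval_sub_left
      (hint (ha.trans_le hab)) (hint ha)]

theorem IsPrimitive.locallyIntegrableOn {U w : ℝ → ℝ} (hU : IsPrimitive U w) :
    LocallyIntegrableOn U (Ioi 0) :=
  hU.continuousOn.locallyIntegrableOn measurableSet_Ioi

theorem integrable_mul_of_tsupport_subset {u v : ℝ → ℝ} (hu : LocallyIntegrableOn u (Ioi 0))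
    (hv : Continuous v) (hc : HasCompactSupport v) (hs : tsupport v ⊆ Ioi 0) :
    Integrable (fun x => v x * u x) := by
  have h1 := (hu.integrableOn_compact_subset hs hc.isCompact).continuousOn_mul
    hv.continuousOn hc.isCompact
  rwa [integrableOn_iff_integrable_of_support_subset] at h1
  exact fun x hx => subset_tsupport _ fun h0 => hx (by simp [h0])

/-- A function on `(0, ∞)` whose weak derivative vanishes is constant. -/
theorem ae_const_of_weakDeriv_zero {u : ℝ → ℝ} (hu : LocallyIntegrableOn u (Ioi 0))
    (h : ∀ v : ℝ → ℝ, ContDiff ℝ ∞ v → HasCompactSupport v → tsupport v ⊆ Ioi 0 →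
      ∫ x, deriv v x * u x = 0) : ∃ c : ℝ, ∀ᵐ x, x ∈ Ioi (0 : ℝ) → u x = c := by
  -- A reference bump supported in `[1, 3]`, inside the half-line, and normalized to integral 1. The
  -- constant sought is the average of `u` against it.
  let β : ContDiffBump (2 : ℝ) := ⟨1 / 2, 1, by norm_num, by norm_num⟩
  let v₀ : ℝ → ℝ := β.normed volume
  have hv₀ : ContDiff ℝ ∞ v₀ := β.contDiff_normed
  have hv₀c : HasCompactSupport v₀ := β.hasCompactSupport_normed
  have hv₀s : tsupport v₀ ⊆ Ioi 0 := by
    rw [β.tsupport_normed_eq]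
    intro x hx
    rw [Metric.mem_closedBall, Real.dist_eq, abs_le] at hx
    have : -1 ≤ x - 2 := hx.1
    simp only [mem_Ioi]; linarith
  have hv₀i : ∫ x, v₀ x = 1 := β.integral_normed
  refine ⟨∫ x, v₀ x * u x, ?_⟩
  set c := ∫ x, v₀ x * u x with hcdef
  have key := isOpen_Ioi.ae_eq_zero_of_integral_contDiff_smul_eq_zero (μ := volume)
    (f := fun x => u x - c) (hu.sub (locallyIntegrableOn_const c)) ?_
  · filter_upwards [key] with x hx hx0
    linarith [hx hx0]
  intro v hv hvc hvs
  let k := ∫ x, v x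
  -- Removing the mean makes the primitive `Z` of `z` compactly supported, so `Z` is an admissible
  -- test function with `Z' = z`.
  let z : ℝ → ℝ := fun x => v x - k * v₀ x
  have hz : ContDiff ℝ ∞ z := hv.sub (contDiff_const.mul hv₀)
  have hts : tsupport z ⊆ tsupport v ∪ tsupport v₀ := by
    refine (tsupport_sub v (fun x => k * v₀ x)).trans (union_subset_union_right _ ?_)
    exact tsupport_mul_subset_right
  have hzc : HasCompactSupport z :=
    HasCompactSupport.of_support_subset_isCompact (hvc.isCompact.union hv₀c.isCompact)
      ((subset_tsupport _).trans hts)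
  have hzs : tsupport z ⊆ Ioi 0 := hts.trans (union_subset hvs hv₀s)
  obtain ⟨a, b, ha, hab, hsub⟩ := exists_Icc_of_hasCompactSupport hzc hzs
  have hvi : Integrable v := hv.continuous.integrable_of_hasCompactSupport hvc
  have hv₀i' : Integrable v₀ := hv₀.continuous.integrable_of_hasCompactSupport hv₀c
  have hz0 : ∫ x, z x = 0 := by
    simp only [z]
    rw [integral_sub hvi (hv₀i'.const_mul k), integral_const_mul, hv₀i]; simp [k]
  let Z : ℝ → ℝ := fun x => ∫ t in a..x, z t
  have hZd : ∀ x, HasDerivAt Z (z x) x := fun x =>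
    intervalIntegral.integral_hasDerivAt_right (hz.continuous.intervalIntegrable _ _)
      hz.continuous.stronglyMeasurable.stronglyMeasurableAtFilter hz.continuous.continuousAt
  have hZdd : deriv Z = z := funext fun x => (hZd x).deriv
  have hZ : ContDiff ℝ ∞ Z := by
    rw [contDiff_infty_iff_deriv]
    exact ⟨fun x => (hZd x).differentiableAt, hZdd ▸ hz⟩
  have hzz : ∀ x, x ∉ Ioo a b → z x = 0 := fun x hx =>
    image_eq_zero_of_notMem_tsupport fun h => hx (hsub h)
  have hZsupp : Function.support Z ⊆ Icc a b := by
    intro x hx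
    by_contra hxn
    apply hx
    rcases lt_or_ge x a with h1 | h1
    · simp only [Z]
      rw [intervalIntegral.integral_symm, intervalIntegral.integral_zero_ae, neg_zero]
      refine Eventually.of_forall fun t ht => hzz t fun h => ?_
      rw [uIoc_of_le h1.le] at ht
      exact absurd h.1 (not_lt.2 ht.2)
    · have h2 : b < x := by by_contra h; exact hxn ⟨h1, not_lt.1 h⟩
      simp only [Z]
      rw [← hz0]
      apply intervalIntegral.integral_eq_integral_of_support_subset
      intro t ht
      have : t ∈ Ioo a b := by by_contra h; exact ht (hzz t h)
      exact ⟨this.1, this.2.le.trans h2.le⟩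
  have hZc : HasCompactSupport Z := HasCompactSupport.of_support_subset_isCompact isCompact_Icc hZsupp
  have hZs : tsupport Z ⊆ Ioi 0 := (closure_minimal hZsupp isClosed_Icc).trans
    fun x hx => lt_of_lt_of_le ha hx.1
  have h3 := h Z hZ hZc hZs
  rw [hZdd] at h3
  have i1 := integrable_mul_of_tsupport_subset hu hv.continuous hvc hvs
  have i2 := integrable_mul_of_tsupport_subset hu hv₀.continuous hv₀c hv₀s
  have h4 : ∫ x, z x * u x = (∫ x, v x * u x) - k * c := by
    simp only [z, sub_mul, mul_assoc]
    rw [integral_sub i1 (i2.const_mul k), integral_const_mul]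
  simp only [smul_eq_mul, mul_sub]
  rw [integral_sub i1 (hvi.mul_const c), integral_mul_const]
  linarith

/-- A function with a weak derivative on `(0, ∞)` agrees almost everywhere with a primitive. -/
theorem exists_isPrimitive_of_weakDeriv {u w : ℝ → ℝ} (hu : LocallyIntegrableOn u (Ioi 0))
    (hw : LocallyIntegrableOn w (Ioi 0))
    (h : ∀ v : ℝ → ℝ, ContDiff ℝ ∞ v → HasCompactSupport v → tsupport v ⊆ Ioi 0 →
      ∫ x, deriv v x * u x = - ∫ x, v x * w x) :
    ∃ U : ℝ → ℝ, IsPrimitive U w ∧ ∀ᵐ x, x ∈ Ioi (0 : ℝ) → u x = U x := by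
  have hp := isPrimitive_integral hw 0
  -- Subtracting one primitive of `w` leaves a function with zero weak derivative; its constant
  -- value is then absorbed into the primitive.
  obtain ⟨c, hc⟩ := ae_const_of_weakDeriv_zero (hu.sub hp.locallyIntegrableOn) (by
    intro v hv hvc hvs
    have hts : tsupport (deriv v) ⊆ Ioi 0 :=
      (closure_minimal (support_deriv_subset) (isClosed_tsupport v)).trans hvs
    have hd : Continuous (deriv v) := hv.continuous_deriv (by simp)
    simp only [Pi.sub_apply, mul_sub]
    rw [integral_sub (integrable_mul_of_tsupport_subset hu hd hvc.deriv hts)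
      (integrable_mul_of_tsupport_subset hp.locallyIntegrableOn hd hvc.deriv hts),
      h v hv hvc hvs, hp.integral_deriv_mul (hv.of_le (by simp)) hvc hvs]
    simp)
  refine ⟨_, isPrimitive_integral hw c, ?_⟩
  filter_upwards [hc] with x hx hx0
  have := hx hx0
  simp only [Pi.sub_apply, zero_add] at this
  linarith


theorem IsPrimitive.mul {U w V z : ℝ → ℝ} (hU : IsPrimitive U w) (hV : IsPrimitive V z) :
    IsPrimitive (fun x => U x * V x) (fun x => w x * V x + U x * z x) where
  locInt := by
    have h1 := hU.locInt.mul_continuousOn hV.continuousOn isOpen_Ioi.isLocallyClosed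
    have h2 := hV.locInt.continuousOn_mul hU.continuousOn isOpen_Ioi.isLocallyClosed
    exact h1.add h2
  sub_eq a ha b hab := hU.mul_sub_eq hV ha hab

theorem isPrimitive_id : IsPrimitive (fun x => x) (fun _ => 1) := by
  simpa using isPrimitive_of_contDiff (contDiff_fun_id (𝕜 := ℝ) (E := ℝ) (n := 1))

/-! ### Radial Sobolev and Hardy inequalities for primitives. -/

section Hardy

variable {U w : ℝ → ℝ}

/-- Beyond `r` the weight `x` is at least `r`, so it can be dropped at the cost of a factor `1/r`.
-/
theorem integrableOn_Ioi_of_mul_self {g : ℝ → ℝ}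
    (hg : LocallyIntegrableOn g (Ioi 0)) (h : IntegrableOn (fun x => g x * x) (Ioi 0))
    {r : ℝ} (hr : 0 < r) : IntegrableOn g (Ioi r) := by
  have hsub : Ioi r ⊆ Ioi 0 := fun x hx => hr.trans hx
  have h1 : IntegrableOn (fun x => r⁻¹ * ‖g x * x‖) (Ioi r) := (h.mono_set hsub).norm.const_mul _
  refine h1.mono' (hg.aestronglyMeasurable.mono_measure (Measure.restrict_mono hsub le_rfl)) ?_
  filter_upwards [ae_restrict_mem measurableSet_Ioi] with x hx
  have hx' : r < x := hx
  rw [norm_mul, Real.norm_of_nonneg (hr.trans hx').le, inv_mul_eq_div, le_div_iff₀ hr]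
  exact mul_le_mul_of_nonneg_left hx'.le (norm_nonneg _)

/-- The radial Sobolev inequality in its pointwise form. -/
theorem IsPrimitive.mul_sq_le (hU : IsPrimitive U w)
    (h2 : IntegrableOn (fun x => U x ^ 2 * x) (Ioi 0))
    (hm : IntegrableOn (fun x => U x * w x * x) (Ioi 0)) {r : ℝ} (hr : 0 < r) :
    r * U r ^ 2 ≤ 2 * ∫ x in Ioi 0, |U x * w x| * x := by
  have hsub : Ioi r ⊆ Ioi 0 := fun x hx => hr.trans hx
  have hloc : LocallyIntegrableOn (fun x => U x * w x) (Ioi 0) :=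
    hU.locInt.continuousOn_mul hU.continuousOn isOpen_Ioi.isLocallyClosed
  have hg : IntegrableOn (fun x => |U x * w x|) (Ioi r) :=
    (integrableOn_Ioi_of_mul_self hloc hm hr).abs
  have habs : IntegrableOn (fun x => |U x * w x| * x) (Ioi 0) := by
    refine hm.abs.congr ?_
    filter_upwards [ae_restrict_mem measurableSet_Ioi] with x hx
    rw [abs_mul (U x * w x), abs_of_pos (show (0 : ℝ) < x from hx)]
  -- `T` bounds the total variation of `U²` on `(r, ∞)`, since `(U²)' = 2 U w`.
  set T := 2 * ∫ x in Ioi r, |U x * w x| with hT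
  have hstep : ∀ R, r < R → U r ^ 2 ≤ U R ^ 2 + T := by
    intro R hR
    have h := hU.mul_sub_eq hU hr hR.le
    have h3 : |∫ x in r..R, (w x * U x + U x * w x)| ≤ T := by
      rw [intervalIntegral.integral_of_le hR.le, hT, ← integral_const_mul]
      refine (abs_integral_le_integral_abs).trans ?_
      refine (setIntegral_mono_set (t := Ioi r) ?_ ?_ ?_).trans (le_of_eq ?_)
      · refine (((integrableOn_Ioi_of_mul_self hloc hm hr).const_mul 2).abs).congr ?_
        exact Eventually.of_forall fun x => by simp only; congr 1; ring
      · exact Eventually.of_forall fun x => abs_nonneg _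
      · exact Ioc_subset_Ioi_self.eventuallyLE
      · refine setIntegral_congr_fun measurableSet_Ioi fun x _ => ?_
        rw [mul_comm (w x), ← two_mul, abs_mul, abs_two]
    have := (abs_le.1 h3).1
    nlinarith
  have hUT : U r ^ 2 ≤ T := by
    -- If `U(r)²` exceeded `T`, then `x U(x)²` would stay above a positive constant on `(r, ∞)`,
    -- which contradicts its integrability.
    by_contra hlt
    push Not at hlt
    have hconst : IntegrableOn (fun _ : ℝ => (U r ^ 2 - T) * r) (Ioi r) := by
      refine (h2.mono_set hsub).mono' aestronglyMeasurable_const ?_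
      filter_upwards [ae_restrict_mem measurableSet_Ioi] with x hx
      have hx' : r < x := hx
      rw [Real.norm_of_nonneg (mul_nonneg (by linarith) hr.le)]
      exact mul_le_mul (by linarith [hstep x hx']) hx'.le hr.le (sq_nonneg _)
    rw [integrableOn_const_iff] at hconst
    rcases hconst with h | h
    · have : (U r ^ 2 - T) * r > 0 := mul_pos (by linarith) hr
      exact this.ne' (by simpa using h)
    · simp at h
  calc r * U r ^ 2 ≤ r * T := mul_le_mul_of_nonneg_left hUT hr.le
    _ = 2 * ∫ x in Ioi r, |U x * w x| * r := by rw [integral_mul_const]; ring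
    _ ≤ 2 * ∫ x in Ioi r, |U x * w x| * x := by
      refine mul_le_mul_of_nonneg_left (setIntegral_mono_on (hg.mul_const r)
        (habs.mono_set hsub) measurableSet_Ioi fun x hx => ?_) zero_le_two
      exact mul_le_mul_of_nonneg_left (le_of_lt hx) (abs_nonneg _)
    _ ≤ _ := by
      refine mul_le_mul_of_nonneg_left (setIntegral_mono_set habs ?_ hsub.eventuallyLE) zero_le_two
      filter_upwards [ae_restrict_mem measurableSet_Ioi] with x hx
      exact mul_nonneg (abs_nonneg _) (le_of_lt hx)

/-- A Hardy-type inequality. -/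
theorem IsPrimitive.integrableOn_sq (hU : IsPrimitive U w)
    (h2 : IntegrableOn (fun x => U x ^ 2 * x) (Ioi 0))
    (hm : IntegrableOn (fun x => U x * w x * x) (Ioi 0)) :
    IntegrableOn (fun x => U x ^ 2) (Ioi 0) := by
  set C := 2 * ∫ x in Ioi 0, |U x * w x| * x with hC
  have habs : IntegrableOn (fun x => |U x * w x| * x) (Ioi 0) := by
    refine hm.abs.congr ?_
    filter_upwards [ae_restrict_mem measurableSet_Ioi] with x hx
    rw [abs_mul (U x * w x), abs_of_pos (show (0 : ℝ) < x from hx)]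
  have hcont : ContinuousOn (fun x => U x ^ 2) (Ioi 0) := hU.continuousOn.pow 2
  have hbound : ∀ a, 0 < a → ∀ b, a ≤ b → ∫ x in a..b, ‖U x ^ 2‖ ≤ 2 * C := by
    intro a ha b hab
    -- The product rule for `x U²` gives `∫ U² = b U(b)² - a U(a)² - ∫ 2 U w x`. The first term is
    -- at most `C` by the radial Sobolev inequality, the second has a good sign, and the third is at
    -- most `C` in absolute value. The bound `2C` is independent of `a` and `b`, so both endpoints
    -- can go to their limits.
    have h := (hU.mul hU).mul_sub_eq isPrimitive_id ha hab
    have hIcc : uIcc a b ⊆ Ioi 0 := fun x hx => by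
      rw [uIcc_of_le hab] at hx; exact lt_of_lt_of_le ha hx.1
    have hi2 : IntervalIntegrable (fun x => U x ^ 2) volume a b :=
      (hcont.mono hIcc).intervalIntegrable
    have hi1 : IntervalIntegrable (fun x => 2 * (U x * w x * x)) volume a b := by
      rw [intervalIntegrable_iff_integrableOn_Ioc_of_le hab]
      exact IntegrableOn.mono_set (hm.const_mul 2) fun x hx => ha.trans hx.1
    have e1 : ∫ x in a..b, ((w x * U x + U x * w x) * x + U x * U x * 1)
        = (∫ x in a..b, 2 * (U x * w x * x)) + ∫ x in a..b, U x ^ 2 := by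
      rw [← intervalIntegral.integral_add hi1 hi2]
      exact intervalIntegral.integral_congr fun x _ => by ring
    have e2 : |∫ x in a..b, 2 * (U x * w x * x)| ≤ C := by
      rw [intervalIntegral.integral_of_le hab, hC, ← integral_const_mul]
      refine abs_integral_le_integral_abs.trans ?_
      refine (setIntegral_mono_set (t := Ioi 0) (hm.const_mul 2).abs
        (Eventually.of_forall fun x => abs_nonneg _)
        (LE.le.eventuallyLE fun x hx => ha.trans hx.1)).trans (le_of_eq ?_)
      refine setIntegral_congr_fun measurableSet_Ioi fun x hx => ?_
      rw [abs_mul, abs_two, abs_mul (U x * w x), abs_of_pos (show (0 : ℝ) < x from hx)]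
    have e3 := hU.mul_sq_le h2 hm (ha.trans_le hab)
    have e4 : 0 ≤ a * U a ^ 2 := mul_nonneg ha.le (sq_nonneg _)
    have e5 : ∫ x in a..b, ‖U x ^ 2‖ = ∫ x in a..b, U x ^ 2 :=
      intervalIntegral.integral_congr fun x _ => Real.norm_of_nonneg (sq_nonneg _)
    rw [e5]
    have := (abs_le.1 e2).1
    nlinarith
  have hI : ∀ a, 0 < a → ∀ b, IntegrableOn (fun x => U x ^ 2) (Ioc a b) := fun a ha b =>
    ((hcont.mono fun x hx => lt_of_lt_of_le ha hx.1).integrableOn_Icc (a := a) (b := b)).mono_set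
      Ioc_subset_Icc_self
  have h01 : IntegrableOn (fun x => U x ^ 2) (Ioc 0 1) := by
    refine integrableOn_Ioc_of_intervalIntegral_norm_bounded_left
      (l := atTop) (a := fun n : ℕ => 1 / ((n : ℝ) + 1)) (I := 2 * C)
      (fun n => hI _ (by positivity) _)
      tendsto_one_div_add_atTop_nhds_zero_nat ?_
    refine Eventually.of_forall fun n => ?_
    have h1 : 1 / ((n : ℝ) + 1) ≤ 1 := by
      rw [div_le_one (by positivity)]; linarith [(Nat.cast_nonneg n : (0 : ℝ) ≤ n)]
    have := hbound (1 / ((n : ℝ) + 1)) (by positivity) 1 h1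
    rwa [intervalIntegral.integral_of_le h1] at this
  have h1i : IntegrableOn (fun x => U x ^ 2) (Ioi 1) := by
    refine integrableOn_Ioi_of_intervalIntegral_norm_bounded (l := atTop)
      (b := fun x : ℝ => x) (2 * C) 1 (fun n => hI 1 one_pos n) tendsto_id ?_
    filter_upwards [eventually_ge_atTop 1] with b hb using hbound 1 one_pos b hb
  rw [← Ioc_union_Ioi_eq_Ioi (zero_le_one' ℝ)]
  exact h01.union h1i

end Hardy


/-! ### Calculus of weak derivatives on the plane. -/

section WeakDeriv

theorem _root_.MeasureTheory.LocallyIntegrable.integrable_mul_of_hasCompactSupport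
    {X : Type*} [TopologicalSpace X] [T2Space X] [MeasurableSpace X] [OpensMeasurableSpace X]
    {μ : Measure X} {f η : X → ℂ} (hf : LocallyIntegrable f μ)
    (hη : Continuous η) (hc : HasCompactSupport η) : Integrable (fun x => η x * f x) μ := by
  simpa using hf.integrable_smul_left_of_hasCompactSupport hη hc

theorem hasCompactSupport_fderiv_apply {E V : Type*} [NormedAddCommGroup E] [NormedSpace ℝ E]
    [NormedAddCommGroup V] [NormedSpace ℝ V] {η : E → V}
    (hc : HasCompactSupport η) (v : E) : HasCompactSupport (fun x => fderiv ℝ η x v) :=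
  hc.fderiv_apply ℝ v

theorem contDiff_fderiv_apply_const {E V : Type*} [NormedAddCommGroup E] [NormedSpace ℝ E]
    [NormedAddCommGroup V] [NormedSpace ℝ V] {η : E → V} (hη : ContDiff ℝ ∞ η) (v : E) :
    ContDiff ℝ ∞ (fun x => fderiv ℝ η x v) :=
  (hη.fderiv_right (m := ∞) (by simp)).clm_apply contDiff_const

variable {v : ℂ} {f F f' F' : ℂ → ℂ}

theorem HasWeakDerivOn.left (h : HasWeakDerivOn univ v f F) : LocallyIntegrable f :=
  locallyIntegrableOn_univ.1 h.1

theorem HasWeakDerivOn.right (h : HasWeakDerivOn univ v f F) : LocallyIntegrable F :=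
  locallyIntegrableOn_univ.1 h.2.1

theorem fderiv_re_apply {η : ℂ → ℂ} (hη : Differentiable ℝ η) (x w : ℂ) :
    fderiv ℝ (fun y => (η y).re) x w = (fderiv ℝ η x w).re := by
  have := (Complex.reCLM.hasFDerivAt (x := η x)).comp x (hη x).hasFDerivAt
  rw [show (fun y => (η y).re) = Complex.reCLM ∘ η from rfl, this.fderiv]; rfl

theorem fderiv_im_apply {η : ℂ → ℂ} (hη : Differentiable ℝ η) (x w : ℂ) :
    fderiv ℝ (fun y => (η y).im) x w = (fderiv ℝ η x w).im := by
  have := (Complex.imCLM.hasFDerivAt (x := η x)).comp x (hη x).hasFDerivAt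
  rw [show (fun y => (η y).im) = Complex.imCLM ∘ η from rfl, this.fderiv]; rfl

theorem fderiv_ofReal_apply {E : Type*} [NormedAddCommGroup E] [NormedSpace ℝ E] {η : E → ℝ}
    (hη : Differentiable ℝ η) (x w : E) :
    fderiv ℝ (fun y => (η y : ℂ)) x w = (fderiv ℝ η x w : ℂ) := by
  have := (Complex.ofRealCLM.hasFDerivAt (x := η x)).comp x (hη x).hasFDerivAt
  rw [show (fun y => (η y : ℂ)) = Complex.ofRealCLM ∘ η from rfl, this.fderiv]; rfl

/-- Weak derivatives can be tested with complex-valued functions. -/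
theorem HasWeakDerivOn.integral_fderiv_mul (h : HasWeakDerivOn univ v f F) {η : ℂ → ℂ}
    (hη : ContDiff ℝ ∞ η) (hc : HasCompactSupport η) :
    ∫ x, fderiv ℝ η x v * f x = - ∫ x, η x * F x := by
  have hd : Differentiable ℝ η := hη.differentiable (by simp)
  have hre : ContDiff ℝ ∞ (fun y => (η y).re) := Complex.reCLM.contDiff.comp hη
  have him : ContDiff ℝ ∞ (fun y => (η y).im) := Complex.imCLM.contDiff.comp hη
  have hrec : HasCompactSupport (fun y => (η y).re) := hc.comp_left (g := Complex.re) rfl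
  have himc : HasCompactSupport (fun y => (η y).im) := hc.comp_left (g := Complex.im) rfl
  have e1 := h.2.2 _ hre hrec (subset_univ _)
  have e2 := h.2.2 _ him himc (subset_univ _)
  have i1 := h.left.integrable_smul_left_of_hasCompactSupport
    (contDiff_fderiv_apply_const hre v).continuous (hasCompactSupport_fderiv_apply hrec v)
  have i2 := h.left.integrable_smul_left_of_hasCompactSupport
    (contDiff_fderiv_apply_const him v).continuous (hasCompactSupport_fderiv_apply himc v)
  have i3 := h.right.integrable_smul_left_of_hasCompactSupport hre.continuous hrec
  have i4 := h.right.integrable_smul_left_of_hasCompactSupport him.continuous himc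
  have e3 : ∀ x, fderiv ℝ η x v * f x = fderiv ℝ (fun y => (η y).re) x v • f x
      + Complex.I * (fderiv ℝ (fun y => (η y).im) x v • f x) := by
    intro x
    rw [fderiv_re_apply hd, fderiv_im_apply hd]
    conv_lhs => rw [← Complex.re_add_im (fderiv ℝ η x v)]
    simp only [Complex.real_smul]; ring
  have e4 : ∀ x, η x * F x = (η x).re • F x + Complex.I * ((η x).im • F x) := by
    intro x
    conv_lhs => rw [← Complex.re_add_im (η x)]
    simp only [Complex.real_smul]; ring
  simp_rw [e3, e4]
  rw [integral_add i1 (i2.const_mul _), integral_add i3 (i4.const_mul _), integral_const_mul,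
    integral_const_mul, e1, e2]
  ring

theorem hasWeakDerivOn_of_complex (hf : LocallyIntegrable f) (hF : LocallyIntegrable F)
    (h : ∀ η : ℂ → ℂ, ContDiff ℝ ∞ η → HasCompactSupport η →
      ∫ x, fderiv ℝ η x v * f x = - ∫ x, η x * F x) : HasWeakDerivOn univ v f F := by
  refine ⟨locallyIntegrableOn_univ.2 hf, locallyIntegrableOn_univ.2 hF, fun η hη hc _ => ?_⟩
  have := h (fun x => (η x : ℂ)) (Complex.ofRealCLM.contDiff.comp hη)
    (hc.comp_left (g := fun t : ℝ => (t : ℂ)) rfl)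
  simp_rw [fderiv_ofReal_apply (hη.differentiable (by simp))] at this
  simpa only [Complex.real_smul] using this

theorem HasWeakDerivOn.ae_unique (h : HasWeakDerivOn univ v f F)
    (h' : HasWeakDerivOn univ v f F') : F =ᵐ[volume] F' := by
  have := ae_eq_zero_of_integral_contDiff_smul_eq_zero (μ := volume) (h.right.sub h'.right)
    fun η hη hc => by
      simp only [Pi.sub_apply, smul_sub]
      rw [integral_sub (h.right.integrable_smul_left_of_hasCompactSupport hη.continuous hc)
        (h'.right.integrable_smul_left_of_hasCompactSupport hη.continuous hc)]
      have e1 := h.2.2 η hη hc (subset_univ _)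
      have e2 := h'.2.2 η hη hc (subset_univ _)
      rw [e1] at e2
      rw [neg_inj.1 e2, sub_self]
  filter_upwards [this] with x hx
  exact sub_eq_zero.1 hx

theorem HasWeakDerivOn.add (h : HasWeakDerivOn univ v f F) (h' : HasWeakDerivOn univ v f' F') :
    HasWeakDerivOn univ v (fun x => f x + f' x) (fun x => F x + F' x) := by
  refine hasWeakDerivOn_of_complex (h.left.add h'.left) (h.right.add h'.right) fun η hη hc => ?_
  have hd := (contDiff_fderiv_apply_const hη v).continuous
  have hdc := hasCompactSupport_fderiv_apply hc v
  simp only [mul_add]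
  rw [integral_add (h.left.integrable_mul_of_hasCompactSupport hd hdc)
    (h'.left.integrable_mul_of_hasCompactSupport hd hdc),
    integral_add (h.right.integrable_mul_of_hasCompactSupport hη.continuous hc)
    (h'.right.integrable_mul_of_hasCompactSupport hη.continuous hc),
    h.integral_fderiv_mul hη hc, h'.integral_fderiv_mul hη hc]
  ring

/-- The smooth factor is absorbed into the test function: test `f` with `η χ` and expand the
derivative by the classical Leibniz rule. -/
theorem HasWeakDerivOn.mul_contDiff (h : HasWeakDerivOn univ v f F) {χ : ℂ → ℂ}
    (hχ : ContDiff ℝ ∞ χ) : HasWeakDerivOn univ v (fun x => χ x * f x)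
      (fun x => fderiv ℝ χ x v * f x + χ x * F x) := by
  have hd := (contDiff_fderiv_apply_const hχ v)
  have l1 : LocallyIntegrable (fun x => χ x * f x) := h.left.continuous_mul hχ.continuous
  have l2 : LocallyIntegrable (fun x => fderiv ℝ χ x v * f x) := h.left.continuous_mul hd.continuous
  have l3 : LocallyIntegrable (fun x => χ x * F x) := h.right.continuous_mul hχ.continuous
  refine hasWeakDerivOn_of_complex l1 (l2.add l3) fun η hη hc => ?_
  have key := h.integral_fderiv_mul (hη.mul hχ) (hc.mul_right)
  have hdη := (contDiff_fderiv_apply_const hη v).continuous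
  have hdc := hasCompactSupport_fderiv_apply hc v
  have e : ∀ x, fderiv ℝ (fun x => η x * χ x) x v * f x
      = fderiv ℝ η x v * (χ x * f x) + η x * (fderiv ℝ χ x v * f x) := by
    intro x
    rw [fderiv_fun_mul (hη.differentiable (by simp) x) (hχ.differentiable (by simp) x)]
    simp only [add_apply, smul_apply, smul_eq_mul]
    ring
  simp_rw [e] at key
  rw [integral_add (l1.integrable_mul_of_hasCompactSupport hdη hdc)
    (l2.integrable_mul_of_hasCompactSupport hη.continuous hc)] at key
  simp only [mul_add]
  rw [integral_add (l2.integrable_mul_of_hasCompactSupport hη.continuous hc)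
    (l3.integrable_mul_of_hasCompactSupport hη.continuous hc)]
  simp only [mul_assoc] at key
  linear_combination key

theorem HasWeakDerivOn.const_mul (h : HasWeakDerivOn univ v f F) (c : ℂ) :
    HasWeakDerivOn univ v (fun x => c * f x) (fun x => c * F x) := by
  simpa using h.mul_contDiff (χ := fun _ => c) contDiff_const

theorem hasWeakDerivOn_of_contDiff {h : ℂ → ℂ} (hh : ContDiff ℝ ∞ h) :
    HasWeakDerivOn univ v h (fun x => fderiv ℝ h x v) := by
  have hd := (contDiff_fderiv_apply_const hh v).continuous
  refine hasWeakDerivOn_of_complex hh.continuous.locallyIntegrable hd.locallyIntegrable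
    fun η hη hc => ?_
  have hdη := (contDiff_fderiv_apply_const hη v).continuous
  have hdc := hasCompactSupport_fderiv_apply hc v
  have := integral_mul_fderiv_eq_neg_fderiv_mul_of_integrable (𝕜 := ℂ) (μ := volume)
    (f := η) (g := h) (v := v)
    (hh.continuous.locallyIntegrable.integrable_mul_of_hasCompactSupport hdη hdc)
    (hd.locallyIntegrable.integrable_mul_of_hasCompactSupport hη.continuous hc)
    (hh.continuous.locallyIntegrable.integrable_mul_of_hasCompactSupport hη.continuous hc)
    (fun x _ => hη.differentiable (by simp) x)
    (fun x _ => hh.differentiable (by simp) x)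
  rw [this, neg_neg]

end WeakDeriv

/-! ### The space `H¹` and its stability properties. -/

section MemH1

variable {f h : ℂ → ℂ}

theorem MemH1.hasWeakDerivOn_one (hf : MemH1 f) : HasWeakDerivOn univ 1 f (weakDeriv 1 f) :=
  weakDeriv_spec (hf.2.1.imp fun _ h => h.1)

theorem MemH1.hasWeakDerivOn_I (hf : MemH1 f) :
    HasWeakDerivOn univ Complex.I f (weakDeriv Complex.I f) :=
  weakDeriv_spec (hf.2.2.imp fun _ h => h.1)

theorem weakDeriv_ae_eq {v : ℂ} {F : ℂ → ℂ} (h : HasWeakDerivOn univ v f F) :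
    weakDeriv v f =ᵐ[volume] F :=
  (weakDeriv_spec ⟨F, h⟩).ae_unique h

theorem MemH1.memLp_one (hf : MemH1 f) : MemLp (weakDeriv 1 f) 2 := by
  obtain ⟨F, h, hF⟩ := hf.2.1
  exact (memLp_congr_ae (weakDeriv_ae_eq h)).2 hF

theorem MemH1.memLp_I (hf : MemH1 f) : MemLp (weakDeriv Complex.I f) 2 := by
  obtain ⟨F, h, hF⟩ := hf.2.2
  exact (memLp_congr_ae (weakDeriv_ae_eq h)).2 hF

theorem MemH1.add (hf : MemH1 f) (hh : MemH1 h) : MemH1 (fun x => f x + h x) :=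
  ⟨hf.1.add hh.1, ⟨_, hf.hasWeakDerivOn_one.add hh.hasWeakDerivOn_one, hf.memLp_one.add hh.memLp_one⟩,
    ⟨_, hf.hasWeakDerivOn_I.add hh.hasWeakDerivOn_I, hf.memLp_I.add hh.memLp_I⟩⟩

theorem MemH1.const_mul (hf : MemH1 f) (c : ℂ) : MemH1 (fun x => c * f x) :=
  ⟨hf.1.const_mul c, ⟨_, hf.hasWeakDerivOn_one.const_mul c, hf.memLp_one.const_mul c⟩,
    ⟨_, hf.hasWeakDerivOn_I.const_mul c, hf.memLp_I.const_mul c⟩⟩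

theorem _root_.MeasureTheory.MemLp.bdd_continuous_mul {f χ : ℂ → ℂ} (hf : MemLp f 2)
    (hχ : Continuous χ) {C : ℝ}
    (hC : ∀ x, ‖χ x‖ ≤ C) : MemLp (fun x => χ x * f x) 2 :=
  (hf.const_mul (C : ℂ)).mono (hχ.aestronglyMeasurable.mul hf.1) (Eventually.of_forall fun x => by
    rw [norm_mul, norm_mul, Complex.norm_real]
    exact mul_le_mul_of_nonneg_right ((hC x).trans (le_abs_self C)) (norm_nonneg _))

/-- Needed for gauge variations, whose multiplier is bounded with bounded gradient but need not have
compact support. -/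
theorem MemH1.mul_contDiff (hf : MemH1 f) {χ : ℂ → ℂ} (hχ : ContDiff ℝ ∞ χ) {C : ℝ}
    (hC : ∀ x, ‖χ x‖ ≤ C) (hC' : ∀ x, ‖fderiv ℝ χ x‖ ≤ C) : MemH1 (fun x => χ x * f x) := by
  have hb : ∀ v x : ℂ, ‖fderiv ℝ χ x v‖ ≤ C * ‖v‖ := fun v x =>
    (ContinuousLinearMap.le_opNorm _ _).trans (mul_le_mul_of_nonneg_right (hC' x) (norm_nonneg v))
  exact ⟨hf.1.bdd_continuous_mul hχ.continuous hC,
    ⟨_, hf.hasWeakDerivOn_one.mul_contDiff hχ,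
      (hf.1.bdd_continuous_mul (contDiff_fderiv_apply_const hχ 1).continuous (hb 1)).add
      (hf.memLp_one.bdd_continuous_mul hχ.continuous hC)⟩,
    ⟨_, hf.hasWeakDerivOn_I.mul_contDiff hχ,
      (hf.1.bdd_continuous_mul (contDiff_fderiv_apply_const hχ Complex.I).continuous
        (hb Complex.I)).add (hf.memLp_I.bdd_continuous_mul hχ.continuous hC)⟩⟩

theorem memH1_of_contDiff (hh : ContDiff ℝ ∞ h) (hc : HasCompactSupport h) : MemH1 h :=
  ⟨hh.continuous.memLp_of_hasCompactSupport hc,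
    ⟨_, hasWeakDerivOn_of_contDiff hh, (contDiff_fderiv_apply_const hh 1).continuous
      |>.memLp_of_hasCompactSupport (hasCompactSupport_fderiv_apply hc 1)⟩,
    ⟨_, hasWeakDerivOn_of_contDiff hh, (contDiff_fderiv_apply_const hh Complex.I).continuous
      |>.memLp_of_hasCompactSupport (hasCompactSupport_fderiv_apply hc Complex.I)⟩⟩

theorem MemH1.locallyIntegrable (hf : MemH1 f) : LocallyIntegrable f :=
  hf.hasWeakDerivOn_one.left

end MemH1


/-! ### Equivariant functions. -/

section Equivariant

variable {m : ℤ} {f h : ℂ → ℂ}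

theorem IsEquivariant.add (hf : IsEquivariant m f) (hh : IsEquivariant m h) :
    IsEquivariant m (fun x => f x + h x) := by
  obtain ⟨u, hu⟩ := hf
  obtain ⟨w, hw⟩ := hh
  exact ⟨fun r => u r + w r, fun x => by simp only [hu x, hw x, mul_add]⟩

theorem IsEquivariant.mul_radial (hf : IsEquivariant m f) (X : ℝ → ℂ) :
    IsEquivariant m (fun x => X ‖x‖ * f x) := by
  obtain ⟨u, hu⟩ := hf
  exact ⟨fun r => X r * u r, fun x => by simp only [hu x]; ring⟩

theorem IsEquivariant.const_mul (hf : IsEquivariant m f) (c : ℂ) :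
    IsEquivariant m (fun x => c * f x) := hf.mul_radial fun _ => c

theorem IsEquivariant.apply_eq (hf : IsEquivariant m f) (x : ℂ) :
    f x = Complex.exp (Complex.I * m * x.arg) * f (‖x‖ : ℂ) := by
  obtain ⟨u, hu⟩ := hf
  rw [hu x, hu (‖x‖ : ℂ), Complex.arg_ofReal_of_nonneg (norm_nonneg x)]
  simp

/-- Writing the phase as a power of `x/|x|` makes it visibly multiplicative and hides the branch cut
of `arg`. -/
theorem exp_arg_eq_zpow {x : ℂ} (hx : x ≠ 0) :
    Complex.exp (Complex.I * m * x.arg) = (x / ‖x‖) ^ m := by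
  have h0 : (‖x‖ : ℂ) ≠ 0 := by simpa using hx
  have : x / ‖x‖ = Complex.exp (x.arg * Complex.I) := by
    rw [div_eq_iff h0, mul_comm, Complex.norm_mul_exp_arg_mul_I]
  rw [this, ← Complex.exp_int_mul]
  congr 1; ring

theorem IsEquivariant.apply_eq_zpow (hf : IsEquivariant m f) {x : ℂ} (hx : x ≠ 0) :
    f x = (x / ‖x‖) ^ m * f (‖x‖ : ℂ) := by
  rw [hf.apply_eq x, exp_arg_eq_zpow hx]

theorem norm_exp_I_mul (a : ℝ) (x : ℂ) : ‖Complex.exp (a * Complex.I) * x‖ = ‖x‖ := by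
  rw [norm_mul, Complex.norm_exp_ofReal_mul_I, one_mul]

theorem IsEquivariant.norm_apply (hf : IsEquivariant m f) (x : ℂ) : ‖f x‖ = ‖f (‖x‖ : ℂ)‖ := by
  rw [hf.apply_eq x, norm_mul,
    show Complex.I * m * x.arg = ((m * x.arg : ℝ) : ℂ) * Complex.I by push_cast; ring,
    Complex.norm_exp_ofReal_mul_I, one_mul]

/-- The origin is excluded: there `arg` is 0 and the value of `f` is arbitrary, whereas a nontrivial
phase would force it to vanish. -/
theorem IsEquivariant.rotate (hf : IsEquivariant m f) (a : ℝ) {x : ℂ} (hx : x ≠ 0) :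
    f (Complex.exp (a * Complex.I) * x) = Complex.exp (m * (a * Complex.I)) * f x := by
  rw [hf.apply_eq_zpow (mul_ne_zero (Complex.exp_ne_zero _) hx), hf.apply_eq_zpow hx,
    norm_exp_I_mul, mul_div_assoc, mul_zpow, Complex.exp_int_mul, mul_assoc]

theorem isEquivariant_of_rotate
    (h : ∀ (a : ℝ) (x : ℂ), f (Complex.exp (a * Complex.I) * x)
      = Complex.exp (m * (a * Complex.I)) * f x) : IsEquivariant m f := by
  refine ⟨fun r => f r, fun x => ?_⟩
  conv_lhs => rw [← Complex.norm_mul_exp_arg_mul_I x, mul_comm, h]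
  congr 2; ring

end Equivariant

/-! ### Rotations, dilations and the angular derivative. -/

section Rotation

theorem measurePreserving_exp_mul (a : ℝ) :
    MeasurePreserving (fun x : ℂ => Complex.exp (a * Complex.I) * x) := by
  have := (rotation (Circle.exp a)).measurePreserving
  convert! this using 1

theorem integral_exp_mul {V : Type*} [NormedAddCommGroup V] [NormedSpace ℝ V] (a : ℝ) (g : ℂ → V) :
    ∫ x, g (Complex.exp (a * Complex.I) * x) = ∫ x, g x :=
  (measurePreserving_exp_mul a).integral_comp
    (Homeomorph.mulLeft₀ _ (Complex.exp_ne_zero _)).measurableEmbedding g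

theorem fderiv_apply_re_im {V : Type*} [NormedAddCommGroup V] [NormedSpace ℝ V] (L : ℂ →L[ℝ] V)
    (y : ℂ) : L y = y.re • L 1 + y.im • L Complex.I := by
  conv_lhs => rw [← Complex.re_add_im y]
  rw [map_add, show (y.re : ℂ) = y.re • (1 : ℂ) by simp, show (y.im : ℂ) * Complex.I
    = y.im • Complex.I by simp, map_smul, map_smul]

variable {f F₁ F₂ : ℂ → ℂ}

/-- Used with `χ` a coordinate function, to assemble the rotation and dilation vector fields from
the two partial derivatives. -/
theorem integral_fderiv_mul_mul {v : ℂ} {F : ℂ → ℂ} (h : HasWeakDerivOn univ v f F) {χ η : ℂ → ℂ}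
    (hχ : ContDiff ℝ ∞ χ) (hη : ContDiff ℝ ∞ η) (hc : HasCompactSupport η) :
    ∫ x, (fderiv ℝ χ x v * η x + χ x * fderiv ℝ η x v) * f x = - ∫ x, χ x * η x * F x := by
  rw [← h.integral_fderiv_mul (hχ.mul hη) hc.mul_left]
  congr 1; ext x
  rw [fderiv_fun_mul (hχ.differentiable (by simp) x) (hη.differentiable (by simp) x)]
  simp only [add_apply, smul_apply, smul_eq_mul]
  ring

theorem contDiff_ofReal_re : ContDiff ℝ ∞ (fun x : ℂ => (x.re : ℂ)) :=
  (Complex.ofRealCLM.comp Complex.reCLM).contDiff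

theorem contDiff_ofReal_im : ContDiff ℝ ∞ (fun x : ℂ => (x.im : ℂ)) :=
  (Complex.ofRealCLM.comp Complex.imCLM).contDiff

theorem fderiv_ofReal_re (x v : ℂ) : fderiv ℝ (fun x : ℂ => (x.re : ℂ)) x v = v.re :=
  congrArg (fun L : ℂ →L[ℝ] ℂ => L v) (Complex.ofRealCLM.comp Complex.reCLM).fderiv

theorem fderiv_ofReal_im (x v : ℂ) : fderiv ℝ (fun x : ℂ => (x.im : ℂ)) x v = v.im :=
  congrArg (fun L : ℂ →L[ℝ] ℂ => L v) (Complex.ofRealCLM.comp Complex.imCLM).fderiv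

/-- Weak form of the rotational derivative. -/
theorem integral_fderiv_rotation (h₁ : HasWeakDerivOn univ 1 f F₁)
    (h₂ : HasWeakDerivOn univ Complex.I f F₂) {η : ℂ → ℂ} (hη : ContDiff ℝ ∞ η)
    (hc : HasCompactSupport η) :
    ∫ x, fderiv ℝ η x (Complex.I * x) * f x = - ∫ x, η x * (x.re * F₂ x - x.im * F₁ x) := by
  have e1 := integral_fderiv_mul_mul h₁ contDiff_ofReal_im hη hc
  have e2 := integral_fderiv_mul_mul h₂ contDiff_ofReal_re hη hc
  simp only [fderiv_ofReal_im, fderiv_ofReal_re, Complex.one_im, Complex.I_re, Complex.ofReal_zero,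
    zero_mul, zero_add] at e1 e2
  have d := fun v => (contDiff_fderiv_apply_const hη v).continuous
  have dc := fun v => hasCompactSupport_fderiv_apply hc v
  have i1 := h₁.left.integrable_mul_of_hasCompactSupport (contDiff_ofReal_im.continuous.mul (d 1))
    (dc 1).mul_left
  have i2 := h₁.left.integrable_mul_of_hasCompactSupport
    (contDiff_ofReal_re.continuous.mul (d Complex.I)) (dc Complex.I).mul_left
  have i3 := h₁.right.integrable_mul_of_hasCompactSupport
    (contDiff_ofReal_im.continuous.mul hη.continuous) hc.mul_left
  have i4 := h₂.right.integrable_mul_of_hasCompactSupport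
    (contDiff_ofReal_re.continuous.mul hη.continuous) hc.mul_left
  simp only [Pi.mul_apply] at i1 i2 i3 i4
  calc ∫ x, fderiv ℝ η x (Complex.I * x) * f x
      = ∫ x, ((x.re : ℂ) * fderiv ℝ η x Complex.I * f x - (x.im : ℂ) * fderiv ℝ η x 1 * f x) := by
        congr 1; ext x
        rw [fderiv_apply_re_im (fderiv ℝ η x) (Complex.I * x)]
        simp only [Complex.mul_re, Complex.I_re, zero_mul, Complex.I_im, one_mul, zero_sub,
          Complex.mul_im, zero_add, Complex.real_smul, Complex.ofReal_neg]
        ring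
    _ = - ∫ x, ((x.re : ℂ) * η x * F₂ x - (x.im : ℂ) * η x * F₁ x) := by
        rw [integral_sub i2 i1, integral_sub i4 i3, e1, e2]; ring
    _ = _ := by
        congr 2; ext x; ring

/-- Weak form of the dilation derivative. -/
theorem integral_fderiv_dilation (h₁ : HasWeakDerivOn univ 1 f F₁)
    (h₂ : HasWeakDerivOn univ Complex.I f F₂) {η : ℂ → ℂ} (hη : ContDiff ℝ ∞ η)
    (hc : HasCompactSupport η) :
    ∫ x, (2 * η x + fderiv ℝ η x x) * f x = - ∫ x, η x * (x.re * F₁ x + x.im * F₂ x) := by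
  have e1 := integral_fderiv_mul_mul h₁ contDiff_ofReal_re hη hc
  have e2 := integral_fderiv_mul_mul h₂ contDiff_ofReal_im hη hc
  simp only [fderiv_ofReal_im, fderiv_ofReal_re, Complex.one_re, Complex.I_im, Complex.ofReal_one,
    one_mul] at e1 e2
  have d := fun v => (contDiff_fderiv_apply_const hη v).continuous
  have dc := fun v => hasCompactSupport_fderiv_apply hc v
  have i1 := h₁.left.integrable_mul_of_hasCompactSupport
    (hη.continuous.add (contDiff_ofReal_re.continuous.mul (d 1))) (hc.add (dc 1).mul_left)
  have i2 := h₁.left.integrable_mul_of_hasCompactSupport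
    (hη.continuous.add (contDiff_ofReal_im.continuous.mul (d Complex.I)))
    (hc.add (dc Complex.I).mul_left)
  have i3 := h₁.right.integrable_mul_of_hasCompactSupport
    (contDiff_ofReal_re.continuous.mul hη.continuous) hc.mul_left
  have i4 := h₂.right.integrable_mul_of_hasCompactSupport
    (contDiff_ofReal_im.continuous.mul hη.continuous) hc.mul_left
  simp only [Pi.mul_apply, Pi.add_apply] at i1 i2 i3 i4
  calc ∫ x, (2 * η x + fderiv ℝ η x x) * f x
      = ∫ x, ((η x + (x.re : ℂ) * fderiv ℝ η x 1) * f x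
          + (η x + (x.im : ℂ) * fderiv ℝ η x Complex.I) * f x) := by
        congr 1; ext x
        rw [fderiv_apply_re_im (fderiv ℝ η x) x]
        simp only [Complex.real_smul]
        ring
    _ = - ∫ x, ((x.re : ℂ) * η x * F₁ x + (x.im : ℂ) * η x * F₂ x) := by
        rw [integral_add i1 i2, integral_add i3 i4, e1, e2]; ring
    _ = _ := by
        congr 2; ext x; ring

/-- Rotating the integration variable transfers the rotation to `f`, which answers with its
character. Differentiating at `a = 0` gives the infinitesimal form of equivariance. -/
theorem integral_comp_exp_mul_mul {m : ℤ} (hf : IsEquivariant m f) (η : ℂ → ℂ) (a : ℝ) :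
    ∫ x, η (Complex.exp (a * Complex.I) * x) * f x
      = Complex.exp (-(m * (a * Complex.I))) * ∫ x, η x * f x := by
  rw [← integral_exp_mul a (fun x => η x * f x), ← integral_const_mul]
  apply integral_congr_ae
  filter_upwards [compl_mem_ae_iff.2 (measure_singleton (0 : ℂ))] with x hx
  rw [hf.rotate a hx]
  have : Complex.exp (-(m * (a * Complex.I))) * Complex.exp (m * (a * Complex.I)) = 1 := by
    rw [← Complex.exp_add, neg_add_cancel, Complex.exp_zero]
  linear_combination (-(η (Complex.exp (a * Complex.I) * x) * f x)) * this

/-- The derivative falls on the smooth factor only, so local integrability of `f` suffices.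
Rotations preserve the ball containing the support, which makes one dominating function serve for
every angle. -/
theorem hasDerivAt_integral_rotation (hf : LocallyIntegrable f) {η : ℂ → ℂ} (hη : ContDiff ℝ ∞ η)
    (hc : HasCompactSupport η) :
    HasDerivAt (fun a : ℝ => ∫ x, η (Complex.exp (a * Complex.I) * x) * f x)
      (∫ x, fderiv ℝ η x (Complex.I * x) * f x) 0 := by
  have hDc : Continuous (fun y => fderiv ℝ η y (Complex.I * y)) :=
    ((hη.continuous_fderiv (by simp)).clm_apply (continuous_const.mul continuous_id))
  have hDs : HasCompactSupport (fun y => fderiv ℝ η y (Complex.I * y)) := by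
    refine (hc.fderiv ℝ).mono fun x hx => ?_
    intro h0; exact hx (by simp [h0])
  obtain ⟨M, hM⟩ := hDs.exists_bound_of_continuous hDc
  obtain ⟨R, hR⟩ := hDs.isCompact.isBounded.subset_closedBall 0
  have rot : ∀ a : ℝ, Continuous fun x : ℂ => Complex.exp (a * Complex.I) * x :=
    fun a => continuous_const.mul continuous_id
  have key := hasDerivAt_integral_of_dominated_loc_of_deriv_le (μ := volume) (x₀ := (0 : ℝ))
    (s := univ)
    (F := fun (a : ℝ) (x : ℂ) => η (Complex.exp (a * Complex.I) * x) * f x)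
    (F' := fun (a : ℝ) (x : ℂ) => fderiv ℝ η (Complex.exp (a * Complex.I) * x)
      (Complex.I * (Complex.exp (a * Complex.I) * x)) * f x)
    (bound := (Metric.closedBall (0 : ℂ) R).indicator fun x => M * ‖f x‖)
    univ_mem
    (Eventually.of_forall fun a =>
      (hη.continuous.comp (rot a)).aestronglyMeasurable.mul hf.aestronglyMeasurable)
    (by simpa using hf.integrable_mul_of_hasCompactSupport hη.continuous hc)
    ((hDc.comp (rot 0)).aestronglyMeasurable.mul hf.aestronglyMeasurable)
    (Eventually.of_forall fun x a _ => by
      by_cases hx : x ∈ Metric.closedBall (0 : ℂ) R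
      · rw [indicator_of_mem hx, norm_mul]
        exact mul_le_mul_of_nonneg_right (hM _) (norm_nonneg _)
      · rw [indicator_of_notMem hx]
        have h0 : fderiv ℝ η (Complex.exp (a * Complex.I) * x)
            (Complex.I * (Complex.exp (a * Complex.I) * x)) = 0 :=
          image_eq_zero_of_notMem_tsupport (f := fun y => fderiv ℝ η y (Complex.I * y))
            fun hmem => hx (by
              have := hR hmem
              rw [mem_closedBall_zero_iff] at this ⊢
              rwa [norm_exp_I_mul] at this)
        rw [h0]; simp)
    ((integrable_indicator_iff Metric.isClosed_closedBall.measurableSet).2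
      ((hf.integrableOn_isCompact (isCompact_closedBall _ _)).norm.const_mul M))
    (Eventually.of_forall fun x a _ => by
      have h1 : HasDerivAt (fun a : ℝ => Complex.exp (a * Complex.I) * x)
          (Complex.I * (Complex.exp (a * Complex.I) * x)) a := by
        have := (((Complex.ofRealCLM.hasDerivAt (x := a)).mul_const Complex.I).cexp).mul_const x
        convert! this using 1
        simp; ring
      exact ((hη.differentiable (by simp) _).hasFDerivAt.comp_hasDerivAt a h1).mul_const _)
  simpa using key.2

/-- The angular derivative of an `m`-equivariant function is multiplication by `i m`. -/
theorem angular_deriv_ae_eq {m : ℤ} (hf : IsEquivariant m f) (h₁ : HasWeakDerivOn univ 1 f F₁)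
    (h₂ : HasWeakDerivOn univ Complex.I f F₂) :
    ∀ᵐ x : ℂ, (x.re : ℂ) * F₂ x - x.im * F₁ x = Complex.I * m * f x := by
  have l1 : LocallyIntegrable fun x : ℂ => (x.re : ℂ) * F₂ x :=
    h₂.right.continuous_mul contDiff_ofReal_re.continuous
  have l2 : LocallyIntegrable fun x : ℂ => (x.im : ℂ) * F₁ x :=
    h₁.right.continuous_mul contDiff_ofReal_im.continuous
  have l3 : LocallyIntegrable fun x : ℂ => Complex.I * m * f x :=
    h₁.left.continuous_mul continuous_const
  have := ae_eq_zero_of_integral_contDiff_smul_eq_zero (μ := volume) ((l1.sub l2).sub l3)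
    fun g hg hgc => by
      let η : ℂ → ℂ := fun x => (g x : ℂ)
      have hη : ContDiff ℝ ∞ η := Complex.ofRealCLM.contDiff.comp hg
      have hc : HasCompactSupport η := hgc.comp_left (g := fun t : ℝ => (t : ℂ)) rfl
      have e1 := hasDerivAt_integral_rotation h₁.left hη hc
      simp_rw [integral_comp_exp_mul_mul hf η] at e1
      have e2 : HasDerivAt (fun a : ℝ => Complex.exp (-(m * (a * Complex.I))) * ∫ x, η x * f x)
          (-(m * Complex.I) * ∫ x, η x * f x) 0 := by
        have := ((((Complex.ofRealCLM.hasDerivAt (x := (0 : ℝ))).mul_const Complex.I).const_mul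
          (m : ℂ)).neg.cexp).mul_const (∫ x, η x * f x)
        convert! this using 1
        simp
      -- The pairing with a rotated test function has been differentiated twice: once on the test
      -- function, once through the explicit character.
      have e3 := e1.unique e2
      rw [integral_fderiv_rotation h₁ h₂ hη hc] at e3
      have i0 := (l1.sub l2).integrable_mul_of_hasCompactSupport hη.continuous hc
      have i1 := l3.integrable_mul_of_hasCompactSupport hη.continuous hc
      simp only [Pi.sub_apply] at i0
      calc ∫ x, g x • (((fun x : ℂ => (x.re : ℂ) * F₂ x) - (fun x : ℂ => (x.im : ℂ) * F₁ x))
            - fun x => Complex.I * m * f x) x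
          = ∫ x, (η x * (x.re * F₂ x - x.im * F₁ x) - η x * (Complex.I * m * f x)) := by
            congr 1; ext x
            simp only [η, Pi.sub_apply, Complex.real_smul]; ring
        _ = 0 := by
            rw [integral_sub i0 i1]
            have : ∫ x, η x * (Complex.I * m * f x) = Complex.I * m * ∫ x, η x * f x := by
              rw [← integral_const_mul]; congr 1; ext x; ring
            rw [this]; linear_combination -e3
  filter_upwards [this] with x hx
  simp only [Pi.sub_apply] at hx
  exact sub_eq_zero.1 hx

end Rotation


/-! ### Polar coordinates and circular means. -/

section Polar

theorem integral_radial {V : Type*} [NormedAddCommGroup V] [NormedSpace ℝ V] (F : ℝ → V) :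
    ∫ x : ℂ, F ‖x‖ = (2 * Real.pi) • ∫ r in Ioi (0 : ℝ), r • F r := by
  have h : (volume : Measure ℂ).real (Metric.ball (0 : ℂ) 1) = Real.pi := by
    simp [Measure.real, Complex.volume_ball]
  rw [integral_fun_norm_addHaar (volume : Measure ℂ) F, Complex.finrank_real_complex, h]
  simp only [Nat.add_one_sub_one, pow_one]
  rw [← Nat.cast_smul_eq_nsmul ℝ, smul_smul]
  norm_num

theorem integrable_radial_iff {V : Type*} [NormedAddCommGroup V] [NormedSpace ℝ V] {F : ℝ → V} :
    Integrable (fun x : ℂ => F ‖x‖) ↔ IntegrableOn (fun r => r • F r) (Ioi (0 : ℝ)) := by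
  rw [integrable_fun_norm_addHaar (volume : Measure ℂ), Complex.finrank_real_complex]
  simp

theorem integrable_polarCoord {H : ℂ → ℂ} (hH : Integrable H) :
    Integrable (fun p : ℝ × ℝ => p.1 • H (Complex.polarCoord.symm p))
      ((volume.restrict (Ioi 0)).prod (volume.restrict (Ioo (-Real.pi) Real.pi))) := by
  have h1 : Integrable (fun p : ℝ × ℝ => H (Complex.measurableEquivRealProd.symm p)) :=
    (Complex.volume_preserving_equiv_real_prod.symm).integrable_comp_of_integrable hH
  have h2 := (integrableOn_image_iff_integrableOn_abs_det_fderiv_smul volume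
    polarCoord.open_target.measurableSet
    (fun p _ => (hasFDerivAt_polarCoord_symm p).hasFDerivWithinAt) polarCoord.symm.injOn
    (fun p : ℝ × ℝ => H (Complex.measurableEquivRealProd.symm p))).1 h1.integrableOn
  rw [Measure.prod_restrict]
  refine (integrableOn_congr_fun ?_ polarCoord.open_target.measurableSet).1 h2
  intro p hp
  simp only [det_fderivPolarCoordSymm]
  rw [abs_of_pos hp.1]
  rfl

/-- The mean of a function over the circle of radius `r`. -/
noncomputable def angMean (H : ℂ → ℂ) (r : ℝ) : ℂ :=
  (2 * Real.pi)⁻¹ • ∫ θ in Ioo (-Real.pi) Real.pi, H (Complex.polarCoord.symm (r, θ))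

theorem angMean_radial_mul (a : ℝ → ℂ) (H : ℂ → ℂ) {r : ℝ} (hr : 0 < r) :
    angMean (fun x => a ‖x‖ * H x) r = a r * angMean H r := by
  simp only [angMean, Complex.norm_polarCoord_symm, abs_of_pos hr]
  rw [integral_const_mul, mul_smul_comm]

theorem integrableOn_angMean {H : ℂ → ℂ} (hH : Integrable H) :
    IntegrableOn (fun r => r • angMean H r) (Ioi 0) := by
  have := (integrable_polarCoord hH).integral_prod_left.smul ((2 * Real.pi)⁻¹)
  refine this.congr (Eventually.of_forall fun r => ?_)
  simp only [angMean, Pi.smul_apply]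
  rw [integral_smul, smul_comm]

theorem integral_eq_angMean {H : ℂ → ℂ} (hH : Integrable H) :
    ∫ x, H x = (2 * Real.pi) • ∫ r in Ioi (0 : ℝ), r • angMean H r := by
  rw [← Complex.integral_comp_polarCoord_symm, polarCoord_target, Measure.volume_eq_prod,
    ← Measure.prod_restrict, integral_prod _ (integrable_polarCoord hH), ← integral_smul]
  congr 1; ext r
  simp only [angMean]
  rw [integral_smul, smul_comm r, smul_smul, mul_inv_cancel₀ (by positivity), one_smul]

/-- On a compact subset of the open half-line `1/r` is bounded, so the polar weight can be divided
out. -/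
theorem locallyIntegrableOn_of_smul {g : ℝ → ℂ}
    (h : ∀ b : ℝ, IntegrableOn (fun r => r • g r) (Ioo 0 b)) :
    LocallyIntegrableOn g (Ioi 0) := by
  rw [locallyIntegrableOn_iff isOpen_Ioi.isLocallyClosed]
  intro K hK hKc
  obtain ⟨b, hb⟩ := hKc.bddAbove
  have h1 : IntegrableOn (fun r => r • g r) K :=
    (h (b + 1)).mono_set fun x hx => ⟨hK hx, by linarith [hb hx]⟩
  have h2 := h1.continuousOn_smul (f := fun r : ℝ => r⁻¹)
    (continuousOn_inv₀.mono fun x hx => (hK hx : (0 : ℝ) < x).ne') hKc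
  refine (integrableOn_congr_fun (fun x hx => ?_) hKc.measurableSet).1 h2
  have : x ≠ 0 := (hK hx : (0 : ℝ) < x).ne'
  rw [smul_smul, inv_mul_cancel₀ this, one_smul]

theorem locallyIntegrableOn_angMean {H : ℂ → ℂ} (hH : LocallyIntegrable H) :
    LocallyIntegrableOn (angMean H) (Ioi 0) := by
  refine locallyIntegrableOn_of_smul fun b => ?_
  have h1 : Integrable ((Metric.closedBall (0 : ℂ) b).indicator H) :=
    (integrable_indicator_iff Metric.isClosed_closedBall.measurableSet).2
      (hH.integrableOn_isCompact (isCompact_closedBall _ _))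
  refine (integrableOn_congr_fun (fun r hr => ?_) measurableSet_Ioo).1
    ((integrableOn_angMean h1).mono_set Ioo_subset_Ioi_self)
  simp only [angMean]
  congr 2
  refine integral_congr_ae (Eventually.of_forall fun θ => ?_)
  refine indicator_of_mem ?_ _
  rw [mem_closedBall_zero_iff, Complex.norm_polarCoord_symm, abs_of_pos hr.1]
  exact hr.2.le

theorem locallyIntegrableOn_of_radial {F : ℝ → ℂ}
    (hF : LocallyIntegrable fun x : ℂ => F ‖x‖) : LocallyIntegrableOn F (Ioi 0) := by
  refine locallyIntegrableOn_of_smul fun b => ?_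
  have := (integrableOn_fun_norm_addHaar (volume : Measure ℂ) (f := F) (r := b)).1
    ((hF.integrableOn_isCompact (isCompact_closedBall _ _)).mono_set Metric.ball_subset_closedBall)
  simpa [Complex.finrank_real_complex] using this

end Polar

/-! ### Smooth radial functions. -/

section RadialSmooth

/-- The norm is smooth away from 0, and constancy of `X` near 0 removes the only singular point. -/
theorem contDiff_comp_norm {X : ℝ → ℝ} (hX : ContDiff ℝ ∞ X) {c : ℝ}
    (h0 : ∀ᶠ r in 𝓝 (0 : ℝ), X r = c) : ContDiff ℝ ∞ (fun x : ℂ => X ‖x‖) := by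
  rw [contDiff_iff_contDiffAt]
  intro x
  by_cases hx : x = 0
  · have : (fun x : ℂ => X ‖x‖) =ᶠ[𝓝 x] fun _ => c := by
      have ht : Tendsto (fun x : ℂ => ‖x‖) (𝓝 x) (𝓝 0) := by
        rw [hx]; simpa using (continuous_norm (E := ℂ)).tendsto 0
      exact ht.eventually h0
    exact contDiffAt_const.congr_of_eventuallyEq this
  · exact hX.contDiffAt.comp x (contDiffAt_norm ℝ hx)

theorem fderiv_comp_norm {X : ℝ → ℝ} (hX : Differentiable ℝ X) {x : ℂ} (hx : x ≠ 0) (y : ℂ) :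
    fderiv ℝ (fun x : ℂ => X ‖x‖) x y = deriv X ‖x‖ * (fderiv ℝ (fun x : ℂ => ‖x‖) x y) := by
  have hn : DifferentiableAt ℝ (fun x : ℂ => ‖x‖) x :=
    (contDiffAt_norm ℝ hx (n := 1)).differentiableAt one_ne_zero
  have := (hX ‖x‖).hasDerivAt.comp_hasFDerivAt x hn.hasFDerivAt
  rw [show (fun x : ℂ => X ‖x‖) = X ∘ fun x => ‖x‖ from rfl, this.fderiv]
  simp

theorem fderiv_norm_apply {x : ℂ} (hx : x ≠ 0) (y : ℂ) :
    fderiv ℝ (fun x : ℂ => ‖x‖) x y = (x.re * y.re + x.im * y.im) / ‖x‖ := by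
  have hn : DifferentiableAt ℝ (fun x : ℂ => ‖x‖) x :=
    (contDiffAt_norm ℝ hx (n := 1)).differentiableAt one_ne_zero
  have h1 := hn.hasFDerivAt.pow 2
  have h2 := congrArg (fun L : ℂ →L[ℝ] ℝ => L y)
    (h1.unique (hasStrictFDerivAt_norm_sq x).hasFDerivAt)
  simp only [smul_apply, nsmul_eq_mul, innerSL_apply_apply, Complex.inner, Complex.mul_re,
    Complex.conj_re, Complex.conj_im, smul_eq_mul] at h2
  have hx' : ‖x‖ ≠ 0 := norm_ne_zero_iff.2 hx
  field_simp
  simp at h2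
  linarith

theorem hasCompactSupport_comp_norm {X : ℝ → ℝ} (hX : HasCompactSupport X) :
    HasCompactSupport (fun x : ℂ => X ‖x‖) := by
  obtain ⟨R, hR⟩ := hX.isCompact.isBounded.subset_closedBall 0
  refine HasCompactSupport.of_support_subset_isCompact (isCompact_closedBall (0 : ℂ) R) ?_
  intro x hx
  have := hR (subset_tsupport _ (show ‖x‖ ∈ Function.support X from hx))
  simpa using this

theorem eventually_eq_zero_of_tsupport {v : ℝ → ℝ} (hs : tsupport v ⊆ Ioi 0) :
    ∀ᶠ r in 𝓝 (0 : ℝ), v r = 0 := by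
  have : (0 : ℝ) ∉ tsupport v := fun h => lt_irrefl (0 : ℝ) (hs h)
  exact notMem_tsupport_iff_eventuallyEq.1 this

theorem contDiff_div_pow {v : ℝ → ℝ} (hv : ContDiff ℝ ∞ v) (hs : tsupport v ⊆ Ioi 0) (k : ℕ) :
    ContDiff ℝ ∞ (fun r => v r / r ^ k) := by
  rw [contDiff_iff_contDiffAt]
  intro r
  by_cases hr : r = 0
  · have : (fun r => v r / r ^ k) =ᶠ[𝓝 r] fun _ => 0 := by
      rw [hr]
      filter_upwards [eventually_eq_zero_of_tsupport hs] with r hr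
      rw [hr, zero_div]
    exact contDiffAt_const.congr_of_eventuallyEq this
  · exact hv.contDiffAt.div (contDiffAt_id.pow k) (pow_ne_zero k hr)

end RadialSmooth

/-! ### Weak differentiability of the radial profile. -/

section Profile

variable {n : ℕ} {f F₁ F₂ : ℂ → ℂ}

/-- The radial derivative with the angular phase removed. -/
noncomputable def radialPart (n : ℕ) (F₁ F₂ : ℂ → ℂ) (x : ℂ) : ℂ :=
  (conj x / ‖x‖) ^ n * radialDeriv x (F₁ x) (F₂ x)

theorem norm_radialDeriv_le (x a b : ℂ) : ‖radialDeriv x a b‖ ≤ ‖a‖ + ‖b‖ := by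
  unfold radialDeriv
  by_cases hx : x = 0
  · simp [hx]; positivity
  have hx' : 0 < ‖x‖ := norm_pos_iff.2 hx
  rw [norm_div, Complex.norm_real, norm_norm, div_le_iff₀ hx']
  refine (norm_add_le _ _).trans ?_
  rw [norm_mul, norm_mul, Complex.norm_real, Complex.norm_real, Real.norm_eq_abs, Real.norm_eq_abs]
  nlinarith [Complex.abs_re_le_norm x, Complex.abs_im_le_norm x, norm_nonneg a, norm_nonneg b]

theorem aestronglyMeasurable_radialDeriv (h₁ : AEStronglyMeasurable F₁) (h₂ : AEStronglyMeasurable F₂) :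
    AEStronglyMeasurable (fun x => radialDeriv x (F₁ x) (F₂ x)) := by
  simp only [radialDeriv, div_eq_mul_inv]
  refine ((contDiff_ofReal_re.continuous.aestronglyMeasurable.mul h₁).add
    (contDiff_ofReal_im.continuous.aestronglyMeasurable.mul h₂)).mul ?_
  exact ((Complex.measurable_ofReal.comp measurable_norm).inv).aestronglyMeasurable

theorem memLp_radialDeriv (h₁ : MemLp F₁ 2) (h₂ : MemLp F₂ 2) :
    MemLp (fun x => radialDeriv x (F₁ x) (F₂ x)) 2 :=
  (h₁.norm.add h₂.norm).mono (aestronglyMeasurable_radialDeriv h₁.1 h₂.1)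
    (Eventually.of_forall fun x => (norm_radialDeriv_le x _ _).trans (le_abs_self _))

theorem norm_radialPart_le (x : ℂ) :
    ‖radialPart n F₁ F₂ x‖ ≤ ‖radialDeriv x (F₁ x) (F₂ x)‖ := by
  unfold radialPart
  rw [norm_mul, norm_pow, norm_div, Complex.norm_conj, Complex.norm_real, norm_norm]
  exact mul_le_of_le_one_left (norm_nonneg _) (pow_le_one₀ (by positivity) (div_self_le_one _))

theorem memLp_radialPart (h₁ : MemLp F₁ 2) (h₂ : MemLp F₂ 2) :
    MemLp (radialPart n F₁ F₂) 2 := by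
  refine (memLp_radialDeriv h₁ h₂).mono ?_ (Eventually.of_forall norm_radialPart_le)
  refine AEStronglyMeasurable.mul ?_ (memLp_radialDeriv h₁ h₂).1
  have : Measurable fun x : ℂ => (conj x / ‖x‖) ^ n :=
    ((Complex.continuous_conj.measurable).div
      (Complex.measurable_ofReal.comp measurable_norm)).pow_const n
  exact this.aestronglyMeasurable

/-- The conjugate phase cancels the phase of `f`. With a natural exponent, `conj x ^ n` is moreover
a polynomial, hence allowed as a factor in smooth test functions. -/
theorem conj_div_pow_mul (hf : IsEquivariant n f) {x : ℂ} (hx : x ≠ 0) :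
    (conj x / ‖x‖) ^ n * f x = f (‖x‖ : ℂ) := by
  rw [hf.apply_eq_zpow hx, zpow_natCast, ← mul_assoc, ← mul_pow, div_mul_div_comm,
    ← Complex.normSq_eq_conj_mul_self, Complex.normSq_eq_norm_sq]
  have : (‖x‖ : ℂ) ≠ 0 := by simpa using hx
  rw [Complex.ofReal_pow, ← pow_two, div_self (pow_ne_zero 2 this), one_pow, one_mul]

theorem ae_ne_zero : ∀ᵐ x : ℂ, x ≠ 0 := compl_mem_ae_iff.2 (measure_singleton (0 : ℂ))

theorem locallyIntegrable_radial_profile (hf : IsEquivariant n f) (hl : LocallyIntegrable f) :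
    LocallyIntegrable fun x : ℂ => f (‖x‖ : ℂ) := by
  have hm : AEStronglyMeasurable fun x : ℂ => f (‖x‖ : ℂ) := by
    have : Measurable fun x : ℂ => (conj x / ‖x‖) ^ n :=
      ((Complex.continuous_conj.measurable).div
        (Complex.measurable_ofReal.comp measurable_norm)).pow_const n
    refine (this.aestronglyMeasurable.mul hl.aestronglyMeasurable).congr ?_
    filter_upwards [ae_ne_zero] with x hx using conj_div_pow_mul hf hx
  exact hl.mono hm (Eventually.of_forall fun x => (hf.norm_apply x).ge)

theorem locallyIntegrableOn_profile (hf : IsEquivariant n f) (hl : LocallyIntegrable f) :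
    LocallyIntegrableOn (fun r : ℝ => f (r : ℂ)) (Ioi 0) :=
  locallyIntegrableOn_of_radial (F := fun r : ℝ => f (r : ℂ)) (locallyIntegrable_radial_profile hf hl)

/-- The radial profile is weakly differentiable on `(0, ∞)`. -/
theorem integral_deriv_mul_profile (hf : IsEquivariant n f) (h₁ : HasWeakDerivOn univ 1 f F₁)
    (h₂ : HasWeakDerivOn univ Complex.I f F₂)
    {v : ℝ → ℝ} (hv : ContDiff ℝ ∞ v) (hc : HasCompactSupport v) (hs : tsupport v ⊆ Ioi 0) :
    ∫ r : ℝ, deriv v r • f (r : ℂ) = - ∫ r : ℝ, v r • angMean (radialPart n F₁ F₂) r := by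
  -- The exponent is chosen so that `(n + 2) V + r V' = v' / r^(n+1)`. Here `n` comes from the
  -- homogeneity of `conj x ^ n` and 2 from the divergence of the dilation field. After
  -- multiplication by `conj x ^ n * f x = r^n f(r)` and by the polar weight `r`, exactly `v' f(r)`
  -- remains.
  let V : ℝ → ℝ := fun r => v r / r ^ (n + 2)
  have hV : ContDiff ℝ ∞ V := contDiff_div_pow hv hs _
  have hV0 : ∀ᶠ r in 𝓝 (0 : ℝ), V r = 0 := by
    filter_upwards [eventually_eq_zero_of_tsupport hs] with r hr
    simp [V, hr]
  have hVc : HasCompactSupport V := hc.mono fun r hr h0 => hr (by simp [V, h0])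
  have hVn := contDiff_comp_norm hV hV0
  have hVnC : ContDiff ℝ ∞ (fun x : ℂ => (V ‖x‖ : ℂ)) := Complex.ofRealCLM.contDiff.comp hVn
  have hconj : ContDiff ℝ ∞ (fun x : ℂ => conj x ^ n) := (Complex.conjCLE.contDiff).pow n
  let η : ℂ → ℂ := fun x => (V ‖x‖ : ℂ) * conj x ^ n
  have hη : ContDiff ℝ ∞ η := hVnC.mul hconj
  have hηc : HasCompactSupport η :=
    ((hasCompactSupport_comp_norm hVc).comp_left (g := fun t : ℝ => (t : ℂ)) rfl).mul_right
  have key := integral_fderiv_dilation h₁ h₂ hη hηc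
  have hL : ∫ x, (2 * η x + fderiv ℝ η x x) * f x
      = ∫ x : ℂ, (fun r : ℝ => (deriv v r / r) • f (r : ℂ)) ‖x‖ := by
    apply integral_congr_ae
    filter_upwards [ae_ne_zero] with x hx
    have hr : 0 < ‖x‖ := norm_pos_iff.2 hx
    have hrC : (‖x‖ : ℂ) ≠ 0 := by simpa using hx
    have e1 : fderiv ℝ (fun x : ℂ => (V ‖x‖ : ℂ)) x x = ((deriv V ‖x‖ * ‖x‖ : ℝ) : ℂ) := by
      rw [fderiv_ofReal_apply (hVn.differentiable (by simp)),
        fderiv_comp_norm (hV.differentiable (by simp)) hx, fderiv_norm_apply hx, ← sq, ← sq,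
        show x.re ^ 2 + x.im ^ 2 = ‖x‖ ^ 2 by rw [Complex.sq_norm, Complex.normSq_apply]; ring,
        sq ‖x‖, mul_self_div_self]
    have e2 : fderiv ℝ (fun x : ℂ => conj x ^ n) x x = n * conj x ^ n := by
      have h1 : HasFDerivAt (fun x : ℂ => conj x) (Complex.conjCLE : ℂ →L[ℝ] ℂ) x :=
        Complex.conjCLE.hasFDerivAt
      rw [(h1.pow n).fderiv]
      simp only [smul_apply, smul_eq_mul, nsmul_eq_mul]
      rcases n with _ | k
      · simp
      · simp only [Nat.add_sub_cancel, pow_succ]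
        change _ * conj x = _
        ring
    have e3 : deriv V ‖x‖ = deriv v ‖x‖ / ‖x‖ ^ (n + 2) - (n + 2) * v ‖x‖ / ‖x‖ ^ (n + 3) := by
      have h1 := ((hv.differentiable (by simp) ‖x‖).hasDerivAt).div (hasDerivAt_pow (n + 2) ‖x‖)
        (pow_ne_zero _ hr.ne')
      rw [show V = v / fun r => r ^ (n + 2) from rfl, h1.deriv]
      push_cast
      field_simp
      ring
    have e4 : fderiv ℝ η x x = ((deriv V ‖x‖ * ‖x‖ : ℝ) : ℂ) * conj x ^ n
        + (V ‖x‖ : ℂ) * (n * conj x ^ n) := by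
      rw [fderiv_fun_mul (hVnC.differentiable (by simp) x) (hconj.differentiable (by simp) x)]
      simp only [add_apply, smul_apply, smul_eq_mul]
      rw [e1, e2]; ring
    have e5 : conj x ^ n * f x = (‖x‖ : ℂ) ^ n * f (‖x‖ : ℂ) := by
      rw [← conj_div_pow_mul hf hx, div_pow]
      field_simp
    rw [e4]
    simp only [η]
    have e6 : (2 * ((V ‖x‖ : ℂ) * conj x ^ n) + (((deriv V ‖x‖ * ‖x‖ : ℝ) : ℂ) * conj x ^ n
        + (V ‖x‖ : ℂ) * (n * conj x ^ n))) * f x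
        = (((n + 2) * V ‖x‖ + deriv V ‖x‖ * ‖x‖ : ℝ) : ℂ) * (conj x ^ n * f x) := by
      push_cast; ring
    rw [e6, e5, e3, Complex.real_smul]
    have e7 : (n + 2) * V ‖x‖ + (deriv v ‖x‖ / ‖x‖ ^ (n + 2)
        - (n + 2) * v ‖x‖ / ‖x‖ ^ (n + 3)) * ‖x‖ = deriv v ‖x‖ / ‖x‖ / ‖x‖ ^ n := by
      simp only [V]; field_simp; ring
    rw [e7]; push_cast; field_simp
  have hR : ∀ᵐ x : ℂ, η x * (x.re * F₁ x + x.im * F₂ x)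
      = ((fun r : ℝ => ((v r / r : ℝ) : ℂ)) ‖x‖) * radialPart n F₁ F₂ x := by
    filter_upwards [ae_ne_zero] with x hx
    have hrC : (‖x‖ : ℂ) ≠ 0 := by simpa using hx
    simp only [η, V, radialPart, radialDeriv, div_pow]
    push_cast; field_simp; ring
  have hint : Integrable fun x : ℂ =>
      ((fun r : ℝ => ((v r / r : ℝ) : ℂ)) ‖x‖) * radialPart n F₁ F₂ x := by
    refine Integrable.congr ?_ hR
    have i1 := (h₁.right.continuous_mul contDiff_ofReal_re.continuous).add
      (h₂.right.continuous_mul contDiff_ofReal_im.continuous)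
    exact i1.integrable_mul_of_hasCompactSupport hη.continuous hηc
  rw [hL, integral_radial (fun r : ℝ => (deriv v r / r) • f (r : ℂ)), integral_congr_ae hR, integral_eq_angMean hint] at key
  have e1 : ∫ r in Ioi (0 : ℝ), r • (fun r : ℝ => (deriv v r / r) • f (r : ℂ)) r
      = ∫ r : ℝ, deriv v r • f (r : ℂ) := by
    rw [← setIntegral_eq_integral_of_forall_compl_eq_zero (s := Ioi 0)
      (f := fun r : ℝ => deriv v r • f (r : ℂ))]
    · refine setIntegral_congr_fun measurableSet_Ioi fun r hr => ?_
      simp only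
      rw [smul_smul, mul_div_cancel₀ _ (ne_of_gt hr)]
    · intro r hr
      have : deriv v r = 0 := by
        by_contra h
        exact hr (hs (support_deriv_subset h))
      rw [this, zero_smul]
  have e2 : ∫ r in Ioi (0 : ℝ), r • angMean (fun x : ℂ =>
        ((fun r : ℝ => ((v r / r : ℝ) : ℂ)) ‖x‖) * radialPart n F₁ F₂ x) r
      = ∫ r : ℝ, v r • angMean (radialPart n F₁ F₂) r := by
    rw [← setIntegral_eq_integral_of_forall_compl_eq_zero (s := Ioi 0)
      (f := fun r : ℝ => v r • angMean (radialPart n F₁ F₂) r)]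
    · refine setIntegral_congr_fun measurableSet_Ioi fun r hr => ?_
      simp only
      rw [angMean_radial_mul (fun r : ℝ => ((v r / r : ℝ) : ℂ)) _ hr]
      have : (r : ℂ) ≠ 0 := by exact_mod_cast ne_of_gt hr
      simp only [Complex.real_smul, Complex.ofReal_div]
      field_simp
    · intro r hr
      have : v r = 0 := by
        by_contra h
        exact hr (hs (subset_tsupport _ h))
      rw [this, zero_smul]
  rw [e1, e2] at key
  have hpi : (2 * Real.pi) ≠ 0 := by positivity
  rw [← smul_neg] at key
  exact smul_right_injective ℂ hpi key

end Profile


/-! ### Pointwise and integral bounds for the profile. -/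

section ProfileBounds

variable {n : ℕ} {f F₁ F₂ : ℂ → ℂ}

theorem integrable_norm_mul {f H : ℂ → ℂ} (hf : MemLp f 2) (hH : MemLp H 2) :
    Integrable fun x => (‖f x‖ : ℂ) * H x := by
  refine (hf.norm.integrable_mul hH.norm).mono
    ((Complex.continuous_ofReal.comp_aestronglyMeasurable hf.1.norm).mul hH.1)
    (Eventually.of_forall fun x => ?_)
  simp

theorem integrableOn_real_of_complex {z : ℝ → ℂ} (hz : LocallyIntegrableOn z (Ioi 0))
    (L : ℂ →L[ℝ] ℝ) : LocallyIntegrableOn (fun r => L (z r)) (Ioi 0) := fun r hr => by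
  obtain ⟨s, hs, hi⟩ := hz r hr
  exact ⟨s, hs, L.integrable_comp hi⟩

/-- The half-line theory is real-valued, so the complex profile is studied one real coordinate at a
time, with `L` the real or the imaginary part. -/
theorem integral_coordinate_profile (hf : IsEquivariant n f) (h₁ : HasWeakDerivOn univ 1 f F₁)
    (h₂ : HasWeakDerivOn univ Complex.I f F₂) (L : ℂ →L[ℝ] ℝ)
    {v : ℝ → ℝ} (hv : ContDiff ℝ ∞ v) (hc : HasCompactSupport v) (hs : tsupport v ⊆ Ioi 0) :
    ∫ r : ℝ, deriv v r * L (f (r : ℂ)) = - ∫ r : ℝ, v r * L (angMean (radialPart n F₁ F₂) r) := by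
  have key := congrArg L (integral_deriv_mul_profile hf h₁ h₂ hv hc hs)
  have hts : tsupport (deriv v) ⊆ Ioi 0 :=
    (closure_minimal (support_deriv_subset) (isClosed_tsupport v)).trans hs
  have hW : LocallyIntegrable (radialPart n F₁ F₂) := by
    have h2 : LocallyIntegrable ((fun x => ‖F₁ x‖) + fun x => ‖F₂ x‖) :=
      LocallyIntegrable.add (fun x => (h₁.right x).imp fun s hs => ⟨hs.1, hs.2.norm⟩)
        (fun x => (h₂.right x).imp fun s hs => ⟨hs.1, hs.2.norm⟩)
    refine h2.mono ?_ (Eventually.of_forall fun x => ?_)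
    · have : Measurable fun x : ℂ => (conj x / ‖x‖) ^ n :=
        ((Complex.continuous_conj.measurable).div
          (Complex.measurable_ofReal.comp measurable_norm)).pow_const n
      exact this.aestronglyMeasurable.mul (aestronglyMeasurable_radialDeriv
        h₁.right.aestronglyMeasurable h₂.right.aestronglyMeasurable)
    · exact (norm_radialPart_le x).trans ((norm_radialDeriv_le x _ _).trans (le_abs_self _))
  have i : ∀ {z : ℝ → ℂ} {a : ℝ → ℝ}, LocallyIntegrableOn z (Ioi 0) → Continuous a →
      HasCompactSupport a → tsupport a ⊆ Ioi 0 → Integrable fun r => a r • z r := by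
    intro z a hz ha hac has
    have h1 := (hz.integrableOn_compact_subset has hac.isCompact).continuousOn_smul
      ha.continuousOn hac.isCompact
    rwa [integrableOn_iff_integrable_of_support_subset] at h1
    exact fun x hx => subset_tsupport _ fun h0 => hx (by simp [h0])
  rw [map_neg, ← L.integral_comp_comm (i (locallyIntegrableOn_profile hf h₁.left)
      (hv.continuous_deriv (by simp)) hc.deriv hts), ← L.integral_comp_comm
      (i (locallyIntegrableOn_angMean hW) hv.continuous hc hs)] at key
  simpa only [map_smul, smul_eq_mul] using key

/-- The coordinate agrees almost everywhere with a primitive `U` of `L ∘ W`. Square integrability of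
`f` controls `U² r`, and the product of the two square-integrable functions `|f|` and the radial
derivative controls `U L(W) r`, so the Sobolev and Hardy inequalities apply. The last clause records
that the constant is proportional to the gradient; it later shows that a vanishing Dirichlet
integral forces `f = 0`. -/
theorem profile_coordinate_bounds (hf : IsEquivariant n f) (hf2 : MemLp f 2)
    (h₁ : HasWeakDerivOn univ 1 f F₁)
    (h₂ : HasWeakDerivOn univ Complex.I f F₂) (hF₁ : MemLp F₁ 2) (hF₂ : MemLp F₂ 2)
    (L : ℂ →L[ℝ] ℝ) (hL : ∀ z, |L z| ≤ ‖z‖) :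
    ∃ C : ℝ, (∀ᵐ r, r ∈ Ioi (0 : ℝ) → r * L (f (r : ℂ)) ^ 2 ≤ C) ∧
      IntegrableOn (fun r : ℝ => L (f (r : ℂ)) ^ 2) (Ioi 0) ∧
      ((∀ x, F₁ x = 0) → (∀ x, F₂ x = 0) → C = 0) := by
  set W := angMean (radialPart n F₁ F₂) with hWdef
  have hH := memLp_radialPart (n := n) hF₁ hF₂
  have hlW : LocallyIntegrableOn W (Ioi 0) :=
    locallyIntegrableOn_angMean (hH.locallyIntegrable (by norm_num))
  have hlu := locallyIntegrableOn_profile hf h₁.left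
  obtain ⟨U, hU, hUe⟩ := exists_isPrimitive_of_weakDeriv (integrableOn_real_of_complex hlu L)
    (integrableOn_real_of_complex hlW L)
    (fun v hv hc hs => integral_coordinate_profile hf h₁ h₂ L hv hc hs)
  have hUe' : ∀ᵐ r : ℝ ∂volume.restrict (Ioi (0 : ℝ)), L (f (r : ℂ)) = U r :=
    (ae_restrict_iff' measurableSet_Ioi).2 hUe
  have hsq : IntegrableOn (fun r : ℝ => ‖f (r : ℂ)‖ ^ 2 * r) (Ioi 0) := by
    have : Integrable fun x : ℂ => (fun r : ℝ => ‖f (r : ℂ)‖ ^ 2) ‖x‖ := by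
      refine (hf2.integrable_norm_pow (by norm_num)).congr (Eventually.of_forall fun x => ?_)
      simp only
      rw [hf.norm_apply x]
    refine (integrable_radial_iff (F := fun r : ℝ => ‖f (r : ℂ)‖ ^ 2).1 this).congr (Eventually.of_forall fun r => ?_)
    simp [mul_comm]
  have hUsq : IntegrableOn (fun r => U r ^ 2 * r) (Ioi 0) := by
    refine hsq.mono' ?_ ?_
    · exact ((hU.continuousOn.pow 2).mul continuousOn_id).aestronglyMeasurable measurableSet_Ioi
    · filter_upwards [hUe', ae_restrict_mem measurableSet_Ioi] with r hr hr0
      have hr0' : (0 : ℝ) < r := hr0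
      rw [← hr, Real.norm_of_nonneg (by positivity)]
      refine mul_le_mul_of_nonneg_right ?_ hr0'.le
      rw [← sq_abs]
      exact pow_le_pow_left₀ (abs_nonneg _) (hL _) 2
  have hUW : IntegrableOn (fun r => U r * L (W r) * r) (Ioi 0) := by
    have h3 := integrableOn_angMean (integrable_norm_mul hf2 hH)
    refine h3.norm.mono' ?_ ?_
    · refine (hU.continuousOn.aestronglyMeasurable measurableSet_Ioi).mul
        (L.continuous.comp_aestronglyMeasurable hlW.aestronglyMeasurable) |>.mul ?_
      exact continuous_id.aestronglyMeasurable
    · filter_upwards [hUe', ae_restrict_mem measurableSet_Ioi] with r hr hr0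
      have hr0' : (0 : ℝ) < r := hr0
      have e : angMean (fun x => (‖f x‖ : ℂ) * radialPart n F₁ F₂ x) r
          = (‖f (r : ℂ)‖ : ℂ) * W r := by
        rw [← angMean_radial_mul (fun r : ℝ => (‖f (r : ℂ)‖ : ℂ)) _ hr0']
        simp only [← hf.norm_apply]
      rw [e, ← hr, norm_smul, norm_mul, norm_mul, norm_mul, Complex.norm_real, norm_norm,
        Real.norm_eq_abs, Real.norm_eq_abs, mul_comm ‖r‖]
      exact mul_le_mul_of_nonneg_right (mul_le_mul (hL _) (hL _) (abs_nonneg _) (norm_nonneg _))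
        (norm_nonneg _)
  refine ⟨2 * ∫ r in Ioi 0, |U r * L (W r)| * r, ?_, ?_, ?_⟩
  · filter_upwards [hUe] with r hr hr0
    rw [hr hr0]
    exact hU.mul_sq_le hUsq hUW hr0
  · refine (hU.integrableOn_sq hUsq hUW).congr ?_
    filter_upwards [hUe'] with r hr
    rw [hr]
  · intro z1 z2
    have : ∀ r, W r = 0 := fun r => by simp [hWdef, angMean, radialPart, radialDeriv, z1, z2]
    simp [this]

theorem profile_bounds (hf : IsEquivariant n f) (hf2 : MemLp f 2)
    (h₁ : HasWeakDerivOn univ 1 f F₁)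
    (h₂ : HasWeakDerivOn univ Complex.I f F₂) (hF₁ : MemLp F₁ 2) (hF₂ : MemLp F₂ 2) :
    ∃ C : ℝ, (∀ᵐ r, r ∈ Ioi (0 : ℝ) → ‖f (r : ℂ)‖ ^ 2 * r ≤ C) ∧
      IntegrableOn (fun r : ℝ => ‖f (r : ℂ)‖ ^ 2) (Ioi 0) ∧
      ((∀ x, F₁ x = 0) → (∀ x, F₂ x = 0) → C = 0) := by
  obtain ⟨C, hC, hi, hz⟩ := profile_coordinate_bounds hf hf2 h₁ h₂ hF₁ hF₂ Complex.reCLM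
    Complex.abs_re_le_norm
  obtain ⟨D, hD, hj, hw⟩ := profile_coordinate_bounds hf hf2 h₁ h₂ hF₁ hF₂ Complex.imCLM
    Complex.abs_im_le_norm
  have e : ∀ z : ℂ, ‖z‖ ^ 2 = Complex.reCLM z ^ 2 + Complex.imCLM z ^ 2 := fun z => by
    rw [Complex.sq_norm, Complex.normSq_apply]; simp [sq]
  refine ⟨C + D, ?_, ?_, fun z1 z2 => by rw [hz z1 z2, hw z1 z2, add_zero]⟩
  · filter_upwards [hC, hD] with r h1 h2 hr
    rw [e, add_mul]
    linarith [h1 hr, h2 hr]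
  · exact (hi.add hj).congr (Eventually.of_forall fun r => (e _).symm)

end ProfileBounds

/-! ### Radial densities and the nonlinear part of the energy. -/

section Density

/-- The class of radial densities on which the nonlinear part of the energy is finite. -/
structure IsRadialDensity (m : ℤ) (q : ℝ → ℝ) : Prop where
  bound : ∃ C : ℝ, ∀ᵐ r ∂volume.restrict (Ioi (0 : ℝ)), |q r| * r ≤ C
  int : IntegrableOn q (Ioi 0)
  int_mul : IntegrableOn (fun r => q r * r) (Ioi 0)
  int_div : IntegrableOn (fun r => m * (q r / r)) (Ioi 0)

variable {m : ℤ} {q p : ℝ → ℝ}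

theorem IsRadialDensity.add (hq : IsRadialDensity m q) (hp : IsRadialDensity m p) :
    IsRadialDensity m fun r => q r + p r where
  bound := by
    obtain ⟨C, hC⟩ := hq.bound
    obtain ⟨D, hD⟩ := hp.bound
    refine ⟨C + D, ?_⟩
    filter_upwards [hC, hD, ae_restrict_mem measurableSet_Ioi] with r h1 h2 hr
    have hr' : (0 : ℝ) < r := hr
    nlinarith [abs_add_le (q r) (p r)]
  int := hq.int.add hp.int
  int_mul := (hq.int_mul.add hp.int_mul).congr (Eventually.of_forall fun r => by
    simp only [Pi.add_apply]; ring)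
  int_div := (hq.int_div.add hp.int_div).congr (Eventually.of_forall fun r => by
    simp only [Pi.add_apply]; ring)

theorem IsRadialDensity.const_mul (hq : IsRadialDensity m q) (c : ℝ) :
    IsRadialDensity m fun r => c * q r where
  bound := by
    obtain ⟨C, hC⟩ := hq.bound
    refine ⟨|c| * C, ?_⟩
    filter_upwards [hC] with r h1
    rw [abs_mul, mul_assoc]
    exact mul_le_mul_of_nonneg_left h1 (abs_nonneg _)
  int := hq.int.const_mul c
  int_mul := (hq.int_mul.const_mul c).congr (Eventually.of_forall fun r => by
    simp only; ring)
  int_div := (hq.int_div.const_mul c).congr (Eventually.of_forall fun r => by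
    simp only; ring)

theorem IsRadialDensity.mono (hq : IsRadialDensity m q)
    (hm : AEStronglyMeasurable p (volume.restrict (Ioi 0))) (h : ∀ r, |p r| ≤ q r) :
    IsRadialDensity m p where
  bound := by
    obtain ⟨C, hC⟩ := hq.bound
    refine ⟨C, ?_⟩
    filter_upwards [hC, ae_restrict_mem measurableSet_Ioi] with r h1 hr
    exact (mul_le_mul_of_nonneg_right ((h r).trans (le_abs_self _)) (le_of_lt hr)).trans h1
  int := hq.int.mono' hm (Eventually.of_forall h)
  int_mul := by
    refine hq.int_mul.mono' (hm.mul continuous_id.aestronglyMeasurable) ?_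
    filter_upwards [ae_restrict_mem measurableSet_Ioi] with r hr
    have hr' : (0 : ℝ) < r := hr
    rw [norm_mul, Real.norm_of_nonneg hr'.le]
    exact mul_le_mul_of_nonneg_right (h r) hr'.le
  int_div := by
    refine hq.int_div.norm.mono' (aestronglyMeasurable_const.mul
      (hm.mul measurable_inv.aestronglyMeasurable)) ?_
    filter_upwards [ae_restrict_mem measurableSet_Ioi] with r hr
    have hr' : (0 : ℝ) < r := hr
    rw [norm_mul, norm_mul, norm_div, norm_div]
    gcongr
    exact (h r).trans (le_abs_self _)

/-- The potential `A_θ` of a radial density. -/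
noncomputable def pot (q : ℝ → ℝ) (r : ℝ) : ℝ := -(1 / 2) * ∫ s in (0 : ℝ)..r, q s * s

theorem IsRadialDensity.intervalIntegrable (hq : IsRadialDensity m q) {a b : ℝ} (ha : 0 ≤ a)
    (hb : 0 ≤ b) : IntervalIntegrable (fun s => q s * s) volume a b := by
  rw [intervalIntegrable_iff]
  exact hq.int_mul.mono_set fun x hx => (le_min ha hb).trans_lt hx.1

theorem pot_add (hq : IsRadialDensity m q) (hp : IsRadialDensity m p) {r : ℝ} (hr : 0 < r) :
    pot (fun r => q r + p r) r = pot q r + pot p r := by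
  simp only [pot, add_mul]
  rw [intervalIntegral.integral_add (hq.intervalIntegrable le_rfl hr.le)
    (hp.intervalIntegrable le_rfl hr.le)]
  ring

theorem pot_const_mul (c r : ℝ) : pot (fun r => c * q r) r = c * pot q r := by
  simp only [pot, mul_assoc]
  rw [intervalIntegral.integral_const_mul]; ring

theorem IsRadialDensity.isPrimitive_pot (hq : IsRadialDensity m q) :
    IsPrimitive (pot q) (fun r => -(1 / 2) * (q r * r)) where
  locInt := IntegrableOn.locallyIntegrableOn (hq.int_mul.const_mul _)
  sub_eq a ha b hab := by
    rw [intervalIntegral.integral_const_mul, ← intervalIntegral.integral_interval_sub_left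
      (hq.intervalIntegrable le_rfl (ha.le.trans hab)) (hq.intervalIntegrable le_rfl ha.le)]
    simp only [pot]; ring

theorem IsRadialDensity.aestronglyMeasurable_pot (hq : IsRadialDensity m q) :
    AEStronglyMeasurable (pot q) (volume.restrict (Ioi 0)) :=
  hq.isPrimitive_pot.continuousOn.aestronglyMeasurable measurableSet_Ioi

/-- Since `q(s) s` is bounded, its integral over `(0, r)` is `O(r)`. Thus `pot q r / r` is a bounded
multiplier, which makes the quartic and sextic integrals converge. -/
theorem IsRadialDensity.abs_pot_le (hq : IsRadialDensity m q) :
    ∃ C : ℝ, ∀ r, 0 < r → |pot q r / r| ≤ C := by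
  obtain ⟨C, hC⟩ := hq.bound
  rw [ae_restrict_iff' measurableSet_Ioi] at hC
  refine ⟨1 / 2 * C, fun r hr => ?_⟩
  have h1 : ‖∫ s in (0 : ℝ)..r, q s * s‖ ≤ C * |r - 0| := by
    refine intervalIntegral.norm_integral_le_of_norm_le_const_ae ?_
    filter_upwards [hC] with s hs hsm
    rw [uIoc_of_le hr.le] at hsm
    rw [norm_mul, Real.norm_of_nonneg hsm.1.le]
    exact hs hsm.1
  rw [sub_zero, abs_of_pos hr] at h1
  rw [abs_div, abs_of_pos hr, div_le_iff₀ hr, pot, abs_mul, abs_neg, abs_of_pos (by norm_num)]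
  rw [Real.norm_eq_abs] at h1
  linarith

theorem IsRadialDensity.aestronglyMeasurable_pot_div (hq : IsRadialDensity m q) :
    AEStronglyMeasurable (fun r => pot q r / r) (volume.restrict (Ioi 0)) :=
  hq.aestronglyMeasurable_pot.mul measurable_inv.aestronglyMeasurable

theorem integrableOn_bdd_mul {b k : ℝ → ℝ} (hk : IntegrableOn k (Ioi 0))
    (hb : AEStronglyMeasurable b (volume.restrict (Ioi 0))) {C : ℝ}
    (hC : ∀ᵐ r ∂volume.restrict (Ioi (0 : ℝ)), |b r| ≤ C) :
    IntegrableOn (fun r => b r * k r) (Ioi 0) :=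
  Integrable.bdd_mul hk hb hC

theorem IsRadialDensity.integrableOn_pot_div_mul (hq : IsRadialDensity m q) {k : ℝ → ℝ}
    (hk : IntegrableOn k (Ioi 0)) : IntegrableOn (fun r => pot q r / r * k r) (Ioi 0) := by
  obtain ⟨C, hC⟩ := hq.abs_pot_le
  refine integrableOn_bdd_mul hk hq.aestronglyMeasurable_pot_div (C := C) ?_
  filter_upwards [ae_restrict_mem measurableSet_Ioi] with r hr using hC r hr

theorem IsRadialDensity.integrableOn_mul_mul (hq : IsRadialDensity m q) {k : ℝ → ℝ}
    (hk : IntegrableOn k (Ioi 0)) : IntegrableOn (fun r => q r * r * k r) (Ioi 0) := by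
  obtain ⟨C, hC⟩ := hq.bound
  refine integrableOn_bdd_mul hk (hq.int.1.mul continuous_id.aestronglyMeasurable) (C := C) ?_
  filter_upwards [hC, ae_restrict_mem measurableSet_Ioi] with r hr hr0
  rwa [abs_mul, abs_of_pos (show (0 : ℝ) < r from hr0)]

/-- The quartic part of the energy, polarized. -/
noncomputable def quartic (m : ℤ) (g : ℝ) (p q : ℝ → ℝ) : ℝ :=
  ∫ r in Ioi 0, (2 * m * (pot p r / r * q r) - g / 2 * (p r * r * q r))

/-- The sextic part of the energy, polarized. -/
noncomputable def sextic (p p' q : ℝ → ℝ) : ℝ :=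
  ∫ r in Ioi 0, pot p r / r * (pot p' r / r * (q r * r))

variable {g : ℝ}

theorem integrableOn_quartic (hp : IsRadialDensity m p) (hq : IsRadialDensity m q) :
    IntegrableOn (fun r => 2 * m * (pot p r / r * q r) - g / 2 * (p r * r * q r)) (Ioi 0) :=
  ((hp.integrableOn_pot_div_mul hq.int).const_mul _).sub
    ((hp.integrableOn_mul_mul hq.int).const_mul _)

theorem integrableOn_sextic {p' : ℝ → ℝ} (hp : IsRadialDensity m p) (hp' : IsRadialDensity m p')
    (hq : IsRadialDensity m q) :
    IntegrableOn (fun r => pot p r / r * (pot p' r / r * (q r * r))) (Ioi 0) :=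
  hp.integrableOn_pot_div_mul (hp'.integrableOn_pot_div_mul hq.int_mul)

/-- The quadratic path of densities through `q₀`. -/
def densityPath (q₀ q₁ q₂ : ℝ → ℝ) (s : ℝ) (r : ℝ) : ℝ := q₀ r + (s * q₁ r + s ^ 2 * q₂ r)

variable {q₀ q₁ q₂ : ℝ → ℝ}

theorem isRadialDensity_densityPath (h₀ : IsRadialDensity m q₀) (h₁ : IsRadialDensity m q₁)
    (h₂ : IsRadialDensity m q₂) (s : ℝ) : IsRadialDensity m (densityPath q₀ q₁ q₂ s) :=
  h₀.add ((h₁.const_mul s).add (h₂.const_mul (s ^ 2)))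

theorem pot_densityPath (h₀ : IsRadialDensity m q₀) (h₁ : IsRadialDensity m q₁)
    (h₂ : IsRadialDensity m q₂) (s : ℝ) {r : ℝ} (hr : 0 < r) :
    pot (densityPath q₀ q₁ q₂ s) r = pot q₀ r + (s * pot q₁ r + s ^ 2 * pot q₂ r) := by
  unfold densityPath
  rw [pot_add h₀ ((h₁.const_mul s).add (h₂.const_mul (s ^ 2))) hr,
    pot_add (h₁.const_mul s) (h₂.const_mul (s ^ 2)) hr, pot_const_mul, pot_const_mul]

theorem setIntegral_path {a b c d : ℝ → ℝ} (s : ℝ) (hb : IntegrableOn b (Ioi 0))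
    (hc : IntegrableOn c (Ioi 0)) (hd : IntegrableOn d (Ioi 0))
    (h : ∀ r, 0 < r → a r = b r + (s * c r + s ^ 2 * d r)) :
    ∫ r in Ioi (0 : ℝ), a r = (∫ r in Ioi (0 : ℝ), b r) + (s * (∫ r in Ioi (0 : ℝ), c r)
      + s ^ 2 * ∫ r in Ioi (0 : ℝ), d r) := by
  have e : IntegrableOn (fun r => s * c r + s ^ 2 * d r) (Ioi 0) :=
    (hc.const_mul s).add (hd.const_mul _)
  rw [setIntegral_congr_fun measurableSet_Ioi fun r hr => h r hr, integral_add hb e,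
    integral_add (hc.const_mul s) (hd.const_mul _), integral_const_mul, integral_const_mul]

theorem quartic_path_left (h₀ : IsRadialDensity m q₀) (h₁ : IsRadialDensity m q₁)
    (h₂ : IsRadialDensity m q₂)
    (hq : IsRadialDensity m q) (s : ℝ) :
    quartic m g (densityPath q₀ q₁ q₂ s) q
      = quartic m g q₀ q + (s * quartic m g q₁ q + s ^ 2 * quartic m g q₂ q) :=
  setIntegral_path s (integrableOn_quartic h₀ hq) (integrableOn_quartic h₁ hq)
    (integrableOn_quartic h₂ hq) fun r hr => by
      rw [pot_densityPath h₀ h₁ h₂ s hr]; simp only [densityPath]; ring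

theorem quartic_path_right (h₀ : IsRadialDensity m q₀) (h₁ : IsRadialDensity m q₁)
    (h₂ : IsRadialDensity m q₂)
    (hq : IsRadialDensity m q) (s : ℝ) :
    quartic m g q (densityPath q₀ q₁ q₂ s)
      = quartic m g q q₀ + (s * quartic m g q q₁ + s ^ 2 * quartic m g q q₂) :=
  setIntegral_path s (integrableOn_quartic hq h₀) (integrableOn_quartic hq h₁)
    (integrableOn_quartic hq h₂) fun r hr => by
      simp only [densityPath]; ring

theorem sextic_path_left (h₀ : IsRadialDensity m q₀) (h₁ : IsRadialDensity m q₁)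
    (h₂ : IsRadialDensity m q₂)
    (hp : IsRadialDensity m p) (hq : IsRadialDensity m q) (s : ℝ) :
    sextic (densityPath q₀ q₁ q₂ s) p q
      = sextic q₀ p q + (s * sextic q₁ p q + s ^ 2 * sextic q₂ p q) :=
  setIntegral_path s (integrableOn_sextic h₀ hp hq) (integrableOn_sextic h₁ hp hq)
    (integrableOn_sextic h₂ hp hq) fun r hr => by
      rw [pot_densityPath h₀ h₁ h₂ s hr]; ring

theorem sextic_path_mid (h₀ : IsRadialDensity m q₀) (h₁ : IsRadialDensity m q₁)
    (h₂ : IsRadialDensity m q₂)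
    (hp : IsRadialDensity m p) (hq : IsRadialDensity m q) (s : ℝ) :
    sextic p (densityPath q₀ q₁ q₂ s) q
      = sextic p q₀ q + (s * sextic p q₁ q + s ^ 2 * sextic p q₂ q) :=
  setIntegral_path s (integrableOn_sextic hp h₀ hq) (integrableOn_sextic hp h₁ hq)
    (integrableOn_sextic hp h₂ hq) fun r hr => by
      rw [pot_densityPath h₀ h₁ h₂ s hr]; ring

theorem sextic_path_right (h₀ : IsRadialDensity m q₀) (h₁ : IsRadialDensity m q₁)
    (h₂ : IsRadialDensity m q₂)
    (hp : IsRadialDensity m p) (hq : IsRadialDensity m q) (s : ℝ) :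
    sextic p q (densityPath q₀ q₁ q₂ s)
      = sextic p q q₀ + (s * sextic p q q₁ + s ^ 2 * sextic p q q₂) :=
  setIntegral_path s (integrableOn_sextic hp hq h₀) (integrableOn_sextic hp hq h₁)
    (integrableOn_sextic hp hq h₂) fun r hr => by
      simp only [densityPath]; ring

/-- The coefficients may depend on `s` themselves, so a multilinear form can be differentiated along
a quadratic path by opening one slot at a time. -/
theorem hasDerivAt_path_zero {A B C : ℝ → ℝ} {A' B' C' : ℝ} (hA : HasDerivAt A A' 0)
    (hB : HasDerivAt B B' 0) (hC : HasDerivAt C C' 0) :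
    HasDerivAt (fun s => A s + (s * B s + s ^ 2 * C s)) (A' + B 0) 0 := by
  have := hA.add (((hasDerivAt_id (0 : ℝ)).mul hB).add ((hasDerivAt_pow 2 (0 : ℝ)).mul hC))
  convert! this using 1
  simp

theorem hasDerivAt_path_const (a b c : ℝ) :
    HasDerivAt (fun s : ℝ => a + (s * b + s ^ 2 * c)) b 0 := by
  simpa using hasDerivAt_path_zero (hasDerivAt_const (0 : ℝ) a) (hasDerivAt_const (0 : ℝ) b)
    (hasDerivAt_const (0 : ℝ) c)

theorem densityPath_zero : densityPath q₀ q₁ q₂ 0 = q₀ := by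
  ext r; simp [densityPath]

/-- By multilinearity the form is a polynomial in `s`, so its derivative is algebraic and no
differentiation under the integral sign is needed. -/
theorem hasDerivAt_quartic_path (h₀ : IsRadialDensity m q₀) (h₁ : IsRadialDensity m q₁)
    (h₂ : IsRadialDensity m q₂) :
    HasDerivAt (fun s => quartic m g (densityPath q₀ q₁ q₂ s) (densityPath q₀ q₁ q₂ s))
      (quartic m g q₀ q₁ + quartic m g q₁ q₀) 0 := by
  have hd : ∀ {p : ℝ → ℝ}, IsRadialDensity m p →
      HasDerivAt (fun s => quartic m g p (densityPath q₀ q₁ q₂ s)) (quartic m g p q₁) 0 :=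
    fun {p} hp => by
      simp_rw [quartic_path_right h₀ h₁ h₂ hp]
      exact hasDerivAt_path_const _ _ _
  have := hasDerivAt_path_zero (hd h₀) (hd h₁) (hd h₂)
  rw [densityPath_zero] at this
  convert! this using 1
  ext s
  exact quartic_path_left h₀ h₁ h₂ (isRadialDensity_densityPath h₀ h₁ h₂ s) s

theorem hasDerivAt_sextic_path (h₀ : IsRadialDensity m q₀) (h₁ : IsRadialDensity m q₁)
    (h₂ : IsRadialDensity m q₂) :
    HasDerivAt (fun s => sextic (densityPath q₀ q₁ q₂ s) (densityPath q₀ q₁ q₂ s)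
        (densityPath q₀ q₁ q₂ s))
      (sextic q₀ q₀ q₁ + sextic q₀ q₁ q₀ + sextic q₁ q₀ q₀) 0 := by
  have hd : ∀ {p p' : ℝ → ℝ}, IsRadialDensity m p → IsRadialDensity m p' →
      HasDerivAt (fun s => sextic p p' (densityPath q₀ q₁ q₂ s)) (sextic p p' q₁) 0 :=
    fun {p p'} hp hp' => by
      simp_rw [sextic_path_right h₀ h₁ h₂ hp hp']
      exact hasDerivAt_path_const _ _ _
  have hd2 : ∀ {p : ℝ → ℝ}, IsRadialDensity m p →
      HasDerivAt (fun s => sextic p (densityPath q₀ q₁ q₂ s) (densityPath q₀ q₁ q₂ s))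
        (sextic p q₀ q₁ + sextic p q₁ q₀) 0 := fun {p} hp => by
    have := hasDerivAt_path_zero (hd hp h₀) (hd hp h₁) (hd hp h₂)
    rw [densityPath_zero] at this
    convert! this using 1
    ext s
    exact sextic_path_mid h₀ h₁ h₂ hp (isRadialDensity_densityPath h₀ h₁ h₂ s) s
  have := hasDerivAt_path_zero (hd2 h₀) (hd2 h₁) (hd2 h₂)
  rw [densityPath_zero] at this
  convert! this using 1
  ext s
  have hs := isRadialDensity_densityPath h₀ h₁ h₂ s
  exact sextic_path_left h₀ h₁ h₂ hs hs s

/-- With `sextic_const_mul`, these homogeneities drive the scaling argument, the Dirichlet integral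
having degree one in the same scale `‖c‖²`. -/
theorem quartic_const_mul (c : ℝ) : quartic m g (fun r => c * q r) (fun r => c * q r)
    = c ^ 2 * quartic m g q q := by
  simp only [quartic, pot_const_mul]
  rw [← integral_const_mul]
  congr 1; ext r; ring

theorem sextic_const_mul (c : ℝ) : sextic (fun r => c * q r) (fun r => c * q r) (fun r => c * q r)
    = c ^ 3 * sextic q q q := by
  simp only [sextic, pot_const_mul]
  rw [← integral_const_mul]
  congr 1; ext r; ring

end Density


theorem integrable_fun_add {X V : Type*} [MeasurableSpace X] [NormedAddCommGroup V]
    {μ : Measure X} {a b : X → V} (ha : Integrable a μ) (hb : Integrable b μ) :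
    Integrable (fun x => a x + b x) μ := ha.add hb

theorem integrable_fun_sub {X V : Type*} [MeasurableSpace X] [NormedAddCommGroup V]
    {μ : Measure X} {a b : X → V} (ha : Integrable a μ) (hb : Integrable b μ) :
    Integrable (fun x => a x - b x) μ := ha.sub hb

/-! ### First variation of the nonlinear energy. -/

section FirstVariation

variable {m : ℤ} {g : ℝ} {q q₀ q₁ q₂ : ℝ → ℝ}

/-- The potential `A₀` of a radial density. -/
noncomputable def potZ (m : ℤ) (q : ℝ → ℝ) (r : ℝ) : ℝ :=
  - ∫ s in Ioi r, (m + pot q s) / s * q s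

/-- The effective potential in the nonlinearity. -/
noncomputable def effPot (m : ℤ) (g : ℝ) (q : ℝ → ℝ) (r : ℝ) : ℝ :=
  2 * m / r ^ 2 * pot q r + potZ m q r + 1 / r ^ 2 * pot q r ^ 2 - g * q r

theorem IsRadialDensity.integrableOn_potZ (hq : IsRadialDensity m q) :
    IntegrableOn (fun s => (m + pot q s) / s * q s) (Ioi 0) :=
  (hq.int_div.add (hq.integrableOn_pot_div_mul hq.int)).congr (Eventually.of_forall fun r => by
    simp only [Pi.add_apply]; ring)

theorem IsRadialDensity.isPrimitive_potZ (hq : IsRadialDensity m q) :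
    IsPrimitive (potZ m q) (fun s => (m + pot q s) / s * q s) where
  locInt := hq.integrableOn_potZ.locallyIntegrableOn
  sub_eq a ha b hab := by
    have h : ∀ {c : ℝ}, 0 < c → IntegrableOn (fun s => (m + pot q s) / s * q s) (Ioi c) :=
      fun hc => hq.integrableOn_potZ.mono_set fun x hx => hc.trans hx
    rw [← intervalIntegral.integral_Ioi_sub_Ioi (h ha) hab]
    simp only [potZ]; ring

theorem IsRadialDensity.abs_potZ_le (hq : IsRadialDensity m q) {r : ℝ} (hr : 0 ≤ r) :
    |potZ m q r| ≤ ∫ s in Ioi 0, ‖(m + pot q s) / s * q s‖ := by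
  rw [potZ, abs_neg]
  refine (norm_integral_le_integral_norm (μ := volume.restrict (Ioi r))
    fun s => (m + pot q s) / s * q s).trans ?_
  exact setIntegral_mono_set hq.integrableOn_potZ.norm (Eventually.of_forall fun _ => norm_nonneg _)
    (LE.le.eventuallyLE fun x hx => hr.trans_lt hx)

theorem IsRadialDensity.aestronglyMeasurable_potZ (hq : IsRadialDensity m q) :
    AEStronglyMeasurable (potZ m q) (volume.restrict (Ioi 0)) :=
  hq.isPrimitive_potZ.continuousOn.aestronglyMeasurable measurableSet_Ioi

theorem IsRadialDensity.integrableOn_potZ_mul (hq : IsRadialDensity m q) {k : ℝ → ℝ}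
    (hk : IntegrableOn k (Ioi 0)) : IntegrableOn (fun r => potZ m q r * k r) (Ioi 0) := by
  refine integrableOn_bdd_mul hk hq.aestronglyMeasurable_potZ
    (C := ∫ s in Ioi 0, ‖(m + pot q s) / s * q s‖) ?_
  filter_upwards [ae_restrict_mem measurableSet_Ioi] with r hr using hq.abs_potZ_le (le_of_lt hr)

/-- Exchanging the order of integration moves the inner potential onto the other factor. -/
theorem integral_primitive_mul {k j : ℝ → ℝ} (hk : IntegrableOn k (Ioi 0))
    (hj : IntegrableOn j (Ioi 0)) :
    ∫ r in Ioi (0 : ℝ), (∫ s in (0 : ℝ)..r, j s) * k r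
      = ∫ s in Ioi (0 : ℝ), (∫ r in Ioi s, k r) * j s := by
  set F : ℝ → ℝ → ℝ := fun r s => {p : ℝ × ℝ | p.2 < p.1}.indicator (fun p => k p.1 * j p.2) (r, s)
    with hF
  have hms : MeasurableSet {p : ℝ × ℝ | p.2 < p.1} := measurableSet_lt measurable_snd measurable_fst
  have hint : Integrable (Function.uncurry F)
      ((volume.restrict (Ioi 0)).prod (volume.restrict (Ioi 0))) :=
    (hk.mul_prod hj).indicator hms
  have key := integral_integral_swap hint
  convert key using 1
  · refine setIntegral_congr_fun measurableSet_Ioi fun r hr => ?_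
    have hr0 : (0 : ℝ) < r := hr
    have e : ∀ s, F r s = (Iio r).indicator (fun s => k r * j s) s := fun s => by
      simp only [hF, indicator, mem_ofPred_eq, mem_Iio]
    simp only [e]
    rw [integral_indicator measurableSet_Iio, Measure.restrict_restrict measurableSet_Iio,
      show Iio r ∩ Ioi 0 = Ioo 0 r by ext; simp [and_comm], ← integral_Ioc_eq_integral_Ioo,
      integral_const_mul, intervalIntegral.integral_of_le hr0.le, mul_comm]
  · refine setIntegral_congr_fun measurableSet_Ioi fun s hs => ?_
    have hs0 : (0 : ℝ) < s := hs
    have e : ∀ r, F r s = (Ioi s).indicator (fun r => k r * j s) r := fun r => by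
      simp only [hF, indicator, mem_ofPred_eq, mem_Ioi]
    simp only [e]
    rw [integral_indicator measurableSet_Ioi, Measure.restrict_restrict measurableSet_Ioi,
      show Ioi s ∩ Ioi 0 = Ioi s from inter_eq_left.2 fun x hx => hs0.trans hx,
      integral_mul_const]

/-- Splits the product into pieces whose integrability is already known: the quartic integrand, its
potential part alone, the sextic integrand and the term with the bounded potential `potZ`. -/
theorem effPot_mul_eq {r : ℝ} (hr : 0 < r) (z : ℝ) : effPot m g q r * (z * r)
    = (2 * (2 * m * (pot q r / r * z) - g / 2 * (q r * r * z)) - 2 * m * (pot q r / r * z))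
      + (pot q r / r * (pot q r / r * (z * r)) + potZ m q r * (z * r)) := by
  simp only [effPot]
  field_simp
  ring

theorem integrableOn_effPot_mul (h₀ : IsRadialDensity m q₀) (h₁ : IsRadialDensity m q₁) :
    IntegrableOn (fun r => effPot m g q₀ r * (q₁ r * r)) (Ioi 0) := by
  refine (integrableOn_congr_fun (fun r hr => (effPot_mul_eq hr (q₁ r)).symm)
    measurableSet_Ioi).1 ?_
  exact (((integrableOn_quartic h₀ h₁).const_mul 2).sub
    ((h₀.integrableOn_pot_div_mul h₁.int).const_mul _)).add
    ((integrableOn_sextic h₀ h₀ h₁).add (h₀.integrableOn_potZ_mul h₁.int_mul))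

/-- The first variation of the nonlinear energy. -/
theorem first_variation (h₀ : IsRadialDensity m q₀) (h₁ : IsRadialDensity m q₁) :
    (quartic m g q₀ q₁ + quartic m g q₁ q₀) + (sextic q₀ q₀ q₁ + sextic q₀ q₁ q₀ + sextic q₁ q₀ q₀)
      = ∫ r in Ioi 0, effPot m g q₀ r * (q₁ r * r) := by
  have hk := h₀.integrableOn_potZ
  have hswap := integral_primitive_mul hk h₁.int_mul
  -- The variation of `A_θ` is nonlocal in `q₁`. Exchanging the order of integration makes `q₁`
  -- local and produces `A₀` as its coefficient.
  have e1 : ∫ r in Ioi (0 : ℝ), 2 * pot q₁ r * ((m + pot q₀ r) / r * q₀ r)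
      = ∫ r in Ioi 0, potZ m q₀ r * (q₁ r * r) := by
    simp only [potZ, neg_mul, integral_neg]
    rw [← hswap, ← integral_neg]
    congr 1; ext r
    simp only [pot]; ring
  have i1 := integrableOn_quartic (g := g) h₀ h₁
  have i2 := integrableOn_quartic (g := g) h₁ h₀
  have i3 := integrableOn_sextic h₀ h₀ h₁
  have i4 := integrableOn_sextic h₀ h₁ h₀
  have i5 := integrableOn_sextic h₁ h₀ h₀
  have i6 := h₀.integrableOn_potZ_mul h₁.int_mul
  have i7 := (h₀.integrableOn_pot_div_mul h₁.int).const_mul (2 * (m : ℝ))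
  have i8 := (h₀.integrableOn_mul_mul h₁.int).const_mul g
  have i9 : IntegrableOn (fun r => 2 * pot q₁ r * ((m + pot q₀ r) / r * q₀ r)) (Ioi 0) := by
    refine (((h₁.integrableOn_pot_div_mul h₀.int).const_mul (2 * (m : ℝ))).add
      ((integrableOn_sextic h₁ h₀ h₀).const_mul 2)).congr ?_
    filter_upwards [ae_restrict_mem measurableSet_Ioi] with r hr
    have hr0 : r ≠ 0 := ne_of_gt hr
    simp only [Pi.add_apply]; field_simp
  have hL : (quartic m g q₀ q₁ + quartic m g q₁ q₀)
      + (sextic q₀ q₀ q₁ + sextic q₀ q₁ q₀ + sextic q₁ q₀ q₀)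
      = ∫ r in Ioi (0 : ℝ), ((2 * m * (pot q₀ r / r * q₁ r) - g * (q₀ r * r * q₁ r))
        + pot q₀ r / r * (pot q₀ r / r * (q₁ r * r))
        + 2 * pot q₁ r * ((m + pot q₀ r) / r * q₀ r)) := by
    simp only [quartic, sextic]
    rw [← integral_add i1 i2, ← integral_add i3 i4, ← integral_add (integrable_fun_add i3 i4) i5,
      ← integral_add (integrable_fun_add i1 i2)
        (integrable_fun_add (integrable_fun_add i3 i4) i5)]
    refine setIntegral_congr_fun measurableSet_Ioi fun r hr => ?_
    have hr0 : r ≠ 0 := ne_of_gt hr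
    field_simp; ring
  have i10 := integrable_fun_add (integrable_fun_sub i7 i8) i3
  rw [hL, integral_add i10 i9, e1, ← integral_add i10 i6]
  refine setIntegral_congr_fun measurableSet_Ioi fun r hr => ?_
  have hr0 : r ≠ 0 := ne_of_gt hr
  simp only [effPot]; field_simp; ring

end FirstVariation

/-! ### Decomposition of the energy. -/

section Energy

variable {n : ℕ} {g : ℝ} {f h F₁ F₂ : ℂ → ℂ}

/-- The radial density `|f|²`. -/
noncomputable def dens (f : ℂ → ℂ) (r : ℝ) : ℝ := ‖f (r : ℂ)‖ ^ 2

/-- The unit vectors in the directions `x` and `i x` form an orthonormal frame. -/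
theorem norm_sq_radial_add_angular {x : ℂ} (hx : x ≠ 0) (a b : ℂ) :
    ‖radialDeriv x a b‖ ^ 2 + 1 / ‖x‖ ^ 2 * ‖(x.re : ℂ) * b - x.im * a‖ ^ 2
      = ‖a‖ ^ 2 + ‖b‖ ^ 2 := by
  have hx' : ‖x‖ ^ 2 ≠ 0 := pow_ne_zero 2 (norm_ne_zero_iff.2 hx)
  unfold radialDeriv
  rw [norm_div, Complex.norm_real, norm_norm, div_pow, div_add' _ _ _ hx', div_eq_iff hx',
    one_div, mul_assoc, mul_comm (‖_ - _‖ ^ 2), inv_mul_cancel_left₀ hx']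
  simp only [Complex.sq_norm, Complex.normSq_apply, Complex.add_re, Complex.add_im, Complex.sub_re,
    Complex.sub_im, Complex.re_ofReal_mul, Complex.im_ofReal_mul]
  ring

theorem MemH1m.equiv (hf : MemH1m n f) : IsEquivariant n f := hf.1

theorem MemH1m.angular_eq (hf : MemH1m n f) : ∀ᵐ x : ℂ,
    (x.re : ℂ) * weakDeriv Complex.I f x - x.im * weakDeriv 1 f x = Complex.I * n * f x := by
  simpa using angular_deriv_ae_eq hf.equiv hf.2.hasWeakDerivOn_one hf.2.hasWeakDerivOn_I

theorem integrable_norm_sq {f : ℂ → ℂ} (hf : MemLp f 2) : Integrable fun x => ‖f x‖ ^ 2 := by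
  simpa using hf.integrable_norm_pow (by norm_num)

/-- The first three conditions come from the profile bounds and from `f ∈ L²`. For the last, the
angular part of the gradient has size `n |f| / r`, so `n² |f|² / r²` is dominated by `|∇f|²`, and `n
≤ n²` for natural `n`. -/
theorem MemH1m.isRadialDensity (hf : MemH1m n f) : IsRadialDensity n (dens f) := by
  obtain ⟨C, hC, hi, -⟩ := profile_bounds hf.equiv hf.2.1 hf.2.hasWeakDerivOn_one
    hf.2.hasWeakDerivOn_I hf.2.memLp_one hf.2.memLp_I
  refine ⟨⟨C, ?_⟩, hi, ?_, ?_⟩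
  · rw [ae_restrict_iff' measurableSet_Ioi]
    filter_upwards [hC] with r hr hr0
    rw [dens, abs_of_nonneg (sq_nonneg _)]
    exact hr hr0
  · have : Integrable fun x : ℂ => dens f ‖x‖ := by
      refine (integrable_norm_sq hf.2.1).congr (Eventually.of_forall fun x => ?_)
      simp only [dens]; rw [hf.equiv.norm_apply x]
    refine (integrable_radial_iff.1 this).congr (Eventually.of_forall fun r => ?_)
    simp [mul_comm]
  · have : Integrable fun x : ℂ => (fun r : ℝ => (n : ℝ) * (dens f r / r ^ 2)) ‖x‖ := by
      refine ((integrable_norm_sq hf.2.memLp_one).add (integrable_norm_sq hf.2.memLp_I)).mono' ?_ ?_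
      · have : AEStronglyMeasurable fun x : ℂ => (n : ℝ) * (‖f x‖ ^ 2 * (‖x‖ ^ 2)⁻¹) :=
          aestronglyMeasurable_const.mul ((hf.2.1.1.norm.pow 2).mul
            (measurable_norm.pow_const 2).inv.aestronglyMeasurable)
        refine this.congr (Eventually.of_forall fun x => ?_)
        simp only [dens]; rw [hf.equiv.norm_apply x, div_eq_mul_inv]
      · filter_upwards [ae_ne_zero, hf.angular_eq] with x hx hax
        have e := norm_sq_radial_add_angular hx (weakDeriv 1 f x) (weakDeriv Complex.I f x)
        rw [hax, norm_mul, norm_mul, Complex.norm_I, one_mul, Complex.norm_natCast] at e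
        simp only [Pi.add_apply]
        rw [← e]
        have hnn : (n : ℝ) ≤ (n : ℝ) ^ 2 := by
          exact_mod_cast Nat.le_self_pow (by norm_num) n
        have hxp : 0 < ‖x‖ := norm_pos_iff.2 hx
        have h2 : dens f ‖x‖ = ‖f x‖ ^ 2 := by simp only [dens]; rw [← hf.equiv.norm_apply x]
        rw [Real.norm_of_nonneg (by rw [h2]; positivity), h2]
        have h3 : (n : ℝ) * (‖f x‖ ^ 2 / ‖x‖ ^ 2) ≤ (n : ℝ) ^ 2 * (‖f x‖ ^ 2 / ‖x‖ ^ 2) :=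
          mul_le_mul_of_nonneg_right hnn (by positivity)
        have h4 : 1 / ‖x‖ ^ 2 * ((n : ℝ) * ‖f x‖) ^ 2 = (n : ℝ) ^ 2 * (‖f x‖ ^ 2 / ‖x‖ ^ 2) := by
          ring
        rw [h4]
        have := sq_nonneg ‖radialDeriv x (weakDeriv 1 f x) (weakDeriv Complex.I f x)‖
        linarith
    refine (integrableOn_congr_fun (fun r hr => ?_) measurableSet_Ioi).1
      (integrable_radial_iff (F := fun r : ℝ => (n : ℝ) * (dens f r / r ^ 2)).1 this)
    have hr0 : r ≠ 0 := ne_of_gt hr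
    simp only [smul_eq_mul, Int.cast_natCast]
    field_simp

/-- The Dirichlet integral `∫ |∇f|²`. -/
noncomputable def dirichlet (f : ℂ → ℂ) : ℝ :=
  ∫ x, (‖weakDeriv 1 f x‖ ^ 2 + ‖weakDeriv Complex.I f x‖ ^ 2)

/-- In `(n + A_θ)²` the term `n²` is the squared angular derivative and completes the gradient; the
terms `2 n A_θ + A_θ²` and the quartic one are radial and go to polar coordinates. -/
theorem energy_eq (hf : MemH1m n f) : energy n g f = 1 / 2 * dirichlet f
    + Real.pi * (quartic n g (dens f) (dens f) + sextic (dens f) (dens f) (dens f)) := by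
  have hq := hf.isRadialDensity
  let G : ℝ → ℝ := fun r => (2 * n * pot (dens f) r + pot (dens f) r ^ 2) / r ^ 2 * dens f r
    - g / 2 * dens f r ^ 2
  have hG : ∀ r : ℝ, 0 < r → r • G r = (2 * (n : ℤ) * (pot (dens f) r / r * dens f r)
      - g / 2 * (dens f r * r * dens f r))
      + pot (dens f) r / r * (pot (dens f) r / r * (dens f r * r)) := fun r hr => by
    simp only [G, smul_eq_mul, Int.cast_natCast]; field_simp; ring
  have i1 := integrableOn_quartic (g := g) hq hq
  have i2 := integrableOn_sextic hq hq hq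
  have hGi : Integrable fun x : ℂ => G ‖x‖ :=
    integrable_radial_iff.2 ((integrableOn_congr_fun (fun r hr => hG r hr) measurableSet_Ioi).2
      (i1.add i2))
  have hGe : ∫ x : ℂ, G ‖x‖ = 2 * Real.pi
      * (quartic n g (dens f) (dens f) + sextic (dens f) (dens f) (dens f)) := by
    rw [integral_radial, setIntegral_congr_fun measurableSet_Ioi fun r hr => hG r hr,
      integral_add i1 i2]
    rfl
  have hD := integrable_fun_add (integrable_norm_sq hf.2.memLp_one)
    (integrable_norm_sq hf.2.memLp_I)
  have hae : ∀ᵐ x : ℂ, (‖radialDeriv x (weakDeriv 1 f x) (weakDeriv Complex.I f x)‖ ^ 2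
      + 1 / ‖x‖ ^ 2 * ‖Complex.I * (((n : ℤ) + potTheta f ‖x‖ : ℝ) : ℂ) * f x‖ ^ 2
      - g / 2 * ‖f x‖ ^ 4)
      = (‖weakDeriv 1 f x‖ ^ 2 + ‖weakDeriv Complex.I f x‖ ^ 2) + G ‖x‖ := by
    filter_upwards [ae_ne_zero, hf.angular_eq] with x hx hax
    have e := norm_sq_radial_add_angular hx (weakDeriv 1 f x) (weakDeriv Complex.I f x)
    rw [hax, norm_mul, norm_mul, Complex.norm_I, one_mul, Complex.norm_natCast] at e
    have h2 : dens f ‖x‖ = ‖f x‖ ^ 2 := by simp only [dens]; rw [← hf.equiv.norm_apply x]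
    have h3 : pot (dens f) ‖x‖ = potTheta f ‖x‖ := rfl
    rw [norm_mul, norm_mul, Complex.norm_I, one_mul, Complex.norm_real, mul_pow, Real.norm_eq_abs,
      sq_abs, ← e]
    simp only [G]
    rw [h2, h3]
    have hxp : ‖x‖ ≠ 0 := norm_ne_zero_iff.2 hx
    simp only [Int.cast_natCast]
    field_simp
    ring
  rw [energy, integral_congr_ae hae, integral_add hD hGi, hGe, dirichlet]
  ring

/-- When both gradient components vanish, 0 itself may serve as weak derivative, and the profile
bound `r |f|² ≤ C` then holds with `C = 0`. -/
theorem eq_zero_of_dirichlet_eq_zero (hf : MemH1m n f) (h0 : dirichlet f = 0) :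
    f =ᵐ[volume] 0 := by
  have hD := integrable_fun_add (integrable_norm_sq hf.2.memLp_one)
    (integrable_norm_sq hf.2.memLp_I)
  have hz := (integral_eq_zero_iff_of_nonneg (fun x => add_nonneg (sq_nonneg _) (sq_nonneg _)) hD).1 h0
  have z : ∀ {v : ℂ}, weakDeriv v f =ᵐ[volume] 0 → HasWeakDerivOn univ v f (weakDeriv v f) →
      HasWeakDerivOn univ v f (fun _ => 0) := fun {v} hv hw =>
    ⟨hw.1, locallyIntegrableOn_const 0, fun η hη hc hs => by
      rw [hw.2.2 η hη hc hs]
      congr 1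
      refine integral_congr_ae ?_
      filter_upwards [hv] with x hx
      rw [hx]; rfl⟩
  have z1 : weakDeriv 1 f =ᵐ[volume] 0 := by
    filter_upwards [hz] with x hx
    simp only [Pi.zero_apply] at hx
    have : ‖weakDeriv 1 f x‖ ^ 2 = 0 := by nlinarith [sq_nonneg ‖weakDeriv 1 f x‖, sq_nonneg ‖weakDeriv Complex.I f x‖]
    simpa using this
  have z2 : weakDeriv Complex.I f =ᵐ[volume] 0 := by
    filter_upwards [hz] with x hx
    simp only [Pi.zero_apply] at hx
    have : ‖weakDeriv Complex.I f x‖ ^ 2 = 0 := by nlinarith [sq_nonneg ‖weakDeriv 1 f x‖, sq_nonneg ‖weakDeriv Complex.I f x‖]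
    simpa using this
  obtain ⟨C, hC, -, hC0⟩ := profile_bounds hf.equiv hf.2.1 (z z1 hf.2.hasWeakDerivOn_one)
    (z z2 hf.2.hasWeakDerivOn_I) (MemLp.zero) (MemLp.zero)
  have hC1 := hC0 (fun _ => rfl) (fun _ => rfl)
  have hr : ∀ᵐ r ∂volume.restrict (Ioi (0 : ℝ)), r • dens f r = 0 := by
    rw [ae_restrict_iff' measurableSet_Ioi]
    filter_upwards [hC] with r hr hr0
    have := hr hr0
    rw [hC1] at this
    have hr0' : (0 : ℝ) < r := hr0
    have h2 : 0 ≤ dens f r * r := mul_nonneg (sq_nonneg _) hr0'.le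
    rw [smul_eq_mul, mul_comm]
    exact le_antisymm this h2
  have hint : ∫ x : ℂ, ‖f x‖ ^ 2 = 0 := by
    have : ∫ x : ℂ, ‖f x‖ ^ 2 = ∫ x : ℂ, dens f ‖x‖ := by
      congr 1; ext x; simp only [dens]; rw [← hf.equiv.norm_apply x]
    rw [this, integral_radial, integral_congr_ae hr]
    simp
  have := (integral_eq_zero_iff_of_nonneg (fun x => by positivity) (integrable_norm_sq hf.2.1)).1 hint
  filter_upwards [this] with x hx
  simpa using hx

end Energy


/-! ### Minimality and the Euler-Lagrange equation. -/

section Variation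

variable {n : ℕ} {g : ℝ} {f h φ : ℂ → ℂ}

theorem MemH1m.add {m : ℤ} (hf : MemH1m m f) (hh : MemH1m m h) : MemH1m m fun x => f x + h x :=
  ⟨hf.1.add hh.1, hf.2.add hh.2⟩

theorem MemH1m.const_mul {m : ℤ} (hf : MemH1m m f) (c : ℂ) : MemH1m m fun x => c * f x :=
  ⟨hf.1.const_mul c, hf.2.const_mul c⟩

theorem weakDeriv_const_mul {v : ℂ} {F : ℂ → ℂ} (hf : HasWeakDerivOn univ v f F) (c : ℂ) :
    weakDeriv v (fun x => c * f x) =ᵐ[volume] fun x => c * weakDeriv v f x :=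
  weakDeriv_ae_eq ((weakDeriv_spec ⟨F, hf⟩).const_mul c)

theorem charge_const_mul (c : ℂ) : charge (fun x => c * f x) = ‖c‖ ^ 2 * charge f := by
  simp only [charge, norm_mul, mul_pow]
  rw [integral_const_mul]

theorem dirichlet_const_mul (hf : MemH1 f) (c : ℂ) :
    dirichlet (fun x => c * f x) = ‖c‖ ^ 2 * dirichlet f := by
  simp only [dirichlet]
  rw [← integral_const_mul]
  refine integral_congr_ae ?_
  filter_upwards [weakDeriv_const_mul hf.hasWeakDerivOn_one c,
    weakDeriv_const_mul hf.hasWeakDerivOn_I c] with x h1 h2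
  rw [h1, h2, norm_mul, norm_mul]; ring

theorem dens_const_mul (c : ℂ) : dens (fun x => c * f x) = fun r => ‖c‖ ^ 2 * dens f r := by
  ext r; simp only [dens, norm_mul, mul_pow]

theorem energy_const_mul (hf : MemH1m n f) (c : ℂ) : energy n g (fun x => c * f x)
    = 1 / 2 * (‖c‖ ^ 2 * dirichlet f) + Real.pi * ((‖c‖ ^ 2) ^ 2 * quartic n g (dens f) (dens f)
      + (‖c‖ ^ 2) ^ 3 * sextic (dens f) (dens f) (dens f)) := by
  rw [energy_eq (hf.const_mul c), dirichlet_const_mul hf.2, dens_const_mul, quartic_const_mul,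
    sextic_const_mul]

theorem energy_nonneg_of_ae_zero {m : ℤ} (hf : f =ᵐ[volume] 0) : 0 ≤ energy m g f := by
  refine mul_nonneg (by norm_num) (integral_nonneg_of_ae ?_)
  filter_upwards [hf] with x hx
  simp only [hx, Pi.zero_apply, mul_zero, norm_zero]
  simp

theorem charge_pos (hf : MemLp f 2) (h0 : ¬ f =ᵐ[volume] 0) : 0 < charge f := by
  refine lt_of_le_of_ne (integral_nonneg fun x => sq_nonneg _) fun h => h0 ?_
  have := (integral_eq_zero_iff_of_nonneg (fun x => sq_nonneg _) (integrable_norm_sq hf)).1 h.symm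
  filter_upwards [this] with x hx
  simpa using hx

theorem dirichlet_nonneg : 0 ≤ dirichlet f := integral_nonneg fun _ => by positivity

/-- A minimal-charge zero-energy state makes the energy nonnegative on its charge ball. -/
theorem energy_nonneg_of_charge_le
    (hmin : ∀ f : ℂ → ℂ, MemH1m n f → ¬ f =ᵐ[volume] 0 → energy n g f = 0 → charge φ ≤ charge f)
    (hf : MemH1m n f) (hc : charge f ≤ charge φ) : 0 ≤ energy n g f := by
  by_contra hneg
  push Not at hneg
  have hf0 : ¬ f =ᵐ[volume] 0 := fun h => absurd (energy_nonneg_of_ae_zero (m := n) (g := g) h)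
    (not_le.2 hneg)
  have hD : 0 < dirichlet f := lt_of_le_of_ne dirichlet_nonneg fun h =>
    hf0 (eq_zero_of_dirichlet_eq_zero hf h.symm)
  set Q := quartic n g (dens f) (dens f)
  set S := sextic (dens f) (dens f) (dens f)
  -- `P c` is the energy of `c f` divided by `c²`. The division makes the value at `c = 0` strictly
  -- positive, so the zero found on `[0, 1]` is not the trivial one.
  let P : ℝ → ℝ := fun c => 1 / 2 * dirichlet f + Real.pi * (c ^ 2 * Q + c ^ 4 * S)
  have hP : ContinuousOn P (Icc 0 1) := by fun_prop
  have hP0 : 0 ≤ P 0 := by simp [P]; exact hD.le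
  have hP1 : P 1 < 0 := by
    have := energy_eq (g := g) hf
    simp only [P, one_pow, one_mul]
    linarith
  obtain ⟨c, ⟨hc0, hc1⟩, hPc⟩ := intermediate_value_Icc' zero_le_one hP ⟨hP1.le, hP0⟩
  have hc0' : 0 < c := by
    refine lt_of_le_of_ne hc0 fun h => ?_
    rw [← h] at hPc
    simp [P] at hPc
    linarith
  have hc1' : c < 1 := by
    refine lt_of_le_of_ne hc1 fun h => ?_
    rw [h] at hPc; linarith
  have hn : ‖(c : ℂ)‖ = c := by rw [Complex.norm_real, Real.norm_of_nonneg hc0]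
  have hE : energy n g (fun x => (c : ℂ) * f x) = 0 := by
    rw [energy_const_mul hf, hn]
    have : c ^ 2 * P c = 0 := by rw [hPc, mul_zero]
    simp only [P] at this
    linarith
  have hcf0 : ¬ (fun x => (c : ℂ) * f x) =ᵐ[volume] 0 := fun h => hf0 (by
    filter_upwards [h] with x hx
    have hcC : (c : ℂ) ≠ 0 := by exact_mod_cast hc0'.ne'
    simpa [hcC] using hx)
  have h1 := hmin _ (hf.const_mul c) hcf0 hE
  rw [charge_const_mul, hn] at h1
  have h2 := charge_pos hf.2.1 hf0
  have h3 : c ^ 2 < 1 := pow_lt_one₀ hc0 hc1' two_ne_zero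
  have h4 : c ^ 2 * charge f < 1 * charge f := mul_lt_mul_of_pos_right h3 h2
  linarith

theorem norm_add_real_mul_sq (a b : ℂ) (s : ℝ) :
    ‖a + s * b‖ ^ 2 = ‖a‖ ^ 2 + (s * (2 * (conj a * b).re) + s ^ 2 * ‖b‖ ^ 2) := by
  simp only [Complex.sq_norm, Complex.normSq_apply, Complex.add_re, Complex.add_im, Complex.mul_re,
    Complex.mul_im, Complex.conj_re, Complex.conj_im, Complex.ofReal_re, Complex.ofReal_im]
  ring

theorem integrable_conj_mul {a b : ℂ → ℂ} (ha : MemLp a 2) (hb : MemLp b 2) :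
    Integrable fun x => conj (a x) * b x :=
  MemLp.integrable_mul (p := 2) (q := 2) ha.star hb

theorem integral_norm_add_sq {a b : ℂ → ℂ} (ha : MemLp a 2) (hb : MemLp b 2) (s : ℝ) :
    ∫ x, ‖a x + s * b x‖ ^ 2
      = (∫ x, ‖a x‖ ^ 2) + (s * (2 * ∫ x, (conj (a x) * b x).re) + s ^ 2 * ∫ x, ‖b x‖ ^ 2) := by
  simp_rw [norm_add_real_mul_sq]
  have i1 : Integrable fun x => s * (2 * (conj (a x) * b x).re) :=
    ((integrable_conj_mul ha hb).re.const_mul 2).const_mul s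
  have i2 := (integrable_norm_sq hb).const_mul (s ^ 2)
  rw [integral_add (integrable_norm_sq ha) (integrable_fun_add i1 i2), integral_add i1 i2,
    integral_const_mul, integral_const_mul, integral_const_mul]

/-- The Dirichlet form. -/
noncomputable def dirichletForm (f h : ℂ → ℂ) : ℂ :=
  ∫ x, (conj (weakDeriv 1 f x) * weakDeriv 1 h x
    + conj (weakDeriv Complex.I f x) * weakDeriv Complex.I h x)

theorem dirichlet_add (hf : MemH1 f) (hh : MemH1 h) (s : ℝ) :
    dirichlet (fun x => f x + s * h x)
      = dirichlet f + (s * (2 * (dirichletForm f h).re) + s ^ 2 * dirichlet h) := by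
  have e : dirichlet (fun x => f x + s * h x) = ∫ x, (‖weakDeriv 1 f x + s * weakDeriv 1 h x‖ ^ 2
      + ‖weakDeriv Complex.I f x + s * weakDeriv Complex.I h x‖ ^ 2) := by
    refine integral_congr_ae ?_
    filter_upwards [weakDeriv_ae_eq (hf.hasWeakDerivOn_one.add (hh.hasWeakDerivOn_one.const_mul s)),
      weakDeriv_ae_eq (hf.hasWeakDerivOn_I.add (hh.hasWeakDerivOn_I.const_mul s))] with x h1 h2
    rw [h1, h2]
  have l1 := hf.memLp_one.add (hh.memLp_one.const_mul (s : ℂ))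
  have l2 := hf.memLp_I.add (hh.memLp_I.const_mul (s : ℂ))
  have c1 := integrable_conj_mul hf.memLp_one hh.memLp_one
  have c2 := integrable_conj_mul hf.memLp_I hh.memLp_I
  have n1 := integrable_norm_sq l1
  have n2 := integrable_norm_sq l2
  simp only [Pi.add_apply] at n1 n2
  rw [e, integral_add n1 n2,
    integral_norm_add_sq hf.memLp_one hh.memLp_one, integral_norm_add_sq hf.memLp_I hh.memLp_I]
  simp only [dirichlet, dirichletForm]
  rw [integral_add (integrable_norm_sq hf.memLp_one) (integrable_norm_sq hf.memLp_I),
    integral_add (integrable_norm_sq hh.memLp_one) (integrable_norm_sq hh.memLp_I),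
    integral_add c1 c2, Complex.add_re]
  have r1 : ∀ {a b : ℂ → ℂ}, Integrable (fun x => conj (a x) * b x) →
      (∫ x, conj (a x) * b x).re = ∫ x, (conj (a x) * b x).re := fun hi => (integral_re hi).symm
  rw [r1 c1, r1 c2]; ring

theorem MemH1m.aestronglyMeasurable_profile (hf : MemH1m n f) :
    AEStronglyMeasurable (fun r : ℝ => f (r : ℂ)) (volume.restrict (Ioi 0)) :=
  (locallyIntegrableOn_profile hf.equiv hf.2.locallyIntegrable).aestronglyMeasurable

/-- The product is dominated by `|f|² + |h|²`; this puts the linear coefficient of the density along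
`f + s h` in the admissible class. -/
theorem isRadialDensity_cross (hf : MemH1m n f) (hh : MemH1m n h) (L : ℂ →L[ℝ] ℝ)
    (hL : ∀ z, |L z| ≤ ‖z‖) :
    IsRadialDensity n fun r => L (conj (f (r : ℂ)) * h (r : ℂ)) := by
  refine (hf.isRadialDensity.add hh.isRadialDensity).mono
    (L.continuous.comp_aestronglyMeasurable ((Complex.continuous_conj.comp_aestronglyMeasurable
      hf.aestronglyMeasurable_profile).mul hh.aestronglyMeasurable_profile)) fun r => ?_
  refine (hL _).trans ?_
  rw [norm_mul, Complex.norm_conj]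
  simp only [dens]
  nlinarith [sq_nonneg (‖f (r : ℂ)‖ - ‖h (r : ℂ)‖), sq_nonneg ‖f (r : ℂ)‖, sq_nonneg ‖h (r : ℂ)‖]

theorem dens_add (s : ℝ) : dens (fun x => f x + s * h x)
    = densityPath (dens f) (fun r => 2 * Complex.reCLM (conj (f (r : ℂ)) * h (r : ℂ))) (dens h) s := by
  ext r
  simp only [dens, densityPath, norm_add_real_mul_sq, Complex.reCLM_apply]

theorem conj_mul_radial (hf : MemH1m n f) (hh : MemH1m n h) (x : ℂ) :
    conj (f x) * h x = conj (f (‖x‖ : ℂ)) * h (‖x‖ : ℂ) := by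
  rw [hf.equiv.apply_eq x, hh.equiv.apply_eq x]
  set e := Complex.exp (Complex.I * ((n : ℤ) : ℂ) * x.arg) with he
  have h1 : conj e * e = 1 := by
    rw [← Complex.normSq_eq_conj_mul_self, Complex.normSq_eq_norm_sq, he,
      show Complex.I * ((n : ℤ) : ℂ) * x.arg = ((n * x.arg : ℝ) : ℂ) * Complex.I by push_cast; ring,
      Complex.norm_exp_ofReal_mul_I]
    simp
  rw [map_mul]
  linear_combination (conj (f (‖x‖ : ℂ)) * h (‖x‖ : ℂ)) * h1

/-- The Euler-Lagrange equation, real part. -/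
theorem euler_lagrange_real (hφ : MemH1m n φ) (hφ0 : ¬ φ =ᵐ[volume] 0) (hE : energy n g φ = 0)
    (hmin : ∀ f : ℂ → ℂ, MemH1m n f → ¬ f =ᵐ[volume] 0 → energy n g f = 0 → charge φ ≤ charge f)
    (hh : MemH1m n h) :
    (dirichletForm φ h).re + 2 * Real.pi * ∫ r in Ioi (0 : ℝ), effPot n g (dens φ) r
        * (Complex.reCLM (conj (φ (r : ℂ)) * h (r : ℂ)) * r)
      = (-2 * (dirichlet φ + Real.pi * quartic n g (dens φ) (dens φ)) / charge φ)
        * ∫ x, (conj (φ x) * h x).re := by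
  set N := charge φ with hN
  have hNpos : 0 < N := charge_pos hφ.2.1 hφ0
  set q₁ : ℝ → ℝ := fun r => 2 * Complex.reCLM (conj (φ (r : ℂ)) * h (r : ℂ)) with hq₁
  have h₀ := hφ.isRadialDensity
  have h₁ : IsRadialDensity n q₁ :=
    (isRadialDensity_cross hφ hh Complex.reCLM Complex.abs_re_le_norm).const_mul 2
  have h₂ := hh.isRadialDensity
  set b := 2 * ∫ x, (conj (φ x) * h x).re with hb
  set Q : ℝ → ℝ := fun s => quartic n g (densityPath (dens φ) q₁ (dens h) s)
    (densityPath (dens φ) q₁ (dens h) s) with hQ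
  set S : ℝ → ℝ := fun s => sextic (densityPath (dens φ) q₁ (dens h) s)
    (densityPath (dens φ) q₁ (dens h) s) (densityPath (dens φ) q₁ (dens h) s) with hS
  set D : ℝ → ℝ := fun s => dirichlet φ + (s * (2 * (dirichletForm φ h).re) + s ^ 2 * dirichlet h)
    with hD
  set ν : ℝ → ℝ := fun s => N + (s * b + s ^ 2 * charge h) with hν
  have dQ := hasDerivAt_quartic_path (g := g) h₀ h₁ h₂
  have dS := hasDerivAt_sextic_path h₀ h₁ h₂
  have dD : HasDerivAt D (2 * (dirichletForm φ h).re) 0 := hasDerivAt_path_const _ _ _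
  have dν : HasDerivAt ν b 0 := hasDerivAt_path_const _ _ _
  -- This is `ν³` times the energy of `φ + s h` rescaled to charge `N`. The factor `ν³` clears all
  -- denominators, and it is harmless for the sign because `ν > 0` near 0. The sextic term then
  -- carries no power of `ν`, which is why only `D` and `Q` enter the multiplier.
  let G : ℝ → ℝ := fun s => 1 / 2 * N * (ν s ^ 2 * D s)
    + Real.pi * (N ^ 2 * (ν s * Q s) + N ^ 3 * S s)
  have hν0 : ν 0 = N := by simp [hν]
  have hQ0 : Q 0 = quartic n g (dens φ) (dens φ) := by simp only [hQ, densityPath_zero]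
  have hS0 : S 0 = sextic (dens φ) (dens φ) (dens φ) := by simp only [hS, densityPath_zero]
  have hD0 : D 0 = dirichlet φ := by simp [hD]
  have hG0 : G 0 = 0 := by
    simp only [G, hν0, hQ0, hS0, hD0]
    rw [energy_eq hφ] at hE
    linear_combination N ^ 3 * hE
  have hGnn : ∀ᶠ s in 𝓝 (0 : ℝ), G 0 ≤ G s := by
    have hνpos : ∀ᶠ s in 𝓝 (0 : ℝ), 0 < ν s :=
      dν.continuousAt.eventually (lt_mem_nhds (by rw [hν0]; exact hNpos))
    filter_upwards [hνpos] with s hs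
    rw [hG0]
    have hfs : MemH1m n fun x => φ x + (s : ℂ) * h x := hφ.add (hh.const_mul s)
    have hcs : charge (fun x => φ x + (s : ℂ) * h x) = ν s := integral_norm_add_sq hφ.2.1 hh.2.1 s
    -- The charge scales by the square of the amplitude, so this factor restores the charge `N`
    -- exactly.
    set t := Real.sqrt (N / ν s) with ht
    have ht2 : ‖(t : ℂ)‖ ^ 2 = N / ν s := by
      rw [Complex.norm_real, Real.norm_eq_abs, sq_abs, ht, Real.sq_sqrt (by positivity)]
    have hpos := energy_nonneg_of_charge_le hmin (hfs.const_mul t)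
      (by rw [charge_const_mul, hcs, ht2, div_mul_cancel₀ _ hs.ne'])
    rw [energy_const_mul hfs, ht2, dens_add, dirichlet_add hφ.2 hh.2] at hpos
    have key : G s = ν s ^ 3 * (1 / 2 * (N / ν s * D s)
        + Real.pi * ((N / ν s) ^ 2 * Q s + (N / ν s) ^ 3 * S s)) := by
      simp only [G]; field_simp
    rw [key]
    exact mul_nonneg (by positivity) hpos
  have dG := ((((dν.pow 2).mul dD).const_mul (1 / 2 * N)).add
    ((((dν.mul dQ).const_mul (N ^ 2)).add (dS.const_mul (N ^ 3))).const_mul Real.pi))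
  have hmin0 : IsLocalMin G 0 := hGnn
  have hzero := hmin0.hasDerivAt_eq_zero dG
  have fv := first_variation (g := g) h₀ h₁
  simp only [Pi.pow_apply, hν0, hD0, Nat.cast_ofNat, Nat.add_one_sub_one, pow_one] at hzero
  have hQ0' : quartic n g (densityPath (dens φ) q₁ (dens h) 0) (densityPath (dens φ) q₁ (dens h) 0)
      = quartic n g (dens φ) (dens φ) := hQ0
  rw [hQ0'] at hzero
  have e1 : ∫ r in Ioi (0 : ℝ), effPot n g (dens φ) r * (q₁ r * r)
      = 2 * ∫ r in Ioi (0 : ℝ), effPot n g (dens φ) r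
        * (Complex.reCLM (conj (φ (r : ℂ)) * h (r : ℂ)) * r) := by
    rw [← integral_const_mul]; congr 1; ext r; simp only [hq₁]; ring
  rw [e1] at fv
  set J := ∫ r in Ioi (0 : ℝ), effPot n g (dens φ) r
        * (Complex.reCLM (conj (φ (r : ℂ)) * h (r : ℂ)) * r)
  have hb' : ∫ x, (conj (φ x) * h x).re = b / 2 := by rw [hb]; ring
  rw [hb', div_mul_eq_mul_div, eq_div_iff hNpos.ne']
  have hN2 : N ^ 2 ≠ 0 := by positivity
  apply mul_left_cancel₀ hN2
  linear_combination hzero - N ^ 3 * Real.pi * fv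

theorem integrable_effPot_mul (hφ : MemH1m n φ) (hh : MemH1m n h) :
    Integrable fun x : ℂ => (effPot n g (dens φ) ‖x‖ : ℂ) * (conj (φ x) * h x) := by
  have i1 := integrableOn_effPot_mul (g := g) hφ.isRadialDensity
    (isRadialDensity_cross hφ hh Complex.reCLM Complex.abs_re_le_norm)
  have i2 := integrableOn_effPot_mul (g := g) hφ.isRadialDensity
    (isRadialDensity_cross hφ hh Complex.imCLM Complex.abs_im_le_norm)
  have : Integrable fun x : ℂ => (fun r : ℝ => (effPot n g (dens φ) r : ℂ)
      * (conj (φ (r : ℂ)) * h (r : ℂ))) ‖x‖ := by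
    refine (integrable_radial_iff (F := fun r : ℝ => (effPot n g (dens φ) r : ℂ)
      * (conj (φ (r : ℂ)) * h (r : ℂ)))).2 ?_
    have := integrable_fun_add (i1.ofReal (𝕜 := ℂ)) ((i2.ofReal (𝕜 := ℂ)).const_mul Complex.I)
    refine this.congr (Eventually.of_forall fun r => ?_)
    simp only [Complex.reCLM_apply, Complex.imCLM_apply, Complex.real_smul, Complex.coe_algebraMap]
    generalize conj (φ (r : ℂ)) * h (r : ℂ) = z
    conv_rhs => rw [← Complex.re_add_im z]
    push_cast
    ring
  refine this.congr (Eventually.of_forall fun x => ?_)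
  simp only
  rw [conj_mul_radial hφ hh x]

theorem dirichletForm_const_mul_right (hh : MemH1 h) (c : ℂ) :
    dirichletForm f (fun x => c * h x) = c * dirichletForm f h := by
  simp only [dirichletForm]
  rw [← integral_const_mul]
  refine integral_congr_ae ?_
  filter_upwards [weakDeriv_const_mul hh.hasWeakDerivOn_one c,
    weakDeriv_const_mul hh.hasWeakDerivOn_I c] with x h1 h2
  rw [h1, h2]; ring

/-- The Euler-Lagrange equation. -/
theorem exists_euler_lagrange (hφ : MemH1m n φ) (hφ0 : ¬ φ =ᵐ[volume] 0) (hE : energy n g φ = 0)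
    (hmin : ∀ f : ℂ → ℂ, MemH1m n f → ¬ f =ᵐ[volume] 0 → energy n g f = 0 → charge φ ≤ charge f) :
    ∃ μ : ℝ, ∀ h : ℂ → ℂ, MemH1m n h →
      dirichletForm φ h + (∫ x : ℂ, (effPot n g (dens φ) ‖x‖ : ℂ) * (conj (φ x) * h x))
        = μ * ∫ x, conj (φ x) * h x := by
  refine ⟨-2 * (dirichlet φ + Real.pi * quartic n g (dens φ) (dens φ)) / charge φ, ?_⟩
  set μ := -2 * (dirichlet φ + Real.pi * quartic n g (dens φ) (dens φ)) / charge φ with hμ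
  let Z : (ℂ → ℂ) → ℂ := fun h => dirichletForm φ h
    + (∫ x : ℂ, (effPot n g (dens φ) ‖x‖ : ℂ) * (conj (φ x) * h x)) - μ * ∫ x, conj (φ x) * h x
  have hre : ∀ h, MemH1m n h → (Z h).re = 0 := by
    intro h hh
    have key := euler_lagrange_real hφ hφ0 hE hmin hh
    have hi := integrable_effPot_mul (g := g) hφ hh
    have hj := integrable_conj_mul hφ.2.1 hh.2.1
    have e1 : (∫ x : ℂ, (effPot n g (dens φ) ‖x‖ : ℂ) * (conj (φ x) * h x)).re
        = 2 * Real.pi * ∫ r in Ioi (0 : ℝ), effPot n g (dens φ) r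
        * (Complex.reCLM (conj (φ (r : ℂ)) * h (r : ℂ)) * r) := by
      have a1 : (∫ x : ℂ, (effPot n g (dens φ) ‖x‖ : ℂ) * (conj (φ x) * h x)).re
          = ∫ x : ℂ, ((effPot n g (dens φ) ‖x‖ : ℂ) * (conj (φ x) * h x)).re :=
        (integral_re hi).symm
      rw [a1]
      have : ∀ x : ℂ, ((effPot n g (dens φ) ‖x‖ : ℂ) * (conj (φ x) * h x)).re
          = (fun r : ℝ => effPot n g (dens φ) r * (conj (φ (r : ℂ)) * h (r : ℂ)).re) ‖x‖ := by
        intro x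
        rw [Complex.re_ofReal_mul, conj_mul_radial hφ hh x]
      simp_rw [this]
      rw [integral_radial (fun r : ℝ => effPot n g (dens φ) r
        * (conj (φ (r : ℂ)) * h (r : ℂ)).re), smul_eq_mul]
      congr 2; ext r
      simp only [smul_eq_mul, Complex.reCLM_apply]; ring
    have e2 : (∫ x, conj (φ x) * h x).re = ∫ x, (conj (φ x) * h x).re := (integral_re hj).symm
    simp only [Z, Complex.sub_re, Complex.add_re, Complex.re_ofReal_mul]
    rw [e1, e2, key]; ring
  intro h hh
  -- The defect `Z` commutes with multiplication by `i`. Vanishing of its real part at both `h` and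
  -- `i h` therefore kills its imaginary part too, with the same multiplier.
  have hI : Z (fun x => Complex.I * h x) = Complex.I * Z h := by
    simp only [Z, mul_left_comm _ Complex.I, integral_const_mul]
    rw [dirichletForm_const_mul_right hh.2]
    ring
  have h1 := hre h hh
  have h2 := hre _ (hh.const_mul Complex.I)
  rw [hI, Complex.I_mul_re, neg_eq_zero] at h2
  have h3 : Z h = 0 := Complex.ext h1 h2
  exact sub_eq_zero.1 h3

end Variation


/-! ### Smooth dependence of integrals on a parameter. -/

section Parametric

theorem hasFDerivAt_intervalIntegral_param {V : Type} [NormedAddCommGroup V] [NormedSpace ℝ V]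
    {F : ℂ × ℝ → V} (hF : ContDiff ℝ 1 F) (a b : ℝ) (x₀ : ℂ) :
    HasFDerivAt (fun x => ∫ t in a..b, F (x, t))
      (∫ t in a..b, (fderiv ℝ F (x₀, t)).comp (ContinuousLinearMap.inl ℝ ℂ ℝ)) x₀ := by
  have hc : Continuous fun p : ℂ × ℝ => (fderiv ℝ F p).comp (ContinuousLinearMap.inl ℝ ℂ ℝ) :=
    (hF.continuous_fderiv one_ne_zero).clm_comp continuous_const
  obtain ⟨M, hM⟩ := ((isCompact_closedBall x₀ 1).prod (isCompact_uIcc (a := a) (b := b)))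
    |>.exists_bound_of_continuousOn hc.continuousOn
  have sl : ∀ x : ℂ, Continuous fun t : ℝ => (x, t) := fun x => by fun_prop
  refine intervalIntegral.hasFDerivAt_integral_of_dominated_of_fderiv_le
    (F := fun x t => F (x, t))
    (F' := fun x t => (fderiv ℝ F (x, t)).comp (ContinuousLinearMap.inl ℝ ℂ ℝ))
    (bound := fun _ => M) (Metric.closedBall_mem_nhds x₀ one_pos)
    (Eventually.of_forall fun x => (hF.continuous.comp (sl x)).aestronglyMeasurable)
    ((hF.continuous.comp (sl x₀)).intervalIntegrable _ _)
    (hc.comp (sl x₀)).aestronglyMeasurable ?_ intervalIntegrable_const ?_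
  · exact Eventually.of_forall fun t ht x hx => hM (x, t) ⟨hx, uIoc_subset_uIcc ht⟩
  · refine Eventually.of_forall fun t _ x _ => ?_
    have h1 : HasFDerivAt (fun x : ℂ => (x, t)) (ContinuousLinearMap.inl ℝ ℂ ℝ) x :=
      hasFDerivAt_prodMk_left x t
    exact (hF.differentiable one_ne_zero (x, t)).hasFDerivAt.comp x h1

/-- The derivative is again a parameter integral, with values in a space of linear maps; the target
space therefore varies inside the induction. -/
theorem contDiff_intervalIntegral_param (k : ℕ) : ∀ {V : Type} [NormedAddCommGroup V]
    [NormedSpace ℝ V] {F : ℂ × ℝ → V}, ContDiff ℝ ∞ F → ∀ a b : ℝ,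
    ContDiff ℝ k fun x => ∫ t in a..b, F (x, t) := by
  induction k with
  | zero =>
    intro V _ _ F hF a b
    exact contDiff_zero.2 (continuous_iff_continuousAt.2 fun x =>
      (hasFDerivAt_intervalIntegral_param (hF.of_le (by simp)) a b x).continuousAt)
  | succ k ih =>
    intro V _ _ F hF a b
    have hF' : ContDiff ℝ ∞ fun p : ℂ × ℝ =>
        (fderiv ℝ F p).comp (ContinuousLinearMap.inl ℝ ℂ ℝ) :=
      (hF.fderiv_right (m := ∞) (by simp)).clm_comp contDiff_const
    rw [show ((k + 1 : ℕ) : WithTop ℕ∞) = (k : WithTop ℕ∞) + 1 by simp,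
      contDiff_succ_iff_hasFDerivAt]
    exact ⟨_, ih hF' a b, fun x => hasFDerivAt_intervalIntegral_param (hF.of_le (by simp)) a b x⟩

theorem contDiff_infty_intervalIntegral_param {V : Type} [NormedAddCommGroup V]
    [NormedSpace ℝ V] {F : ℂ × ℝ → V} (hF : ContDiff ℝ ∞ F) (a b : ℝ) :
    ContDiff ℝ ∞ fun x => ∫ t in a..b, F (x, t) :=
  contDiff_infty.2 fun k => contDiff_intervalIntegral_param k hF a b

theorem fderiv_intervalIntegral_param {F : ℂ × ℝ → ℂ} (hF : ContDiff ℝ ∞ F) (a b : ℝ) (x v : ℂ) :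
    fderiv ℝ (fun x => ∫ t in a..b, F (x, t)) x v
      = ∫ t in a..b, fderiv ℝ (fun y => F (y, t)) x v := by
  rw [(hasFDerivAt_intervalIntegral_param (hF.of_le (by simp)) a b x).fderiv,
    ContinuousLinearMap.intervalIntegral_apply]
  · refine intervalIntegral.integral_congr fun t _ => ?_
    have h1 : HasFDerivAt (fun x : ℂ => (x, t)) (ContinuousLinearMap.inl ℝ ℂ ℝ) x :=
      hasFDerivAt_prodMk_left x t
    have h2 := (hF.differentiable (by simp) (x, t)).hasFDerivAt.comp x h1
    exact congrArg (fun L : ℂ →L[ℝ] ℂ => L v) h2.fderiv.symm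
  · have hc : Continuous fun p : ℂ × ℝ => (fderiv ℝ F p).comp (ContinuousLinearMap.inl ℝ ℂ ℝ) :=
      (hF.continuous_fderiv (by simp)).clm_comp continuous_const
    exact (hc.comp (by fun_prop : Continuous fun t : ℝ => (x, t))).intervalIntegrable _ _

end Parametric

/-! ### Averaging test functions over rotations. -/

section RotAvg

variable {n : ℕ} {η k : ℂ → ℂ}

/-- The projection of `η` to the angular momentum sector `-n`. -/
noncomputable def rotAvg (n : ℕ) (η : ℂ → ℂ) (x : ℂ) : ℂ :=
  ∫ a in (0 : ℝ)..(2 * Real.pi), ((2 * Real.pi : ℝ) : ℂ)⁻¹ * (Complex.exp (n * (a * Complex.I))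
    * η (Complex.exp (a * Complex.I) * x))

/-- The coordinate form of the Laplacian. -/
noncomputable def lap (η : ℂ → ℂ) (x : ℂ) : ℂ :=
  fderiv ℝ (fun y => fderiv ℝ η y 1) x 1 + fderiv ℝ (fun y => fderiv ℝ η y Complex.I) x Complex.I

theorem contDiff_exp_mul : ContDiff ℝ ∞ fun p : ℂ × ℝ => Complex.exp (p.2 * Complex.I) := by
  have h1 : ContDiff ℝ ∞ fun p : ℂ × ℝ => (p.2 : ℂ) := Complex.ofRealCLM.contDiff.comp contDiff_snd
  exact (h1.mul contDiff_const).cexp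

theorem contDiff_phase (n : ℕ) :
    ContDiff ℝ ∞ fun p : ℂ × ℝ => Complex.exp (n * (p.2 * Complex.I)) := by
  have h1 : ContDiff ℝ ∞ fun p : ℂ × ℝ => (p.2 : ℂ) := Complex.ofRealCLM.contDiff.comp contDiff_snd
  exact (contDiff_const.mul (h1.mul contDiff_const)).cexp

theorem contDiff_rotAvg_integrand (n : ℕ) (hη : ContDiff ℝ ∞ η) :
    ContDiff ℝ ∞ fun p : ℂ × ℝ => ((2 * Real.pi : ℝ) : ℂ)⁻¹ * (Complex.exp (n * (p.2 * Complex.I))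
      * η (Complex.exp (p.2 * Complex.I) * p.1)) :=
  contDiff_const.mul ((contDiff_phase n).mul (hη.comp (contDiff_exp_mul.mul contDiff_fst)))

theorem contDiff_rotAvg (n : ℕ) (hη : ContDiff ℝ ∞ η) : ContDiff ℝ ∞ (rotAvg n η) :=
  contDiff_infty_intervalIntegral_param (contDiff_rotAvg_integrand n hη) _ _

theorem rotAvg_eq_zero {x : ℂ} (h : ∀ y : ℂ, ‖y‖ = ‖x‖ → η y = 0) : rotAvg n η x = 0 := by
  simp [rotAvg, h _ (norm_exp_I_mul _ x)]

theorem hasCompactSupport_rotAvg (hc : HasCompactSupport η) : HasCompactSupport (rotAvg n η) := by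
  obtain ⟨R, hR⟩ := hc.isCompact.isBounded.subset_closedBall 0
  refine HasCompactSupport.of_support_subset_isCompact (isCompact_closedBall (0 : ℂ) R) ?_
  intro x hx
  by_contra hxR
  refine hx (rotAvg_eq_zero fun y hy => image_eq_zero_of_notMem_tsupport fun hm => hxR ?_)
  have := hR hm
  rw [mem_closedBall_zero_iff] at this ⊢
  rwa [← hy]

/-- A rotation by `b` shifts the averaging angle, and the integrand is `2π`-periodic because `n` is
an integer. The sign of the character means that the conjugate of the average is `n`-equivariant. -/
theorem rotAvg_rotate (n : ℕ) (η : ℂ → ℂ) (b : ℝ) (x : ℂ) :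
    rotAvg n η (Complex.exp (b * Complex.I) * x)
      = Complex.exp (-(n * (b * Complex.I))) * rotAvg n η x := by
  set G : ℝ → ℂ := fun a => ((2 * Real.pi : ℝ) : ℂ)⁻¹ * (Complex.exp (n * (a * Complex.I))
    * η (Complex.exp (a * Complex.I) * x)) with hG
  have hper : Function.Periodic G (2 * Real.pi) := by
    intro a
    simp only [hG]
    have e1 : Complex.exp (((a + 2 * Real.pi : ℝ) : ℂ) * Complex.I) = Complex.exp (a * Complex.I) := by
      push_cast
      rw [add_mul, Complex.exp_add, Complex.exp_two_pi_mul_I, mul_one]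
    rw [Complex.exp_nat_mul, e1, ← Complex.exp_nat_mul]
  have e : ∀ a : ℝ, ((2 * Real.pi : ℝ) : ℂ)⁻¹ * (Complex.exp (n * (a * Complex.I))
      * η (Complex.exp (a * Complex.I) * (Complex.exp (b * Complex.I) * x)))
      = Complex.exp (-(n * (b * Complex.I))) * G (a + b) := by
    intro a
    simp only [hG]
    have e2 : Complex.exp (((a + b : ℝ) : ℂ) * Complex.I)
        = Complex.exp (a * Complex.I) * Complex.exp (b * Complex.I) := by
      rw [← Complex.exp_add]; congr 1; push_cast; ring
    have e3 : Complex.exp (n * (a * Complex.I)) = Complex.exp (-(n * (b * Complex.I)))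
        * Complex.exp (n * (((a + b : ℝ) : ℂ) * Complex.I)) := by
      rw [← Complex.exp_add]; congr 1; push_cast; ring
    rw [e3, e2, mul_assoc (Complex.exp (a * Complex.I))]; ring
  simp only [rotAvg]
  simp_rw [e]
  rw [intervalIntegral.integral_const_mul, intervalIntegral.integral_comp_add_right]
  congr 1
  have := hper.intervalIntegral_add_eq b 0
  rw [zero_add] at this
  rw [zero_add, add_comm, this]

theorem fderiv_mul_left_apply {ξ : ℂ → ℂ} (hξ : Differentiable ℝ ξ) (c x v : ℂ) :
    fderiv ℝ (fun y => ξ (c * y)) x v = fderiv ℝ ξ (c * x) (c * v) := by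
  have h1 : HasFDerivAt (fun y : ℂ => c * y) (ContinuousLinearMap.mul ℝ ℂ c) x :=
    (ContinuousLinearMap.mul ℝ ℂ c).hasFDerivAt
  have := (hξ (c * x)).hasFDerivAt.comp x h1
  exact congrArg (fun L : ℂ →L[ℝ] ℂ => L v) this.fderiv

theorem lap_eq {ξ : ℂ → ℂ} (hξ : ContDiff ℝ ∞ ξ) (x : ℂ) :
    lap ξ x = fderiv ℝ (fderiv ℝ ξ) x 1 1 + fderiv ℝ (fderiv ℝ ξ) x Complex.I Complex.I := by
  have hd : DifferentiableAt ℝ (fderiv ℝ ξ) x :=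
    (hξ.fderiv_right (m := ∞) (by simp)).differentiable (by simp) x
  have e : ∀ v w : ℂ, fderiv ℝ (fun y => fderiv ℝ ξ y v) x w = fderiv ℝ (fderiv ℝ ξ) x w v := by
    intro v w
    rw [fderiv_clm_apply hd (differentiableAt_const v)]
    simp
  rw [lap, e, e]

theorem fderiv_fderiv_rotAvg (n : ℕ) (hη : ContDiff ℝ ∞ η) (x v : ℂ) :
    fderiv ℝ (fun y => fderiv ℝ (rotAvg n η) y v) x v
      = ∫ a in (0 : ℝ)..(2 * Real.pi), ((2 * Real.pi : ℝ) : ℂ)⁻¹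
        * (Complex.exp (n * (a * Complex.I))
        * fderiv ℝ (fderiv ℝ η) (Complex.exp (a * Complex.I) * x) (Complex.exp (a * Complex.I) * v)
          (Complex.exp (a * Complex.I) * v)) := by
  have hd := hη.differentiable (by simp)
  have hη' : ContDiff ℝ ∞ (fderiv ℝ η) := hη.fderiv_right (m := ∞) (by simp)
  have h1 : ∀ y, fderiv ℝ (rotAvg n η) y v = ∫ a in (0 : ℝ)..(2 * Real.pi),
      (fun p : ℂ × ℝ => ((2 * Real.pi : ℝ) : ℂ)⁻¹ * (Complex.exp (n * (p.2 * Complex.I))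
        * fderiv ℝ η (Complex.exp (p.2 * Complex.I) * p.1) (Complex.exp (p.2 * Complex.I) * v)))
        (y, a) := by
    intro y
    unfold rotAvg
    rw [fderiv_intervalIntegral_param (contDiff_rotAvg_integrand n hη)]
    refine intervalIntegral.integral_congr fun a _ => ?_
    have hda : DifferentiableAt ℝ (fun y => η (Complex.exp (a * Complex.I) * y)) y :=
      (hd _).comp y (by fun_prop)
    simp only
    rw [fderiv_const_mul (hda.const_mul _), fderiv_const_mul hda]
    simp only [smul_apply, smul_eq_mul]
    rw [fderiv_mul_left_apply hd]
  have hF : ContDiff ℝ ∞ (fun p : ℂ × ℝ => ((2 * Real.pi : ℝ) : ℂ)⁻¹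
      * (Complex.exp (n * (p.2 * Complex.I)) * fderiv ℝ η (Complex.exp (p.2 * Complex.I) * p.1)
        (Complex.exp (p.2 * Complex.I) * v))) :=
    contDiff_const.mul ((contDiff_phase n).mul ((hη'.comp (contDiff_exp_mul.mul contDiff_fst)).clm_apply
      (contDiff_exp_mul.mul contDiff_const)))
  simp_rw [h1]
  rw [fderiv_intervalIntegral_param hF]
  refine intervalIntegral.integral_congr fun a _ => ?_
  set w := Complex.exp (a * Complex.I) * v
  have hξ : ContDiff ℝ ∞ (fun y => fderiv ℝ η y w) := contDiff_fderiv_apply_const hη w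
  have hda : DifferentiableAt ℝ
      (fun y => fderiv ℝ η (Complex.exp (a * Complex.I) * y) w) x :=
    (hξ.differentiable (by simp) _).comp x (f := fun y => Complex.exp (a * Complex.I) * y)
      (by fun_prop)
  simp only
  rw [fderiv_const_mul (hda.const_mul _), fderiv_const_mul hda]
  simp only [smul_apply, smul_eq_mul]
  rw [fderiv_mul_left_apply (ξ := fun y => fderiv ℝ η y w) (hξ.differentiable (by simp)),
    fderiv_clm_apply (hη'.differentiable (by simp) _) (differentiableAt_const w)]
  simp [w]

theorem continuous_lap (hη : ContDiff ℝ ∞ η) : Continuous (lap η) :=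
  (((contDiff_fderiv_apply_const (contDiff_fderiv_apply_const hη 1) 1).continuous).add
    ((contDiff_fderiv_apply_const (contDiff_fderiv_apply_const hη Complex.I) Complex.I).continuous))

theorem hasCompactSupport_lap (hc : HasCompactSupport η) : HasCompactSupport (lap η) :=
  (hasCompactSupport_fderiv_apply (hasCompactSupport_fderiv_apply hc 1) 1).add
    (hasCompactSupport_fderiv_apply (hasCompactSupport_fderiv_apply hc Complex.I) Complex.I)

/-- After differentiating under the integral, the Hessian is evaluated on a rotated orthonormal
frame, where its trace is unchanged. -/
theorem lap_rotAvg (n : ℕ) (hη : ContDiff ℝ ∞ η) (x : ℂ) :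
    lap (rotAvg n η) x = rotAvg n (lap η) x := by
  have hη' : ContDiff ℝ ∞ (fderiv ℝ η) := hη.fderiv_right (m := ∞) (by simp)
  have hc2 : Continuous (fderiv ℝ (fderiv ℝ η)) := hη'.continuous_fderiv (by simp)
  have cont : ∀ v : ℂ, Continuous fun a : ℝ => ((2 * Real.pi : ℝ) : ℂ)⁻¹
        * (Complex.exp (n * (a * Complex.I))
        * fderiv ℝ (fderiv ℝ η) (Complex.exp (a * Complex.I) * x) (Complex.exp (a * Complex.I) * v)
          (Complex.exp (a * Complex.I) * v)) := fun v => by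
    have e1 : Continuous fun a : ℝ => Complex.exp (a * Complex.I) := by fun_prop
    exact continuous_const.mul ((by fun_prop : Continuous fun a : ℝ =>
      Complex.exp (n * (a * Complex.I))).mul (((hc2.comp (e1.mul continuous_const)).clm_apply
      (e1.mul continuous_const)).clm_apply (e1.mul continuous_const)))
  rw [lap, fderiv_fderiv_rotAvg n hη, fderiv_fderiv_rotAvg n hη, rotAvg,
    ← intervalIntegral.integral_add ((cont 1).intervalIntegrable _ _)
      ((cont Complex.I).intervalIntegrable _ _)]
  refine intervalIntegral.integral_congr fun a _ => ?_
  rw [lap_eq hη]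
  set B := fderiv ℝ (fderiv ℝ η) (Complex.exp (a * Complex.I) * x)
  -- The mixed terms for `w` and `i w` cancel separately, so symmetry of the Hessian is not needed.
  have hw1 : ∀ w : ℂ, B w w = (w.re * w.re : ℝ) • B 1 1 + (w.re * w.im : ℝ) • B 1 Complex.I
      + (w.im * w.re : ℝ) • B Complex.I 1 + (w.im * w.im : ℝ) • B Complex.I Complex.I := by
    intro w
    rw [fderiv_apply_re_im B w]
    simp only [add_apply, smul_apply]
    rw [fderiv_apply_re_im (B 1) w, fderiv_apply_re_im (B Complex.I) w]
    simp only [smul_add, smul_smul]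
    abel
  have r1 : (Complex.exp (a * Complex.I)).re = Real.cos a := Complex.exp_ofReal_mul_I_re a
  have r2 : (Complex.exp (a * Complex.I)).im = Real.sin a := Complex.exp_ofReal_mul_I_im a
  rw [hw1 (Complex.exp (a * Complex.I) * 1), hw1 (Complex.exp (a * Complex.I) * Complex.I)]
  simp only [mul_one, Complex.mul_re, Complex.mul_im, Complex.I_re, Complex.I_im, mul_zero, r1, r2,
    zero_sub, add_zero, Complex.real_smul]
  have hcs : ((Real.cos a : ℝ) : ℂ) ^ 2 + ((Real.sin a : ℝ) : ℂ) ^ 2 = 1 := by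
    exact_mod_cast Real.cos_sq_add_sin_sq a
  push_cast at hcs ⊢
  linear_combination ((2 * (Real.pi : ℂ))⁻¹ * Complex.exp (n * (a * Complex.I))
    * (B 1 1 + B Complex.I Complex.I)) * hcs

/-- Pairing with an equivariant function only sees the projected test function. -/
theorem integral_rotAvg_mul (hk : LocallyIntegrable k)
    (hrot : ∀ a : ℝ, ∀ᵐ x : ℂ, k (Complex.exp (a * Complex.I) * x)
      = Complex.exp (n * (a * Complex.I)) * k x)
    {ξ : ℂ → ℂ} (hξ : Continuous ξ) (hc : HasCompactSupport ξ) :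
    ∫ x, rotAvg n ξ x * k x = ∫ x, ξ x * k x := by
  obtain ⟨M, hM⟩ := hc.exists_bound_of_continuous hξ
  obtain ⟨R, hR⟩ := hc.isCompact.isBounded.subset_closedBall 0
  have hpi : (0 : ℝ) ≤ 2 * Real.pi := by positivity
  set c := ((2 * Real.pi : ℝ) : ℂ)⁻¹ with hcdef
  let T : ℂ → ℝ → ℂ := fun x a => c * (Complex.exp (n * (a * Complex.I))
    * ξ (Complex.exp (a * Complex.I) * x)) * k x
  have hTc : Continuous fun p : ℂ × ℝ => c * (Complex.exp (n * (p.2 * Complex.I))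
      * ξ (Complex.exp (p.2 * Complex.I) * p.1)) :=
    continuous_const.mul ((contDiff_phase n).continuous.mul
      (hξ.comp (contDiff_exp_mul.continuous.mul continuous_fst)))
  have hint : Integrable (Function.uncurry T)
      (volume.prod (volume.restrict (Ioc 0 (2 * Real.pi)))) := by
    have hdom : Integrable (fun p : ℂ × ℝ => (‖c‖ * M) *
        ((Metric.closedBall (0 : ℂ) R).indicator (fun x => ‖k x‖) p.1 * 1))
        (volume.prod (volume.restrict (Ioc 0 (2 * Real.pi)))) := by
      refine Integrable.const_mul (Integrable.mul_prod ?_ (integrable_const (1 : ℝ))) _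
      exact (integrable_indicator_iff Metric.isClosed_closedBall.measurableSet).2
        ((hk.integrableOn_isCompact (isCompact_closedBall _ _)).norm)
    refine hdom.mono' (hTc.aestronglyMeasurable.mul hk.aestronglyMeasurable.comp_fst)
      (Eventually.of_forall fun p => ?_)
    obtain ⟨x, a⟩ := p
    simp only [Function.uncurry, T]
    have hph : ‖Complex.exp (n * (a * Complex.I))‖ = 1 := by
      rw [show (n : ℂ) * (a * Complex.I) = ((n * a : ℝ) : ℂ) * Complex.I by push_cast; ring,
        Complex.norm_exp_ofReal_mul_I]
    rw [norm_mul, norm_mul, norm_mul, hph, one_mul, mul_one]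
    by_cases hx : x ∈ Metric.closedBall (0 : ℂ) R
    · rw [indicator_of_mem hx]
      exact mul_le_mul_of_nonneg_right (mul_le_mul_of_nonneg_left (hM _) (norm_nonneg _))
        (norm_nonneg _)
    · rw [indicator_of_notMem hx]
      have : ξ (Complex.exp (a * Complex.I) * x) = 0 :=
        image_eq_zero_of_notMem_tsupport fun hm => hx (by
          have := hR hm
          rw [mem_closedBall_zero_iff] at this ⊢
          rwa [norm_exp_I_mul] at this)
      rw [this]; simp
  have h1 : ∀ x, rotAvg n ξ x * k x = ∫ a in Ioc 0 (2 * Real.pi), T x a := fun x => by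
    simp only [T]
    rw [integral_mul_const, rotAvg, intervalIntegral.integral_of_le hpi]
  simp_rw [h1]
  rw [integral_integral_swap hint]
  have h2 : ∀ a : ℝ, ∫ x, T x a = c * ∫ x, ξ x * k x := by
    intro a
    rw [← integral_exp_mul a (fun x => ξ x * k x), ← integral_const_mul]
    refine integral_congr_ae ?_
    filter_upwards [hrot a] with x hx
    simp only [T]
    rw [hx]; ring
  simp_rw [h2]
  rw [setIntegral_const, Real.volume_real_Ioc_of_le hpi, sub_zero, Complex.real_smul, ← mul_assoc,
    hcdef, mul_inv_cancel₀ (by exact_mod_cast (by positivity : (2 * Real.pi) ≠ 0)), one_mul]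

end RotAvg


/-! ### The stationary equation in the plane. -/

section Stationary

variable {n : ℕ} {g : ℝ} {f φ ζ : ℂ → ℂ}

theorem IsRadialDensity.aestronglyMeasurable_effPot {q : ℝ → ℝ} {m : ℤ} (hq : IsRadialDensity m q) :
    AEStronglyMeasurable (effPot m g q) (volume.restrict (Ioi 0)) := by
  have h1 := hq.aestronglyMeasurable_pot
  have m1 : AEStronglyMeasurable (fun r : ℝ => 2 * m / r ^ 2) (volume.restrict (Ioi 0)) :=
    (measurable_const.div (measurable_id.pow_const 2)).aestronglyMeasurable
  have m2 : AEStronglyMeasurable (fun r : ℝ => 1 / r ^ 2) (volume.restrict (Ioi 0)) :=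
    (measurable_const.div (measurable_id.pow_const 2)).aestronglyMeasurable
  exact (((m1.mul h1).add hq.aestronglyMeasurable_potZ).add (m2.mul (h1.pow 2))).sub
    (hq.int.1.const_mul g)

/-- The effective potential is `O(1/r)` near the origin. -/
theorem IsRadialDensity.effPot_bound {q : ℝ → ℝ} {m : ℤ} (hq : IsRadialDensity m q) (R : ℝ) :
    ∃ C : ℝ, ∀ᵐ r ∂volume.restrict (Ioo 0 R), |effPot m g q r * r| ≤ C := by
  obtain ⟨A, hA⟩ := hq.abs_pot_le
  obtain ⟨B, hB⟩ := hq.bound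
  set K := ∫ s in Ioi 0, ‖(m + pot q s) / s * q s‖
  refine ⟨|2 * (m : ℝ)| * A + K * R + A * A * R + |g| * B, ?_⟩
  filter_upwards [ae_restrict_mem measurableSet_Ioo,
    ae_restrict_of_ae_restrict_of_subset (Ioo_subset_Ioi_self : Ioo (0 : ℝ) R ⊆ Ioi 0) hB] with r hr hb
  have hr0 : 0 < r := hr.1
  have e : effPot m g q r * r = 2 * m * (pot q r / r) + potZ m q r * r
      + pot q r / r * (pot q r / r) * r - g * (q r * r) := by
    simp only [effPot]; field_simp
  have a := hA r hr0
  have z := hq.abs_potZ_le hr0.le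
  have hA0 : 0 ≤ A := (abs_nonneg _).trans a
  have hK0 : 0 ≤ K := (abs_nonneg _).trans z
  have t1 : |2 * (m : ℝ) * (pot q r / r)| ≤ |2 * (m : ℝ)| * A := by
    rw [abs_mul]; exact mul_le_mul_of_nonneg_left a (abs_nonneg _)
  have t2 : |potZ m q r * r| ≤ K * R := by
    rw [abs_mul, abs_of_pos hr0]; exact mul_le_mul z hr.2.le hr0.le hK0
  have t3 : |pot q r / r * (pot q r / r) * r| ≤ A * A * R := by
    rw [abs_mul, abs_of_pos hr0, abs_mul]
    exact mul_le_mul (mul_le_mul a a (abs_nonneg _) hA0) hr.2.le hr0.le (mul_nonneg hA0 hA0)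
  have t4 : |g * (q r * r)| ≤ |g| * B := by
    rw [abs_mul, abs_mul (q r), abs_of_pos hr0]
    exact mul_le_mul_of_nonneg_left hb (abs_nonneg _)
  rw [e]
  refine (abs_sub _ _).trans ?_
  refine add_le_add ((abs_add_le _ _).trans (add_le_add ((abs_add_le _ _).trans
    (add_le_add t1 t2)) t3)) t4

/-- The issue is null sets: a null set of radii must pull back to a null set of the plane. Polar
integration of its indicator shows this. -/
theorem aestronglyMeasurable_radial {F : ℝ → ℂ}
    (hF : AEStronglyMeasurable F (volume.restrict (Ioi 0))) :
    AEStronglyMeasurable (fun x : ℂ => F ‖x‖) := by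
  obtain ⟨G, hG, hGe⟩ := hF
  refine ⟨fun x => G ‖x‖, hG.comp_measurable measurable_norm, ?_⟩
  rw [EventuallyEq, ae_restrict_iff' measurableSet_Ioi] at hGe
  obtain ⟨N, hNs, hNm, hN0⟩ := exists_measurable_superset_of_null hGe
  have h0 : ∀ᵐ x : ℂ, (indicator N (fun _ => (1 : ℝ))) ‖x‖ = 0 := by
    have hz : ∀ᵐ r ∂volume.restrict (Ioi (0 : ℝ)), r • indicator N (fun _ => (1 : ℝ)) r = 0 := by
      refine ae_restrict_of_ae ?_
      have : ∀ᵐ r : ℝ, r ∉ N := measure_eq_zero_iff_ae_notMem.1 hN0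
      filter_upwards [this] with r hr
      rw [indicator_of_notMem hr, smul_zero]
    have hi : Integrable fun x : ℂ => (indicator N (fun _ => (1 : ℝ))) ‖x‖ :=
      integrable_radial_iff.2 ((integrable_zero ℝ ℝ _).congr (by
        filter_upwards [hz] with r hr using hr.symm))
    have hint : ∫ x : ℂ, (indicator N (fun _ => (1 : ℝ))) ‖x‖ = 0 := by
      rw [integral_radial, integral_congr_ae hz]; simp
    have := (integral_eq_zero_iff_of_nonneg
      (fun x => indicator_nonneg (fun _ _ => zero_le_one) _) hi).1 hint
    filter_upwards [this] with x hx using hx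
  filter_upwards [h0, ae_ne_zero] with x hx hx0
  by_contra hne
  have : ‖x‖ ∈ N := hNs fun hh => hne (hh (norm_pos_iff.2 hx0))
  rw [indicator_of_mem this] at hx
  exact one_ne_zero hx

/-- Use `|φ| ≤ 1 + |φ|²`. Against the polar weight, `V r` is bounded on bounded intervals of radii,
and `V |φ|² r` is integrable on the half-line. -/
theorem locallyIntegrable_effPot_mul (hφ : MemH1m n φ) :
    LocallyIntegrable fun x : ℂ => (effPot n g (dens φ) ‖x‖ : ℂ) * φ x := by
  have hq := hφ.isRadialDensity
  have hm : AEStronglyMeasurable fun x : ℂ => (effPot n g (dens φ) ‖x‖ : ℂ) * φ x :=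
    (aestronglyMeasurable_radial (F := fun r => (effPot n g (dens φ) r : ℂ))
      (Complex.continuous_ofReal.comp_aestronglyMeasurable hq.aestronglyMeasurable_effPot)).mul
      hφ.2.1.1
  rw [locallyIntegrable_iff]
  intro K hK
  obtain ⟨R, hR⟩ := hK.isBounded.subset_ball 0
  refine IntegrableOn.mono_set ?_ hR
  obtain ⟨C, hC⟩ := hq.effPot_bound (g := g) R
  have h1 : IntegrableOn (fun x : ℂ => (fun r => |effPot n g (dens φ) r| * (1 + dens φ r)) ‖x‖)
      (Metric.ball 0 R) := by
    rw [integrableOn_fun_norm_addHaar (volume : Measure ℂ)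
      (f := fun r => |effPot n g (dens φ) r| * (1 + dens φ r)), Complex.finrank_real_complex]
    have i1 : IntegrableOn (fun r => |effPot n g (dens φ) r * r|) (Ioo 0 R) := by
      refine Integrable.of_bound (C := C) ?_ ?_
      · have := (hq.aestronglyMeasurable_effPot (g := g)).mono_measure
          (Measure.restrict_mono (Ioo_subset_Ioi_self : Ioo (0 : ℝ) R ⊆ Ioi 0) le_rfl)
        exact (this.mul continuous_id.aestronglyMeasurable).norm
      · filter_upwards [hC] with r hr
        rwa [Real.norm_eq_abs, abs_abs]
    have i2 := IntegrableOn.mono_set (Integrable.abs (integrableOn_effPot_mul (g := g) hq hq))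
      (Ioo_subset_Ioi_self : Ioo (0 : ℝ) R ⊆ Ioi 0)
    refine (integrableOn_congr_fun (fun r hr => ?_) measurableSet_Ioo).1 (i1.add i2)
    have hr0 : 0 < r := hr.1
    have hd : 0 ≤ dens φ r := sq_nonneg _
    simp only [Pi.add_apply, smul_eq_mul]
    rw [abs_mul, abs_mul, abs_mul, abs_of_pos hr0, abs_of_nonneg hd]
    ring
  refine h1.mono' hm.restrict (Eventually.of_forall fun x => ?_)
  rw [norm_mul, Complex.norm_real, Real.norm_eq_abs]
  refine mul_le_mul_of_nonneg_left ?_ (abs_nonneg _)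
  simp only [dens]
  rw [← hφ.equiv.norm_apply x]
  nlinarith [sq_nonneg (‖φ x‖ - 1), norm_nonneg (φ x)]

theorem contDiff_conj_comp (hζ : ContDiff ℝ ∞ ζ) : ContDiff ℝ ∞ fun x => conj (ζ x) :=
  Complex.conjCLE.contDiff.comp hζ

theorem fderiv_conj_comp (hζ : Differentiable ℝ ζ) (x v : ℂ) :
    fderiv ℝ (fun x => conj (ζ x)) x v = conj (fderiv ℝ ζ x v) := by
  have := (Complex.conjCLE.hasFDerivAt (x := ζ x)).comp x (hζ x).hasFDerivAt
  exact congrArg (fun L : ℂ →L[ℝ] ℂ => L v) this.fderiv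

/-- Both conjugations together make the form bilinear in `f` and `ζ`; the second derivatives then go
onto the smooth function by integration by parts. -/
theorem conj_dirichletForm_conj (hf : MemH1 f) (hζ : ContDiff ℝ ∞ ζ) (hc : HasCompactSupport ζ) :
    conj (dirichletForm f fun x => conj (ζ x)) = - ∫ x, lap ζ x * f x := by
  have hh : ContDiff ℝ ∞ fun x => conj (ζ x) := contDiff_conj_comp hζ
  have hd := hζ.differentiable (by simp)
  have e1 : conj (dirichletForm f fun x => conj (ζ x))
      = ∫ x, (fderiv ℝ ζ x 1 * weakDeriv 1 f x + fderiv ℝ ζ x Complex.I * weakDeriv Complex.I f x) := by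
    rw [dirichletForm, ← integral_conj]
    refine integral_congr_ae ?_
    filter_upwards [weakDeriv_ae_eq (hasWeakDerivOn_of_contDiff (v := 1) hh),
      weakDeriv_ae_eq (hasWeakDerivOn_of_contDiff (v := Complex.I) hh)] with x h1 h2
    rw [h1, h2, fderiv_conj_comp hd, fderiv_conj_comp hd]
    simp only [map_add, map_mul, Complex.conj_conj]
    ring
  have c : ∀ v, ContDiff ℝ ∞ fun x => fderiv ℝ ζ x v := contDiff_fderiv_apply_const hζ
  have s : ∀ v, HasCompactSupport fun x => fderiv ℝ ζ x v := hasCompactSupport_fderiv_apply hc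
  have i : ∀ v, Integrable fun x => fderiv ℝ (fun y => fderiv ℝ ζ y v) x v * f x := fun v =>
    hf.locallyIntegrable.integrable_mul_of_hasCompactSupport
      (contDiff_fderiv_apply_const (c v) v).continuous (hasCompactSupport_fderiv_apply (s v) v)
  rw [e1, integral_add
    (hf.hasWeakDerivOn_one.right.integrable_mul_of_hasCompactSupport (c 1).continuous (s 1))
    (hf.hasWeakDerivOn_I.right.integrable_mul_of_hasCompactSupport (c Complex.I).continuous
      (s Complex.I))]
  have k1 := hf.hasWeakDerivOn_one.integral_fderiv_mul (c 1) (s 1)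
  have k2 := hf.hasWeakDerivOn_I.integral_fderiv_mul (c Complex.I) (s Complex.I)
  simp only [lap, add_mul]
  rw [integral_add (i 1) (i Complex.I), k1, k2]
  ring

/-- The stationary equation in the sense of distributions on the plane. -/
theorem stationary_equation (hφ : MemH1m n φ) {μ : ℝ}
    (hEL : ∀ h : ℂ → ℂ, MemH1m n h →
      dirichletForm φ h + (∫ x : ℂ, (effPot n g (dens φ) ‖x‖ : ℂ) * (conj (φ x) * h x))
        = μ * ∫ x, conj (φ x) * h x)
    {η : ℂ → ℂ} (hη : ContDiff ℝ ∞ η) (hc : HasCompactSupport η) :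
    ∫ x, lap η x * φ x
      = (∫ x, η x * ((effPot n g (dens φ) ‖x‖ : ℂ) * φ x)) - μ * ∫ x, η x * φ x := by
  set ζ := rotAvg n η with hζdef
  have hζ : ContDiff ℝ ∞ ζ := contDiff_rotAvg n hη
  have hζc : HasCompactSupport ζ := hasCompactSupport_rotAvg hc
  -- The Euler-Lagrange equation admits only equivariant variations. The conjugate of the average is
  -- one, even though `η` is arbitrary.
  have hh : MemH1m n fun x => conj (ζ x) := by
    refine ⟨isEquivariant_of_rotate fun a x => ?_, memH1_of_contDiff (contDiff_conj_comp hζ)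
      (hζc.comp_left (g := conj) (map_zero _))⟩
    rw [hζdef, rotAvg_rotate, map_mul, ← Complex.exp_conj]
    congr 2
    simp
  have key := congrArg conj (hEL _ hh)
  rw [map_add, map_mul, conj_dirichletForm_conj hφ.2 hζ hζc, ← integral_conj, ← integral_conj,
    Complex.conj_ofReal] at key
  simp only [map_mul, Complex.conj_conj, Complex.conj_ofReal] at key
  have rot : ∀ a : ℝ, ∀ᵐ x : ℂ, φ (Complex.exp (a * Complex.I) * x)
      = Complex.exp (n * (a * Complex.I)) * φ x := fun a => by
    filter_upwards [ae_ne_zero] with x hx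
    simpa using hφ.equiv.rotate a hx
  have rotV : ∀ a : ℝ, ∀ᵐ x : ℂ,
      (fun x : ℂ => (effPot n g (dens φ) ‖x‖ : ℂ) * φ x) (Complex.exp (a * Complex.I) * x)
      = Complex.exp (n * (a * Complex.I)) * (fun x : ℂ => (effPot n g (dens φ) ‖x‖ : ℂ) * φ x) x :=
    fun a => by
      filter_upwards [rot a] with x hx
      rw [hx, norm_exp_I_mul]; ring
  have l := hφ.2.locallyIntegrable
  -- Both `φ` and `V φ` are equivariant, so each pairing with the average equals the pairing with
  -- the original test function.
  have b1 := integral_rotAvg_mul l rot (continuous_lap hη) (hasCompactSupport_lap hc)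
  have b2 := integral_rotAvg_mul l rot hη.continuous hc
  have b3 := integral_rotAvg_mul (locallyIntegrable_effPot_mul (g := g) hφ) rotV hη.continuous hc
  simp_rw [← lap_rotAvg n hη] at b1
  rw [← b1, ← b2, ← b3]
  have e1 : ∫ x : ℂ, (effPot n g (dens φ) ‖x‖ : ℂ) * (φ x * ζ x)
      = ∫ x, ζ x * ((effPot n g (dens φ) ‖x‖ : ℂ) * φ x) := by
    congr 1; ext x; ring
  have e2 : ∫ x, φ x * ζ x = ∫ x, ζ x * φ x := by
    congr 1; ext x; ring
  rw [e1, e2] at key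
  linear_combination -key

end Stationary

/-! ### Vanishing of the radial current. -/

section Current

variable {n : ℕ} {g : ℝ} {f F₁ F₂ φ : ℂ → ℂ}

/-- The radial current density `Im (conj φ ∂_r φ)`. -/
noncomputable def current (φ : ℂ → ℂ) (x : ℂ) : ℝ :=
  (conj (φ x) * radialDeriv x (weakDeriv 1 φ x) (weakDeriv Complex.I φ x)).im

theorem integrable_conj_mul_radialDeriv (hφ : MemH1 φ) : Integrable fun x =>
    conj (φ x) * radialDeriv x (weakDeriv 1 φ x) (weakDeriv Complex.I φ x) :=
  integrable_conj_mul hφ.1 (memLp_radialDeriv hφ.memLp_one hφ.memLp_I)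

/-- Invariance under radial gauge transformations annihilates the current. -/
theorem integral_radial_mul_current (hφ : MemH1m n φ) {μ : ℝ}
    (hEL : ∀ h : ℂ → ℂ, MemH1m n h →
      dirichletForm φ h + (∫ x : ℂ, (effPot n g (dens φ) ‖x‖ : ℂ) * (conj (φ x) * h x))
        = μ * ∫ x, conj (φ x) * h x)
    {v : ℝ → ℝ} (hv : ContDiff ℝ ∞ v) (hc : HasCompactSupport v)
    (hv0 : ∀ᶠ r in 𝓝 (0 : ℝ), v r = 0) :
    ∫ x : ℂ, v ‖x‖ * current φ x = 0 := by
  -- The variation `i X φ` is tangent to the gauge orbit `e^{isX} φ`, along which `|φ|²` is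
  -- constant. `X` need not have compact support, but it is bounded with bounded derivative, and it
  -- vanishes near 0, so `X(|x|)` is smooth.
  let X : ℝ → ℝ := fun r => ∫ t in (0 : ℝ)..r, v t
  have hXd : ∀ r, HasDerivAt X (v r) r := fun r =>
    intervalIntegral.integral_hasDerivAt_right (hv.continuous.intervalIntegrable _ _)
      hv.continuous.stronglyMeasurable.stronglyMeasurableAtFilter hv.continuous.continuousAt
  have hXdd : deriv X = v := funext fun r => (hXd r).deriv
  have hX : ContDiff ℝ ∞ X := by
    rw [contDiff_infty_iff_deriv]
    exact ⟨fun r => (hXd r).differentiableAt, hXdd ▸ hv⟩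
  have hX0 : ∀ᶠ r in 𝓝 (0 : ℝ), X r = 0 := by
    obtain ⟨δ, hδ, hball⟩ := Metric.eventually_nhds_iff_ball.1 hv0
    filter_upwards [Metric.ball_mem_nhds (0 : ℝ) hδ] with r hr
    simp only [X]
    refine intervalIntegral.integral_zero_ae (Eventually.of_forall fun t ht => hball t ?_)
    rw [mem_ball_zero_iff, Real.norm_eq_abs] at hr ⊢
    rcases le_total 0 r with h | h
    · rw [uIoc_of_le h] at ht
      rw [abs_of_nonneg h] at hr
      rw [abs_of_pos ht.1]; exact ht.2.trans_lt hr
    · rw [uIoc_of_ge h] at ht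
      rw [abs_of_nonpos h] at hr
      rw [abs_of_nonpos ht.2]; linarith [ht.1]
  obtain ⟨M, hM⟩ := hc.exists_bound_of_continuous hv.continuous
  have hvi : Integrable v := hv.continuous.integrable_of_hasCompactSupport hc
  have hM0 : 0 ≤ M := (norm_nonneg _).trans (hM 0)
  have hXb : ∀ r, |X r| ≤ ∫ t, ‖v t‖ := fun r => by
    refine (intervalIntegral.norm_integral_le_integral_norm_uIoc (f := v) (a := 0) (b := r)
      (μ := volume)).trans ?_
    exact setIntegral_le_integral hvi.norm (Eventually.of_forall fun _ => norm_nonneg _)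
  have hχr := contDiff_comp_norm hX hX0
  have hχ : ContDiff ℝ ∞ fun x : ℂ => (X ‖x‖ : ℂ) := Complex.ofRealCLM.contDiff.comp hχr
  have hlip : LipschitzWith ⟨M, hM0⟩ fun x : ℂ => (X ‖x‖ : ℂ) := by
    have h1 : LipschitzWith ⟨M, hM0⟩ X := lipschitzWith_of_nnnorm_deriv_le
      (fun r => (hXd r).differentiableAt) fun r => by rw [hXdd]; exact hM r
    have h2 := (h1.comp (lipschitzWith_one_norm (E := ℂ))).weaken (mul_one (⟨M, hM0⟩ : NNReal)).le
    exact (Complex.isometry_ofReal.lipschitz.comp h2).weaken (one_mul (⟨M, hM0⟩ : NNReal)).le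
  set C := max M (∫ t, ‖v t‖)
  have hχI : ContDiff ℝ ∞ fun x : ℂ => Complex.I * (X ‖x‖ : ℂ) := contDiff_const.mul hχ
  have hfd : ∀ x w : ℂ, fderiv ℝ (fun x : ℂ => Complex.I * (X ‖x‖ : ℂ)) x w
      = Complex.I * fderiv ℝ (fun x : ℂ => (X ‖x‖ : ℂ)) x w := fun x w => by
    rw [fderiv_const_mul (hχ.differentiable (by simp) x)]; rfl
  have hh : MemH1m n fun x => (Complex.I * (X ‖x‖ : ℂ)) * φ x := by
    refine ⟨hφ.1.mul_radial fun r => Complex.I * (X r : ℂ), hφ.2.mul_contDiff hχI (C := C) ?_ ?_⟩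
    · intro x
      rw [norm_mul, Complex.norm_I, one_mul, Complex.norm_real]
      exact (hXb _).trans (le_max_right _ _)
    · intro x
      refine ContinuousLinearMap.opNorm_le_bound _ (hM0.trans (le_max_left _ _)) fun w => ?_
      rw [hfd, norm_mul, Complex.norm_I, one_mul]
      refine (ContinuousLinearMap.le_opNorm _ _).trans
        (mul_le_mul_of_nonneg_right ?_ (norm_nonneg _))
      exact (norm_fderiv_le_of_lipschitz ℝ hlip).trans (le_max_left _ _)
  have key := congrArg Complex.re (hEL _ hh)
  -- The pairing of `φ` with the variation is purely imaginary, so the potential and charge terms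
  -- drop out of the real part. Only the Dirichlet form remains, and in it only the gradient of `X`.
  have hsq : ∀ x : ℂ, conj (φ x) * ((Complex.I * (X ‖x‖ : ℂ)) * φ x)
      = ((X ‖x‖ * ‖φ x‖ ^ 2 : ℝ) : ℂ) * Complex.I := fun x => by
    have := Complex.conj_mul' (φ x)
    push_cast
    linear_combination (Complex.I * (X ‖x‖ : ℂ)) * this
  have z1 : (∫ x : ℂ, conj (φ x) * ((Complex.I * (X ‖x‖ : ℂ)) * φ x)).re = 0 := by
    simp_rw [hsq]
    rw [integral_mul_const, integral_complex_ofReal]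
    simp
  have z2 : (∫ x : ℂ, (effPot n g (dens φ) ‖x‖ : ℂ)
      * (conj (φ x) * ((Complex.I * (X ‖x‖ : ℂ)) * φ x))).re = 0 := by
    simp_rw [hsq, ← mul_assoc, ← Complex.ofReal_mul]
    rw [integral_mul_const, integral_complex_ofReal]
    simp
  rw [Complex.add_re, z2, Complex.re_ofReal_mul, z1, mul_zero, add_zero] at key
  have w1 := weakDeriv_ae_eq (hφ.2.hasWeakDerivOn_one.mul_contDiff hχI)
  have w2 := weakDeriv_ae_eq (hφ.2.hasWeakDerivOn_I.mul_contDiff hχI)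
  have hi : Integrable fun x => conj (weakDeriv 1 φ x)
        * weakDeriv 1 (fun x => (Complex.I * (X ‖x‖ : ℂ)) * φ x) x
      + conj (weakDeriv Complex.I φ x)
        * weakDeriv Complex.I (fun x => (Complex.I * (X ‖x‖ : ℂ)) * φ x) x :=
    integrable_fun_add (integrable_conj_mul hφ.2.memLp_one hh.2.memLp_one)
      (integrable_conj_mul hφ.2.memLp_I hh.2.memLp_I)
  rw [dirichletForm, show (∫ x, (conj (weakDeriv 1 φ x)
        * weakDeriv 1 (fun x => (Complex.I * (X ‖x‖ : ℂ)) * φ x) x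
      + conj (weakDeriv Complex.I φ x)
        * weakDeriv Complex.I (fun x => (Complex.I * (X ‖x‖ : ℂ)) * φ x) x)).re
      = ∫ x, (conj (weakDeriv 1 φ x)
        * weakDeriv 1 (fun x => (Complex.I * (X ‖x‖ : ℂ)) * φ x) x
      + conj (weakDeriv Complex.I φ x)
        * weakDeriv Complex.I (fun x => (Complex.I * (X ‖x‖ : ℂ)) * φ x) x).re
      from (integral_re hi).symm] at key
  rw [← key]
  refine integral_congr_ae ?_
  filter_upwards [w1, w2, ae_ne_zero] with x h1 h2 hx
  rw [h1, h2, hfd, hfd]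
  have hgrad : ∀ w : ℂ, fderiv ℝ (fun x : ℂ => (X ‖x‖ : ℂ)) x w
      = ((v ‖x‖ * ((x.re * w.re + x.im * w.im) / ‖x‖) : ℝ) : ℂ) := fun w => by
    rw [fderiv_ofReal_apply (hχr.differentiable (by simp)),
      fderiv_comp_norm (hX.differentiable (by simp)) hx, hXdd, fderiv_norm_apply hx]
  rw [hgrad, hgrad]
  have hx' : ‖x‖ ≠ 0 := norm_ne_zero_iff.2 hx
  simp only [current, radialDeriv, Complex.one_re, Complex.one_im, Complex.I_re, Complex.I_im,
    mul_one, mul_zero, add_zero, zero_add]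
  generalize weakDeriv 1 φ x = a
  generalize weakDeriv Complex.I φ x = b
  generalize φ x = p
  generalize X ‖x‖ = y
  generalize v ‖x‖ = w
  rw [div_eq_mul_inv, ← Complex.ofReal_inv]
  simp only [Complex.add_re, Complex.mul_re, Complex.mul_im, Complex.add_im, Complex.conj_re,
    Complex.conj_im, Complex.ofReal_re, Complex.ofReal_im, Complex.I_re, Complex.I_im]
  field_simp
  ring

theorem HasWeakDerivOn.congr_left {v : ℂ} {f' F : ℂ → ℂ} (h : HasWeakDerivOn univ v f F)
    (he : f =ᵐ[volume] f') : HasWeakDerivOn univ v f' F := by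
  refine ⟨locallyIntegrableOn_univ.2 fun x => ?_, h.2.1, fun η hη hc hs => ?_⟩
  · obtain ⟨s, hs, hi⟩ := h.left x
    exact ⟨s, hs, hi.congr (ae_restrict_of_ae he)⟩
  · rw [← h.2.2 η hη hc hs]
    refine integral_congr_ae ?_
    filter_upwards [he] with x hx
    rw [hx]

/-- The chain rule for a rotation, obtained by carrying the rotation over to the test function with
a measure-preserving change of variables. -/
theorem HasWeakDerivOn.comp_rotate (h₁ : HasWeakDerivOn univ 1 f F₁)
    (h₂ : HasWeakDerivOn univ Complex.I f F₂) (a : ℝ) (v : ℂ) :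
    HasWeakDerivOn univ v (fun x => f (Complex.exp (a * Complex.I) * x))
      (fun x => ((Complex.exp (a * Complex.I) * v).re : ℂ) * F₁ (Complex.exp (a * Complex.I) * x)
        + ((Complex.exp (a * Complex.I) * v).im : ℂ) * F₂ (Complex.exp (a * Complex.I) * x)) := by
  set e := Complex.exp (a * Complex.I) with he
  have he0 : e ≠ 0 := Complex.exp_ne_zero _
  have hloc : ∀ {k : ℂ → ℂ}, LocallyIntegrable k → LocallyIntegrable fun x => k (e * x) := by
    intro k hk
    rw [locallyIntegrable_iff]
    intro K hK
    have hK' : IsCompact ((fun x => e * x) '' K) := hK.image (by fun_prop)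
    have h1 := hk.integrableOn_isCompact hK'
    have h2 := ((measurePreserving_exp_mul a).integrableOn_comp_preimage
      (Homeomorph.mulLeft₀ e he0).measurableEmbedding).2 h1
    exact h2.mono_set (subset_preimage_image _ _)
  refine hasWeakDerivOn_of_complex (hloc h₁.left)
    (((hloc h₁.right).continuous_mul continuous_const).add
      ((hloc h₂.right).continuous_mul continuous_const)) fun η hη hc => ?_
  have hinv : e⁻¹ = Complex.exp ((-a : ℝ) * Complex.I) := by
    rw [he, ← Complex.exp_neg]; congr 1; push_cast; ring
  let η' : ℂ → ℂ := fun y => η (e⁻¹ * y)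
  have hη' : ContDiff ℝ ∞ η' := hη.comp (contDiff_const.mul contDiff_id)
  have hc' : HasCompactSupport η' :=
    hc.comp_homeomorph (Homeomorph.mulLeft₀ e⁻¹ (inv_ne_zero he0))
  have hfd : ∀ x, fderiv ℝ η' (e * x) (e * v) = fderiv ℝ η x v := fun x => by
    simp only [η']
    rw [fderiv_mul_left_apply (hη.differentiable (by simp)), inv_mul_cancel_left₀ he0,
      inv_mul_cancel_left₀ he0]
  have c1 : ∫ x, fderiv ℝ η x v * f (e * x) = ∫ y, fderiv ℝ η' y (e * v) * f y := by
    rw [← integral_exp_mul a fun y => fderiv ℝ η' y (e * v) * f y]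
    congr 1; ext x
    rw [← he, hfd]
  have c2 : ∫ x, η x * (((e * v).re : ℂ) * F₁ (e * x) + ((e * v).im : ℂ) * F₂ (e * x))
      = ∫ y, η' y * (((e * v).re : ℂ) * F₁ y + ((e * v).im : ℂ) * F₂ y) := by
    rw [← integral_exp_mul a fun y => η' y * (((e * v).re : ℂ) * F₁ y + ((e * v).im : ℂ) * F₂ y)]
    congr 1; ext x
    simp only [η', ← he, inv_mul_cancel_left₀ he0]
  rw [c1, c2]
  have k1 := h₁.integral_fderiv_mul hη' hc'
  have k2 := h₂.integral_fderiv_mul hη' hc'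
  have cd := fun w => (contDiff_fderiv_apply_const hη' w).continuous
  have cs := fun w => hasCompactSupport_fderiv_apply hc' w
  have i1 := (h₁.left.integrable_mul_of_hasCompactSupport (cd 1) (cs 1)).const_mul ((e * v).re : ℂ)
  have i2 := (h₁.left.integrable_mul_of_hasCompactSupport (cd Complex.I) (cs Complex.I)).const_mul
    ((e * v).im : ℂ)
  have i3 := (h₁.right.integrable_mul_of_hasCompactSupport hη'.continuous hc').const_mul
    ((e * v).re : ℂ)
  have i4 := (h₂.right.integrable_mul_of_hasCompactSupport hη'.continuous hc').const_mul
    ((e * v).im : ℂ)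
  have e1 : ∀ y, fderiv ℝ η' y (e * v) * f y = ((e * v).re : ℂ) * (fderiv ℝ η' y 1 * f y)
      + ((e * v).im : ℂ) * (fderiv ℝ η' y Complex.I * f y) := fun y => by
    rw [fderiv_apply_re_im (fderiv ℝ η' y) (e * v)]
    simp only [Complex.real_smul]; ring
  have e2 : ∀ y, η' y * (((e * v).re : ℂ) * F₁ y + ((e * v).im : ℂ) * F₂ y)
      = ((e * v).re : ℂ) * (η' y * F₁ y) + ((e * v).im : ℂ) * (η' y * F₂ y) := fun y => by ring
  simp_rw [e1, e2]
  rw [integral_add i1 i2, integral_add i3 i4, integral_const_mul, integral_const_mul,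
    integral_const_mul, integral_const_mul, k1, k2]
  ring

/-- The radial derivative of an equivariant function is equivariant. -/
theorem radialDeriv_rotate (hf : IsEquivariant n f) (h₁ : HasWeakDerivOn univ 1 f F₁)
    (h₂ : HasWeakDerivOn univ Complex.I f F₂) (a : ℝ) : ∀ᵐ x : ℂ,
    radialDeriv (Complex.exp (a * Complex.I) * x) (F₁ (Complex.exp (a * Complex.I) * x))
      (F₂ (Complex.exp (a * Complex.I) * x))
      = Complex.exp (n * (a * Complex.I)) * radialDeriv x (F₁ x) (F₂ x) := by
  have he : (fun x => Complex.exp (n * (a * Complex.I)) * f x)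
      =ᵐ[volume] fun x => f (Complex.exp (a * Complex.I) * x) := by
    filter_upwards [ae_ne_zero] with x hx
    simpa using (hf.rotate a hx).symm
  -- The rotated function is a phase times `f`, so its weak gradient can be computed in two ways;
  -- uniqueness equates them.
  have u1 := ((h₁.const_mul (Complex.exp (n * (a * Complex.I)))).congr_left he).ae_unique
    (h₁.comp_rotate h₂ a 1)
  have u2 := ((h₂.const_mul (Complex.exp (n * (a * Complex.I)))).congr_left he).ae_unique
    (h₁.comp_rotate h₂ a Complex.I)
  filter_upwards [u1, u2] with x e1 e2
  simp only [radialDeriv, norm_exp_I_mul]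
  rw [← mul_div_assoc]
  congr 1
  simp only [mul_one, Complex.mul_re, Complex.mul_im, Complex.I_re, Complex.I_im, mul_zero,
    zero_sub, add_zero] at e1 e2 ⊢
  push_cast at e1 e2 ⊢
  linear_combination (-(x.re : ℂ)) * e1 - (x.im : ℂ) * e2

/-- The current of a stationary state vanishes. -/
theorem current_ae_zero (hφ : MemH1m n φ) {μ : ℝ}
    (hEL : ∀ h : ℂ → ℂ, MemH1m n h →
      dirichletForm φ h + (∫ x : ℂ, (effPot n g (dens φ) ‖x‖ : ℂ) * (conj (φ x) * h x))
        = μ * ∫ x, conj (φ x) * h x) :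
    ∀ᵐ x : ℂ, current φ x = 0 := by
  have hJi : Integrable (current φ) := (integrable_conj_mul_radialDeriv hφ.2).im
  have hJl : LocallyIntegrable fun x => (current φ x : ℂ) := hJi.ofReal.locallyIntegrable
  have hrot : ∀ a : ℝ, ∀ᵐ x : ℂ, (fun x => (current φ x : ℂ)) (Complex.exp (a * Complex.I) * x)
      = Complex.exp ((0 : ℕ) * (a * Complex.I)) * (fun x => (current φ x : ℂ)) x := fun a => by
    filter_upwards [ae_ne_zero, radialDeriv_rotate hφ.equiv hφ.2.hasWeakDerivOn_one
      hφ.2.hasWeakDerivOn_I a] with x hx hr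
    simp only [Nat.cast_zero, zero_mul, Complex.exp_zero, one_mul, current]
    rw [hr, hφ.equiv.rotate a hx]
    have h1 : conj (Complex.exp (n * (a * Complex.I))) * Complex.exp (n * (a * Complex.I)) = 1 := by
      rw [← Complex.normSq_eq_conj_mul_self, Complex.normSq_eq_norm_sq,
        show (n : ℂ) * (a * Complex.I) = ((n * a : ℝ) : ℂ) * Complex.I by push_cast; ring,
        Complex.norm_exp_ofReal_mul_I]
      simp
    congr 2
    simp only [Int.cast_natCast, map_mul]
    linear_combination (conj (φ x) * radialDeriv x (weakDeriv 1 φ x) (weakDeriv Complex.I φ x)) * h1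
  -- Testing away from the origin ensures that the averaged test function vanishes near 0, as the
  -- gauge argument requires; the origin is a null set. The current is rotation invariant, so
  -- averaging with `n = 0` replaces any test function by a radial one.
  have key := (isOpen_compl_singleton (x := (0 : ℂ))).ae_eq_zero_of_integral_contDiff_smul_eq_zero
    (μ := volume) (f := current φ) (hJi.locallyIntegrable.locallyIntegrableOn _) fun ηr hηr hcr hsr => by
      let η : ℂ → ℂ := fun x => (ηr x : ℂ)
      have hη : ContDiff ℝ ∞ η := Complex.ofRealCLM.contDiff.comp hηr
      have hc : HasCompactSupport η := hcr.comp_left (g := fun t : ℝ => (t : ℂ)) rfl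
      have avg := integral_rotAvg_mul (n := 0) hJl hrot hη.continuous hc
      let v : ℝ → ℝ := fun r => (rotAvg 0 η (r : ℂ)).re
      have hv : ContDiff ℝ ∞ v :=
        Complex.reCLM.contDiff.comp ((contDiff_rotAvg 0 hη).comp Complex.ofRealCLM.contDiff)
      have hvc : HasCompactSupport v := by
        have := (hasCompactSupport_rotAvg (n := 0) hc).comp_isClosedEmbedding
          Complex.isometry_ofReal.isClosedEmbedding
        exact this.comp_left (g := Complex.re) rfl
      have hv0 : ∀ᶠ r in 𝓝 (0 : ℝ), v r = 0 := by
        have h0 : (0 : ℂ) ∉ tsupport ηr := fun h => hsr h rfl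
        obtain ⟨δ, hδ, hball⟩ := Metric.eventually_nhds_iff_ball.1
          (notMem_tsupport_iff_eventuallyEq.1 h0)
        filter_upwards [Metric.ball_mem_nhds (0 : ℝ) hδ] with r hr
        simp only [v]
        rw [rotAvg_eq_zero fun y hy => ?_]
        · rfl
        · have : ηr y = 0 := hball y (by
            rw [mem_ball_zero_iff, hy, Complex.norm_real]
            rwa [mem_ball_zero_iff] at hr)
          simp [η, this]
      have h1 := integral_radial_mul_current hφ hEL hv hvc hv0
      have hrad : ∀ x : ℂ, rotAvg 0 η x = rotAvg 0 η (‖x‖ : ℂ) := fun x => by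
        conv_lhs => rw [← Complex.norm_mul_exp_arg_mul_I x, mul_comm, rotAvg_rotate]
        simp
      have i2 : Integrable fun x => rotAvg 0 η x * (current φ x : ℂ) :=
        hJl.integrable_mul_of_hasCompactSupport (contDiff_rotAvg 0 hη).continuous
          (hasCompactSupport_rotAvg hc)
      have h2 : (∫ x, rotAvg 0 η x * (current φ x : ℂ)).re = 0 := by
        have a1 : (∫ x, rotAvg 0 η x * (current φ x : ℂ)).re
            = ∫ x, (rotAvg 0 η x * (current φ x : ℂ)).re := (integral_re i2).symm
        rw [a1, ← h1]
        congr 1; ext x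
        rw [Complex.re_mul_ofReal, hrad]
      rw [avg] at h2
      have i3 : ∀ x, η x * (current φ x : ℂ) = ((ηr x * current φ x : ℝ) : ℂ) := fun x => by
        simp [η]
      simp_rw [i3] at h2
      rw [integral_complex_ofReal] at h2
      simpa using h2
  filter_upwards [key, ae_ne_zero] with x hx hx0 using hx hx0

end Current


/-! ### Weak derivatives of products of functions of time and space. -/

section Product

theorem integrable_smul_of_tsupport_subset {X V : Type*} [TopologicalSpace X] [T2Space X]
    [TopologicalSpace.PseudoMetrizableSpace X] [MeasurableSpace X] [BorelSpace X] [NormedAddCommGroup V]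
    [NormedSpace ℝ V] {μ : Measure X} {s : Set X} {f : X → V} {η : X → ℝ}
    (hf : LocallyIntegrableOn f s μ)
    (hη : Continuous η) (hc : HasCompactSupport η) (hs : tsupport η ⊆ s) :
    Integrable (fun x => η x • f x) μ := by
  have h1 : IntegrableOn f (tsupport η) μ := hf.integrableOn_compact_subset hs hc
  have h2 := h1.continuousOn_smul hη.continuousOn hc
  refine (integrableOn_iff_integrable_of_support_subset ?_).1 h2
  exact (Function.support_smul_subset_left _ _).trans (subset_tsupport η)

theorem _root_.MeasureTheory.LocallyIntegrableOn.prod_mul {E : Type*} [TopologicalSpace E]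
    [MeasureSpace E] [SFinite (volume : Measure E)] {L : Type*} [RCLike L] {s : Set E} {c : ℝ → L} {k : E → L}
    (hc : Continuous c) (hk : LocallyIntegrableOn k s) :
    LocallyIntegrableOn (fun p : ℝ × E => c p.1 * k p.2) (univ ×ˢ s) := by
  rintro ⟨t, x⟩ ⟨-, hx⟩
  obtain ⟨u, hu, hi⟩ := hk x hx
  refine ⟨Icc (t - 1) (t + 1) ×ˢ u, ?_, ?_⟩
  · rw [nhdsWithin_prod_eq, nhdsWithin_univ]
    exact prod_mem_prod (Icc_mem_nhds (by linarith) (by linarith)) hu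
  · have h1 : IntegrableOn c (Icc (t - 1) (t + 1)) := hc.continuousOn.integrableOn_Icc
    rw [IntegrableOn, Measure.volume_eq_prod, ← Measure.prod_restrict]
    exact Integrable.mul_prod h1 hi

theorem HasWeakDerivOn.congr_right {E V : Type*} [NormedAddCommGroup E] [NormedSpace ℝ E]
    [MeasureSpace E] [NormedAddCommGroup V] [NormedSpace ℝ V] {v : E}
    {f F F' : E → V} (h : HasWeakDerivOn univ v f F) (he : F =ᵐ[volume] F') :
    HasWeakDerivOn univ v f F' := by
  refine ⟨h.1, fun x hx => ?_, fun η hη hc hs => ?_⟩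
  · obtain ⟨s, hs, hi⟩ := h.2.1 x hx
    exact ⟨s, hs, hi.congr (ae_restrict_of_ae he)⟩
  · rw [h.2.2 η hη hc hs]
    congr 1
    refine integral_congr_ae ?_
    filter_upwards [he] with x hx
    rw [hx]

section Slice

variable {E : Type*} [NormedAddCommGroup E]

variable {η : ℝ × E → ℝ}

theorem hasCompactSupport_slice_right (hc : HasCompactSupport η) (t : ℝ) :
    HasCompactSupport fun x => η (t, x) :=
  HasCompactSupport.intro (hc.isCompact.image continuous_snd) fun _ hx =>
    image_eq_zero_of_notMem_tsupport fun h => hx ⟨_, h, rfl⟩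

theorem hasCompactSupport_slice_left (hc : HasCompactSupport η) (x : E) :
    HasCompactSupport fun t => η (t, x) :=
  HasCompactSupport.intro (hc.isCompact.image continuous_fst) fun _ ht =>
    image_eq_zero_of_notMem_tsupport fun h => ht ⟨_, h, rfl⟩

theorem tsupport_slice_right_subset {s : Set E} (hs : tsupport η ⊆ univ ×ˢ s) (t : ℝ) :
    tsupport (fun x => η (t, x)) ⊆ s := fun _ hx =>
  (hs (tsupport_comp_subset_preimage η (f := fun x => (t, x)) (by fun_prop) hx)).2

variable [NormedSpace ℝ E]

theorem contDiff_slice_right (hη : ContDiff ℝ ∞ η) (t : ℝ) : ContDiff ℝ ∞ fun x => η (t, x) :=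
  hη.comp (contDiff_const.prodMk contDiff_id)

theorem contDiff_slice_left (hη : ContDiff ℝ ∞ η) (x : E) : ContDiff ℝ ∞ fun t => η (t, x) :=
  hη.comp (contDiff_id.prodMk contDiff_const)

theorem fderiv_slice_right (hη : Differentiable ℝ η) (t : ℝ) (x v : E) :
    fderiv ℝ (fun x => η (t, x)) x v = fderiv ℝ η (t, x) (0, v) := by
  have := (hη (t, x)).hasFDerivAt.comp x (hasFDerivAt_prodMk_right (𝕜 := ℝ) t x)
  exact congrArg (fun A : E →L[ℝ] ℝ => A v) this.fderiv

theorem hasDerivAt_slice_left (hη : Differentiable ℝ η) (t : ℝ) (x : E) :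
    HasDerivAt (fun t => η (t, x)) (fderiv ℝ η (t, x) (1, 0)) t := by
  have := (hη (t, x)).hasFDerivAt.comp t (hasFDerivAt_prodMk_left (𝕜 := ℝ) t x)
  exact this.hasDerivAt.congr_deriv (by simp)

end Slice

variable {E : Type*} [NormedAddCommGroup E] [NormedSpace ℝ E] [MeasureSpace E] [BorelSpace E]
  [SecondCountableTopology E] [SFinite (volume : Measure E)] {L : Type*} [RCLike L]

/-- A time-dependent factor does not affect spatial weak derivatives. -/
theorem HasWeakDerivOn.prod_mul {s : Set E} {v : E} {k K : E → L} (h : HasWeakDerivOn s v k K)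
    {c : ℝ → L} (hc : Continuous c) :
    HasWeakDerivOn (univ ×ˢ s) ((0 : ℝ), v) (fun p : ℝ × E => c p.1 * k p.2)
      (fun p => c p.1 * K p.2) := by
  refine ⟨h.1.prod_mul hc, h.2.1.prod_mul hc, fun η hη hηc hηs => ?_⟩
  have hd := contDiff_fderiv_apply_const hη ((0 : ℝ), v)
  have i1 := integrable_smul_of_tsupport_subset (h.1.prod_mul hc) hd.continuous
    (hasCompactSupport_fderiv_apply hηc _) ((tsupport_fderiv_apply_subset ℝ _).trans hηs)
  have i2 := integrable_smul_of_tsupport_subset (h.2.1.prod_mul hc) hη.continuous hηc hηs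
  rw [Measure.volume_eq_prod] at i1 i2 ⊢
  rw [integral_prod _ i1, integral_prod _ i2, ← integral_neg]
  congr 1
  ext t
  have key := h.2.2 _ (contDiff_slice_right hη t) (hasCompactSupport_slice_right hηc t)
    (tsupport_slice_right_subset hηs t)
  simp_rw [fderiv_slice_right (hη.differentiable (by simp))] at key
  simp only [← mul_smul_comm]
  rw [integral_const_mul, integral_const_mul, key, mul_neg]

/-- The weak time derivative of a product. -/
theorem hasWeakDerivOn_time {k : E → L} (hk : LocallyIntegrable k) {c c' : ℝ → L}
    (hc : ∀ t, HasDerivAt c (c' t) t) (hc' : Continuous c') :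
    HasWeakDerivOn univ ((1 : ℝ), (0 : E)) (fun p : ℝ × E => c p.1 * k p.2)
      (fun p => c' p.1 * k p.2) := by
  have hcc : Continuous c := continuous_iff_continuousAt.2 fun t => (hc t).continuousAt
  have l1 := (locallyIntegrableOn_univ.2 hk).prod_mul hcc
  have l2 := (locallyIntegrableOn_univ.2 hk).prod_mul hc'
  rw [univ_prod_univ] at l1 l2
  refine ⟨l1, l2, fun η hη hηc hηs => ?_⟩
  have hd := contDiff_fderiv_apply_const hη ((1 : ℝ), (0 : E))
  have i1 := integrable_smul_of_tsupport_subset l1 hd.continuous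
    (hasCompactSupport_fderiv_apply hηc _) (subset_univ _)
  have i2 := integrable_smul_of_tsupport_subset l2 hη.continuous hηc hηs
  rw [Measure.volume_eq_prod] at i1 i2 ⊢
  rw [integral_prod_symm _ i1, integral_prod_symm _ i2, ← integral_neg]
  congr 1
  ext x
  have hη1 := fun t => hasDerivAt_slice_left (hη.differentiable (by simp)) t x
  have cη : Continuous fun t => η (t, x) := (contDiff_slice_left hη x).continuous
  have cη' : Continuous fun t => fderiv ℝ η (t, x) (1, 0) :=
    hd.continuous.comp (continuous_id.prodMk continuous_const)
  have sη := hasCompactSupport_slice_left hηc x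
  have sη' : HasCompactSupport fun t => fderiv ℝ η (t, x) (1, 0) :=
    hasCompactSupport_slice_left (hasCompactSupport_fderiv_apply hηc ((1 : ℝ), (0 : E))) x
  have j1 : Integrable fun t => fderiv ℝ η (t, x) (1, 0) • c t :=
    (cη'.smul hcc).integrable_of_hasCompactSupport sη'.smul_right
  have j2 : Integrable fun t => η (t, x) • c' t :=
    (cη.smul hc').integrable_of_hasCompactSupport sη.smul_right
  have j0 : Integrable fun t => η (t, x) • c t :=
    (cη.smul hcc).integrable_of_hasCompactSupport sη.smul_right
  have key := integral_eq_zero_of_hasDerivAt_of_integrable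
    (fun t => (hη1 t).smul (hc t)) (j2.add j1) j0
  rw [integral_add j2 j1] at key
  simp only [← smul_mul_assoc]
  rw [integral_mul_const, integral_mul_const, eq_neg_of_add_eq_zero_right key, neg_mul]

theorem IsPrimitive.hasWeakDerivOn {U w : ℝ → ℝ} (h : IsPrimitive U w) :
    HasWeakDerivOn (Ioi 0) (1 : ℝ) U w := by
  refine ⟨h.locallyIntegrableOn, h.locInt, fun η hη hc hs => ?_⟩
  simpa using h.integral_deriv_mul (hη.of_le (by simp)) hc hs

theorem IsPrimitive.hasWeakDerivOn_prod {U w : ℝ → ℝ} (h : IsPrimitive U w) :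
    HasWeakDerivOn {q : ℝ × ℝ | 0 < q.2} (0, 1) (fun q => U q.2) (fun q => w q.2) := by
  have hs : {q : ℝ × ℝ | 0 < q.2} = univ ×ˢ Ioi 0 := by ext; simp
  simpa [hs] using h.hasWeakDerivOn.prod_mul (c := fun _ => 1) continuous_const

end Product

/-! ### The spatial Laplacian of space-time test functions. -/

section Evolution

variable {n : ℕ} {g : ℝ} {φ : ℂ → ℂ}

/-- Expressed through joint derivatives, the spatial Laplacian is visibly continuous and compactly
supported in space-time. -/
theorem laplacian_slice {η : ℝ × ℂ → ℝ} (hη : ContDiff ℝ ∞ η) (t : ℝ) (x : ℂ) :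
    Laplacian.laplacian (fun x : ℂ => η (t, x)) x
      = fderiv ℝ (fun q => fderiv ℝ η q (0, 1)) (t, x) (0, 1)
        + fderiv ℝ (fun q => fderiv ℝ η q (0, Complex.I)) (t, x) (0, Complex.I) := by
  have hs := contDiff_slice_right hη t
  have hd : DifferentiableAt ℝ (fderiv ℝ fun x => η (t, x)) x :=
    (hs.fderiv_right (m := ∞) (by simp)).differentiable (by simp) x
  have e : ∀ v : ℂ, fderiv ℝ (fderiv ℝ fun x => η (t, x)) x v v
      = fderiv ℝ (fun q => fderiv ℝ η q (0, v)) (t, x) (0, v) := fun v => by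
    rw [← fderiv_slice_right ((contDiff_fderiv_apply_const hη _).differentiable (by simp))]
    simp_rw [← fderiv_slice_right (hη.differentiable (by simp))]
    rw [fderiv_clm_apply hd (differentiableAt_const v)]
    simp
  rw [InnerProductSpace.laplacian_eq_iteratedFDeriv_complexPlane]
  simp only [iteratedFDeriv_two_apply]
  simp [e]

theorem lap_slice {η : ℝ × ℂ → ℝ} (hη : ContDiff ℝ ∞ η) (t : ℝ) (x : ℂ) :
    lap (fun x : ℂ => (η (t, x) : ℂ)) x
      = ((Laplacian.laplacian (fun x : ℂ => η (t, x)) x : ℝ) : ℂ) := by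
  rw [laplacian_slice hη, lap]
  have hd := contDiff_slice_right hη t
  simp_rw [fderiv_ofReal_apply (hd.differentiable (by simp)),
    fderiv_slice_right (hη.differentiable (by simp))]
  have hd2 : ∀ v : ℂ, Differentiable ℝ fun y => fderiv ℝ η (t, y) (0, v) := fun v =>
    (contDiff_slice_right (contDiff_fderiv_apply_const hη _) t).differentiable (by simp)
  rw [fderiv_ofReal_apply (hd2 _), fderiv_ofReal_apply (hd2 _),
    fderiv_slice_right (η := fun q => fderiv ℝ η q (0, 1))
      ((contDiff_fderiv_apply_const hη _).differentiable (by simp)),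
    fderiv_slice_right (η := fun q => fderiv ℝ η q (0, Complex.I))
      ((contDiff_fderiv_apply_const hη _).differentiable (by simp))]
  push_cast
  rfl

end Evolution


/-! ### The standing wave solves the system. -/

section StandingWave

variable {n : ℕ} {g : ℝ} {φ : ℂ → ℂ}

theorem norm_exp_I_mul_mul (lam t : ℝ) : ‖Complex.exp (Complex.I * lam * t)‖ = 1 := by
  rw [show Complex.I * lam * t = ((lam * t : ℝ) : ℂ) * Complex.I by push_cast; ring,
    Complex.norm_exp_ofReal_mul_I]

theorem continuous_exp_I_mul (lam : ℝ) : Continuous fun t : ℝ => Complex.exp (Complex.I * lam * t) := by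
  fun_prop

theorem hasDerivAt_exp_I_mul (lam t : ℝ) :
    HasDerivAt (fun t : ℝ => Complex.exp (Complex.I * lam * t))
      (Complex.I * lam * Complex.exp (Complex.I * lam * t)) t := by
  have h := ((Complex.ofRealCLM.hasDerivAt (x := t)).const_mul (Complex.I * (lam : ℂ))).cexp
  simpa [mul_comm] using h

theorem h1NormSq_const_mul (hφ : MemH1 φ) {c : ℂ} (hc : ‖c‖ = 1) :
    h1NormSq (fun x => c * φ x) = h1NormSq φ := by
  refine integral_congr_ae ?_
  filter_upwards [weakDeriv_const_mul hφ.hasWeakDerivOn_one c,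
    weakDeriv_const_mul hφ.hasWeakDerivOn_I c] with x h1 h2
  rw [h1, h2]
  simp only [norm_mul, hc, one_mul]

/-- The coefficient depends on the wave only through its modulus, so a unimodular phase factors out.
-/
theorem nonlinearity_eq (hφ : MemH1m n φ) {c : ℂ} (hc : ‖c‖ = 1) (x : ℂ) :
    nonlinearity n g ‖x‖ (potTheta φ ‖x‖) (potZero n φ ‖x‖) (c * φ x)
      = c * ((effPot n g (dens φ) ‖x‖ : ℂ) * φ x) := by
  have hd : ‖c * φ x‖ ^ 2 = dens φ ‖x‖ := by
    rw [norm_mul, hc, one_mul, hφ.equiv.norm_apply x, dens]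
  rw [nonlinearity, hd]
  rw [show (2 * ((n : ℤ) : ℝ) / ‖x‖ ^ 2 * potTheta φ ‖x‖ + potZero n φ ‖x‖
    + 1 / ‖x‖ ^ 2 * potTheta φ ‖x‖ ^ 2 - g * dens φ ‖x‖) = effPot n g (dens φ) ‖x‖ from rfl]
  ring

theorem locallyIntegrable_phase_mul {k : ℂ → ℂ} (hk : LocallyIntegrable k) (lam : ℝ) :
    LocallyIntegrable fun p : ℝ × ℂ => Complex.exp (Complex.I * lam * p.1) * k p.2 := by
  have := (locallyIntegrableOn_univ.2 hk).prod_mul (continuous_exp_I_mul lam)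
  rwa [univ_prod_univ, locallyIntegrableOn_univ] at this

/-- The time derivative of the phase contributes `μ ψ`, while the stationary equation makes the
Laplacian contribute `V ψ - μ ψ`; the multiplier cancels. -/
theorem evolution_equation (hφ : MemH1m n φ) {μ : ℝ}
    (hEL : ∀ h : ℂ → ℂ, MemH1m n h →
      dirichletForm φ h + (∫ x : ℂ, (effPot n g (dens φ) ‖x‖ : ℂ) * (conj (φ x) * h x))
        = μ * ∫ x, conj (φ x) * h x)
    {η : ℝ × ℂ → ℝ} (hη : ContDiff ℝ ∞ η) (hc : HasCompactSupport η) :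
    ∫ p : ℝ × ℂ, (-Complex.I * ((fderiv ℝ η p (1, 0) : ℝ) : ℂ)
        + ((Laplacian.laplacian (fun x : ℂ => η (p.1, x)) p.2 : ℝ) : ℂ))
          * (Complex.exp (Complex.I * (-μ : ℝ) * p.1) * φ p.2)
      = ∫ p : ℝ × ℂ, (η p : ℂ) * (Complex.exp (Complex.I * (-μ : ℝ) * p.1)
          * ((effPot n g (dens φ) ‖p.2‖ : ℂ) * φ p.2)) := by
  have l := hφ.2.locallyIntegrable
  have lψ := locallyIntegrable_phase_mul l (-μ)
  have lN := locallyIntegrable_phase_mul (locallyIntegrable_effPot_mul (g := g) hφ) (-μ)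
  have hcd : ∀ v, ContDiff ℝ ∞ fun p => fderiv ℝ η p v := contDiff_fderiv_apply_const hη
  have hcs : ∀ v, HasCompactSupport fun p => fderiv ℝ η p v := hasCompactSupport_fderiv_apply hc
  have time := (hasWeakDerivOn_time l (hasDerivAt_exp_I_mul (-μ))
    (continuous_const.mul (continuous_exp_I_mul (-μ)))).2.2 η hη hc (subset_univ _)
  simp only [Complex.real_smul] at time
  have iT : Integrable fun p : ℝ × ℂ => ((fderiv ℝ η p (1, 0) : ℝ) : ℂ)
      * (Complex.exp (Complex.I * (-μ : ℝ) * p.1) * φ p.2) :=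
    lψ.integrable_mul_of_hasCompactSupport
      (η := fun p : ℝ × ℂ => ((fderiv ℝ η p (1, 0) : ℝ) : ℂ))
      (Complex.continuous_ofReal.comp (hcd _).continuous)
      ((hcs _).comp_left (g := fun t : ℝ => (t : ℂ)) rfl)
  have iη : Integrable fun p : ℝ × ℂ => (η p : ℂ)
      * (Complex.exp (Complex.I * (-μ : ℝ) * p.1) * φ p.2) :=
    lψ.integrable_mul_of_hasCompactSupport (η := fun p : ℝ × ℂ => (η p : ℂ))
      (Complex.continuous_ofReal.comp hη.continuous)
      (hc.comp_left (g := fun t : ℝ => (t : ℂ)) rfl)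
  have iN : Integrable fun p : ℝ × ℂ => (η p : ℂ) * (Complex.exp (Complex.I * (-μ : ℝ) * p.1)
      * ((effPot n g (dens φ) ‖p.2‖ : ℂ) * φ p.2)) :=
    lN.integrable_mul_of_hasCompactSupport (η := fun p : ℝ × ℂ => (η p : ℂ))
      (Complex.continuous_ofReal.comp hη.continuous)
      (hc.comp_left (g := fun t : ℝ => (t : ℂ)) rfl)
  have iΔ : Integrable fun p : ℝ × ℂ =>
      ((Laplacian.laplacian (fun x : ℂ => η (p.1, x)) p.2 : ℝ) : ℂ)
        * (Complex.exp (Complex.I * (-μ : ℝ) * p.1) * φ p.2) := by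
    have e : (fun p : ℝ × ℂ => Laplacian.laplacian (fun x : ℂ => η (p.1, x)) p.2)
        = fun p => fderiv ℝ (fun q => fderiv ℝ η q (0, 1)) p (0, 1)
          + fderiv ℝ (fun q => fderiv ℝ η q (0, Complex.I)) p (0, Complex.I) :=
      funext fun p => laplacian_slice hη p.1 p.2
    refine lψ.integrable_mul_of_hasCompactSupport
      (η := fun p : ℝ × ℂ => ((Laplacian.laplacian (fun x : ℂ => η (p.1, x)) p.2 : ℝ) : ℂ))
      (Complex.continuous_ofReal.comp ?_) (HasCompactSupport.comp_left
        (g := fun t : ℝ => (t : ℂ)) ?_ rfl)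
    · rw [e]
      exact (contDiff_fderiv_apply_const (hcd _) _).continuous.add
        (contDiff_fderiv_apply_const (hcd _) _).continuous
    · rw [e]
      exact (hasCompactSupport_fderiv_apply (hcs _) _).add
        (hasCompactSupport_fderiv_apply (hcs _) _)
  -- By Fubini the stationary equation is applied on each time slice, where the phase is a constant
  -- factor.
  have space : ∫ p : ℝ × ℂ, ((Laplacian.laplacian (fun x : ℂ => η (p.1, x)) p.2 : ℝ) : ℂ)
        * (Complex.exp (Complex.I * (-μ : ℝ) * p.1) * φ p.2)
      = (∫ p : ℝ × ℂ, (η p : ℂ) * (Complex.exp (Complex.I * (-μ : ℝ) * p.1)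
          * ((effPot n g (dens φ) ‖p.2‖ : ℂ) * φ p.2)))
        - μ * ∫ p : ℝ × ℂ, (η p : ℂ) * (Complex.exp (Complex.I * (-μ : ℝ) * p.1) * φ p.2) := by
    rw [← integral_const_mul, ← integral_sub iN (iη.const_mul _)]
    have i' := integrable_fun_sub iN (iη.const_mul (μ : ℂ))
    rw [Measure.volume_eq_prod] at i' iΔ ⊢
    rw [integral_prod _ iΔ, integral_prod _ i']
    refine integral_congr_ae ?_
    rw [Measure.volume_eq_prod] at iN iη
    filter_upwards [iN.prod_right_ae, iη.prod_right_ae] with t hN hη'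
    have st := stationary_equation hφ hEL (η := fun x => (η (t, x) : ℂ))
      (Complex.ofRealCLM.contDiff.comp (contDiff_slice_right hη t))
      ((hasCompactSupport_slice_right hc t).comp_left (g := fun t : ℝ => (t : ℂ)) rfl)
    simp_rw [lap_slice hη] at st
    rw [integral_sub hN (hη'.const_mul _), integral_const_mul]
    simp only [mul_left_comm _ (Complex.exp _)]
    rw [integral_const_mul, integral_const_mul, integral_const_mul, st]
    ring
  have split : ∀ p : ℝ × ℂ, (-Complex.I * ((fderiv ℝ η p (1, 0) : ℝ) : ℂ)
        + ((Laplacian.laplacian (fun x : ℂ => η (p.1, x)) p.2 : ℝ) : ℂ))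
          * (Complex.exp (Complex.I * (-μ : ℝ) * p.1) * φ p.2)
      = -Complex.I * (((fderiv ℝ η p (1, 0) : ℝ) : ℂ)
          * (Complex.exp (Complex.I * (-μ : ℝ) * p.1) * φ p.2))
        + ((Laplacian.laplacian (fun x : ℂ => η (p.1, x)) p.2 : ℝ) : ℂ)
          * (Complex.exp (Complex.I * (-μ : ℝ) * p.1) * φ p.2) := fun p => by ring
  have etime : ∀ p : ℝ × ℂ, (η p : ℂ) * (Complex.I * (-μ : ℝ)
        * Complex.exp (Complex.I * (-μ : ℝ) * p.1) * φ p.2)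
      = (Complex.I * (-μ : ℝ)) * ((η p : ℂ)
        * (Complex.exp (Complex.I * (-μ : ℝ) * p.1) * φ p.2)) := fun p => by ring
  simp_rw [etime] at time
  rw [integral_const_mul] at time
  simp_rw [split]
  rw [integral_add (iT.const_mul _) iΔ, integral_const_mul, time, space]
  push_cast
  linear_combination (-(μ : ℂ) * ∫ p : ℝ × ℂ, (η p : ℂ)
    * (Complex.exp (Complex.I * (-(μ : ℂ)) * p.1) * φ p.2)) * Complex.I_sq

theorem IsRadialDensity.tendsto_pot {q : ℝ → ℝ} {m : ℤ} (hq : IsRadialDensity m q) :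
    Tendsto (pot q) (𝓝[>] 0) (𝓝 0) := by
  obtain ⟨C, hC⟩ := hq.abs_pot_le
  refine squeeze_zero_norm' (a := fun r => C * r) ?_ ?_
  · filter_upwards [self_mem_nhdsWithin] with r hr
    have hr0 : 0 < r := hr
    have := hC r hr0
    rwa [abs_div, abs_of_pos hr0, div_le_iff₀ hr0] at this
  · have : Tendsto (fun r : ℝ => C * r) (𝓝 0) (𝓝 (C * 0)) :=
      (continuous_const.mul continuous_id).tendsto 0
    rw [mul_zero] at this
    exact this.mono_left nhdsWithin_le_nhds

theorem IsRadialDensity.tendsto_potZ {q : ℝ → ℝ} {m : ℤ} (hq : IsRadialDensity m q) :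
    Tendsto (potZ m q) atTop (𝓝 0) := by
  have h1 := intervalIntegral_tendsto_integral_Ioi 0 hq.integrableOn_potZ tendsto_id
  have h2 := (h1.sub_const (∫ s in Ioi 0, (m + pot q s) / s * q s))
  rw [sub_self] at h2
  refine h2.congr' ?_
  filter_upwards [eventually_ge_atTop 0] with r hr
  have := intervalIntegral.integral_Ioi_sub_Ioi (hq.integrableOn_potZ) hr
  simp only [id, potZ]
  linarith

theorem IsRadialDensity.locallyIntegrable_pot_norm {q : ℝ → ℝ} {m : ℤ}
    (hq : IsRadialDensity m q) : LocallyIntegrable fun x : ℂ => pot q ‖x‖ := by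
  obtain ⟨C, hC⟩ := hq.abs_pot_le
  have hm : AEStronglyMeasurable fun x : ℂ => pot q ‖x‖ := by
    have := aestronglyMeasurable_radial
      (Complex.continuous_ofReal.comp_aestronglyMeasurable hq.aestronglyMeasurable_pot)
    exact Complex.continuous_re.comp_aestronglyMeasurable this
  have hl : LocallyIntegrable fun x : ℂ => C * ‖x‖ :=
    (continuous_const.mul continuous_norm).locallyIntegrable
  refine hl.mono hm ?_
  filter_upwards [ae_ne_zero] with x hx
  have hr0 := norm_pos_iff.2 hx
  have := hC _ hr0
  rw [abs_div, abs_of_pos hr0, div_le_iff₀ hr0] at this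
  exact this.trans (le_abs_self _)

/-- A solution of the Euler-Lagrange equation generates a standing wave. -/
theorem isWeakSolution_of_euler_lagrange (hφ : MemH1m n φ) {μ : ℝ}
    (hEL : ∀ h : ℂ → ℂ, MemH1m n h →
      dirichletForm φ h + (∫ x : ℂ, (effPot n g (dens φ) ‖x‖ : ℂ) * (conj (φ x) * h x))
        = μ * ∫ x, conj (φ x) * h x) :
    IsWeakSolution n g
      (fun p : ℝ × ℂ => Complex.exp (Complex.I * (-μ : ℝ) * p.1) * φ p.2)
      (fun q : ℝ × ℝ => potTheta φ q.2) (fun q : ℝ × ℝ => potZero n φ q.2) where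
  locallyIntegrable := locallyIntegrable_phase_mul hφ.2.locallyIntegrable _
  memH1m t := hφ.const_mul (Complex.exp (Complex.I * (-μ : ℝ) * t))
  bounded := ⟨h1NormSq φ, fun t => (h1NormSq_const_mul hφ.2 (norm_exp_I_mul_mul _ t)).le⟩
  nonlinearity_locallyIntegrable := by
    simp_rw [nonlinearity_eq hφ (norm_exp_I_mul_mul _ _)]
    exact locallyIntegrable_phase_mul (locallyIntegrable_effPot_mul hφ) _
  evolution η hη hc := by
    simp_rw [nonlinearity_eq hφ (norm_exp_I_mul_mul _ _)]
    exact evolution_equation hφ hEL hη hc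
  deriv_r_A₀ := by
    have := hφ.isRadialDensity.isPrimitive_potZ.hasWeakDerivOn_prod
    convert this using 2 with q q
    · rfl
    rw [norm_mul, norm_exp_I_mul_mul, one_mul, dens, one_div_mul_eq_div]
    rfl
  deriv_t_Aθ := by
    have h₁ := hφ.2.hasWeakDerivOn_one.prod_mul (continuous_exp_I_mul (-μ))
    have h₂ := hφ.2.hasWeakDerivOn_I.prod_mul (continuous_exp_I_mul (-μ))
    rw [univ_prod_univ] at h₁ h₂
    refine ⟨_, _, h₁, h₂, ?_⟩
    have h := hasWeakDerivOn_time hφ.isRadialDensity.locallyIntegrable_pot_norm (c := fun _ => 1)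
      (c' := fun _ => 0) (fun t => hasDerivAt_const t 1) continuous_const
    simp only [one_mul, zero_mul] at h
    refine h.congr_right ?_
    -- Since `A_θ` is independent of time, its weak time derivative is 0. It remains to see that the
    -- right-hand side is null: the phase cancels in the current of the wave, which is that of `φ`.
    have hJ : ∀ᵐ p : ℝ × ℂ, current φ p.2 = 0 :=
      Measure.quasiMeasurePreserving_snd.ae (current_ae_zero hφ hEL)
    filter_upwards [hJ] with p hp
    set c := Complex.exp (Complex.I * (-μ : ℝ) * p.1) with hcdef
    have hc : conj c * c = 1 := by
      rw [← Complex.normSq_eq_conj_mul_self, Complex.normSq_eq_norm_sq, norm_exp_I_mul_mul]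
      simp
    have e : conj (c * φ p.2) * radialDeriv p.2 (c * weakDeriv 1 φ p.2)
          (c * weakDeriv Complex.I φ p.2)
        = conj (φ p.2) * radialDeriv p.2 (weakDeriv 1 φ p.2) (weakDeriv Complex.I φ p.2) := by
      simp only [radialDeriv, map_mul]
      linear_combination (conj (φ p.2) * (((p.2.re : ℂ) * weakDeriv 1 φ p.2
        + (p.2.im : ℂ) * weakDeriv Complex.I φ p.2) / (‖p.2‖ : ℂ))) * hc
    rw [e]
    rw [current] at hp
    rw [hp, mul_zero]
  deriv_r_Aθ := by
    have := hφ.isRadialDensity.isPrimitive_pot.hasWeakDerivOn_prod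
    convert this using 2 with q q
    · rfl
    rw [norm_mul, norm_exp_I_mul_mul, one_mul, dens, mul_assoc]
  Aθ_zero _ := hφ.isRadialDensity.tendsto_pot
  A₀_infinity _ := hφ.isRadialDensity.tendsto_potZ

end StandingWave

end EquivariantCSS

end

theorem lemma7p7 (m : ℤ) (hm : 0 ≤ m) (g : ℝ) (hg : 1 < g)
    (φ : ℂ → ℂ) (hφ : EquivariantCSS.MemH1m m φ) (hφ0 : ¬ φ =ᵐ[volume] 0)
    (hE : EquivariantCSS.energy m g φ = 0)
    (hmin : ∀ f : ℂ → ℂ, EquivariantCSS.MemH1m m f → ¬ f =ᵐ[volume] 0 →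
      EquivariantCSS.energy m g f = 0 → EquivariantCSS.charge φ ≤ EquivariantCSS.charge f) :
    ∃ lam : ℝ, EquivariantCSS.IsWeakSolution m g
      (fun p : ℝ × ℂ => Complex.exp (Complex.I * lam * p.1) * φ p.2)
      (fun q : ℝ × ℝ => EquivariantCSS.potTheta φ q.2)
      (fun q : ℝ × ℝ => EquivariantCSS.potZero m φ q.2) := by
  obtain ⟨n, rfl⟩ := Int.eq_ofNat_of_zero_le hm
  obtain ⟨μ, hμ⟩ := EquivariantCSS.exists_euler_lagrange hφ hφ0 hE hmin
  -- The sign comes from `i ∂_t e^{iλt} = -λ e^{iλt}` together with `-Δφ + Vφ = μφ`.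
  exact ⟨-μ, EquivariantCSS.isWeakSolution_of_euler_lagrange hφ hμ⟩
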